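/- For a prime $p$ let $v_p$ be the $p$-adic valuation, with $v_p(0)=\infty$, and let $\left(\frac{\cdot}{p}\right)$ be the Legendre symbol. For each $T\in\{C_3,C_5,C_6,C_7,C_9,C_{10},C_{12},C_2\times C_6\}$ let $E_T=E_T(a,b)$ be the curve $y^2+a_1xy+a_3y=x^3+a_2x^2$ over $\mathbb{Q}$ with - $C_3$: $a_1=a$, $a_2=0$, $a_3=a^2b$; - $C_5$: $a_1=a-b$, $a_2=-ab$, $a_3=-a^2b$; - $C_6$: $a_1=a-b$, $a_2=-ab-b^2$, $a_3=-a^2b-ab^2$; - $C_7$: $a_1=a^2+ab-b^2$, $a_2=a^2b^2-ab^3$, $a_3=a^4b^2-a^3b^3$; - $C_9$: $a_1=a^3+ab^2-b^3$, $a_2=a^4b^2-2a^3b^3+2a^2b^4-ab^5$, $a_3=a^3a_2$; - $C_{10}$: $a_1=a^3-2a^2b-2ab^2+2b^3$, $a_2=-a^3b^3+3a^2b^4-2ab^5$, $a_3=(a^3-3a^2b+ab^2)a_2$; - $C_{12}$: $a_1=-a^4+2a^3b+2a^2b^2-8ab^3+6b^4$, $a_2=b(a-2b)(a-b)^2(a^2-3ab+3b^2)(a^2-2ab+2b^2)$,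 $a_3=a(b-a)^3a_2$; - $C_2\times C_6$: $a_1=-19a^2+2ab+b^2$, $a_2=-10a^4+22a^3b-14a^2b^2+2ab^3$, $a_3=90a^6-198a^5b+116a^4b^2+4a^3b^3-14a^2b^4+2ab^5$. Let $a,b$ be coprime integers such that $E_T$ is an elliptic curve (nonzero discriminant), let $p$ be a prime and $n$ a non-negative integer. Say that $E_T$ has multiplicative reduction of Néron type $\mathrm{I}_n$ at $p$ if a minimal model over $\mathbb{Q}_p$ has $v_p(\Delta)=n>0$ and $v_p(c_4)=0$; it is split if the slopes of the tangent lines at the node of the reduced curve lie in $\mathbb{F}_p$, and non-split otherwise. **Theorem.** $E_T$ has multiplicative reduction of Néron type $\mathrm{I}_n$ at $p$ if and only if $n>0$ and $(a,b,p,n)$ satisfies one of the rows listed below for $T$. The reduction is moreover split if and only if $n>0$ and a row labeled S is satisfied, and non-split if and only if $n>0$ and a row labeled NS is satisfied. (In a row "S if $X$, NS if $Y$", the conditions $X$ and $Y$ give one row labeled S and one labeled NS.) $T=C_3$: - all $p$: $n=3v_p(b)$; S. - $p\ne3$: $n=v_p(a-27b)$; S if $p\equiv1\bmod 6$, NS if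 $p\equiv5\bmod 6$ or $p=2$. $T=C_5$: - all $p$: $n=5v_p(ab)$; S. - $p\ge7$: $n=v_p(a^2+11ab-b^2)$; S if $\left(\frac{-5(a^2+b^2)}{p}\right)=1$, NS if it is $-1$. $T=C_6$: - all $p$: $n=6v_p(b)$; S. - $p\ne3$: $n=2v_p(a)$; S if $p\equiv1\bmod6$, NS if $p\equiv5\bmod6$ or $p=2$. - $p>3$: $n=v_p(a+9b)$; S if $p\equiv1\bmod6$, NS if $p\equiv5\bmod6$. - $p\ge3$, with $v_3(a)=0$ if $p=3$: $n=3v_p(a+b)$; S. - $p=2$, $v_2(a+b)=3$: $n=v_2(a+9b)-3$; NS. - $p=2$, $v_2(a+b)>3$: $n=3v_2(a+b)-9$; S. $T=C_7$: - all $p$: $n=7v_p(ab(a-b))$; S. - $p\ge13$: $n=v_p(a^3+5a^2b-8ab^2+b^3)$; S if $\left(\frac{-7(a^2-ab+b^2)}{p}\right)=1$, NS if it is $-1$. $T=C_9$: - all $p$: $n=9v_p(ab(a-b))$; S. - $p\ge7$: $n=3v_p(a^2-ab+b^2)+v_p(a^3+3a^2b-6ab^2+b^3)$; S if $p\equiv1\bmod6$,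 NS if $p\equiv5\bmod6$. $T=C_{10}$: - all $p$, with $v_2(a)=0$ if $p=2$: $n=v_p(a^5b^{10}(a-2b)^5(a-b)^{10})$; S. - $p=2$, $v_2(a)>0$: $n=v_2(a^5(a-2b)^5)+v_2(a^2+2ab-4b^2)-12$; S. - $p\ge7$: $n=v_p(a^2+2ab-4b^2)$; S if $\left(\frac{b^2-a^2}{p}\right)=1$, NS if it is $-1$. - $p\ge7$: $n=2v_p(a^2-3ab+b^2)$; S if $\left(\frac{-(ab+b^2)}{p}\right)=1$, NS if it is $-1$. $T=C_{12}$: - all $p$, with $v_2(a)=0$ if $p=2$ and $v_3(a)=0$ if $p=3$: $n=v_p(b^{12}(a-b)^{12}(a-2b)^6)$; S. - $p=2$, $v_2(a)=1$: $n=6v_2(a-2b)-6$; S. - $p=2$, $v_2(a)\ge2$: $n=2v_2(a)-2$; NS. - $p\ge5$: $n=2v_p(a)+v_p(a^2-6ab+6b^2)$; S if $p\equiv1\bmod6$, NS if $p\equiv5\bmod6$. - $p\ge5$: $n=3v_p(a^2-2ab+2b^2)+4v_p(a^2-3ab+3b^2)$; S. $T=C_2\times C_6$: - all $p$, with $v_3(b)=0$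 if $p=3$ and $v_2(a+b)=0$ if $p=2$: $n=6v_p(2a(b-5a)(b-a))$; S. - $p\ge5$: $n=2v_p((b^2-9a^2)(b-9a))$; S if $p\equiv1\bmod6$, NS if $p\equiv5\bmod6$. - $p=2$, $v_2(a-b)=2$: $n=6v_2(b-5a)+2v_2(b+3a)-24$; NS if $ab-b^2\equiv4\bmod16$, S if $ab-b^2\equiv12\bmod16$. - $p=2$, $v_2(a-b)\ge4$: $n=6v_2(b-a)-18$; S. - $p=2$, $v_2(a-b)=3$: $n=2v_2(b-9a)-6$; NS. - $p=2$, $v_2(a-b)=1$: $n=2v_2(b-3a)-2$; NS. -/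

import Mathlib

/-- The eight torsion families considered here: every torsion group over `ℚ` with a non-trivial
point of odd order, the family with `j`-invariant `0` (that is, `y² + a y = x³`) left out. -/
inductive OddTorsionFamily
  | C3 | C5 | C6 | C7 | C9 | C10 | C12 | C2xC6

/-- The label of a row of the table: split (`S`) or non-split (`NS`). -/
inductive ReductionLabel
  | S | NS

/-- The coefficient `a₁` of the parametrized model `y² + a₁ x y + a₃ y = x³ + a₂ x²`. -/
def OddTorsionFamily.coeffA₁ : OddTorsionFamily → ℤ → ℤ → ℤ
  | .C3, a, _ => a
  | .C5, a, b => a - b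
  | .C6, a, b => a - b
  | .C7, a, b => a ^ 2 + a * b - b ^ 2
  | .C9, a, b => a ^ 3 + a * b ^ 2 - b ^ 3
  | .C10, a, b => a ^ 3 - 2 * a ^ 2 * b - 2 * a * b ^ 2 + 2 * b ^ 3
  | .C12, a, b => -a ^ 4 + 2 * a ^ 3 * b + 2 * a ^ 2 * b ^ 2 - 8 * a * b ^ 3 + 6 * b ^ 4
  | .C2xC6, a, b => -19 * a ^ 2 + 2 * a * b + b ^ 2

/-- The coefficient `a₂` of the parametrized model `y² + a₁ x y + a₃ y = x³ + a₂ x²`. -/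
def OddTorsionFamily.coeffA₂ : OddTorsionFamily → ℤ → ℤ → ℤ
  | .C3, _, _ => 0
  | .C5, a, b => -(a * b)
  | .C6, a, b => -(a * b) - b ^ 2
  | .C7, a, b => a ^ 2 * b ^ 2 - a * b ^ 3
  | .C9, a, b => a ^ 4 * b ^ 2 - 2 * a ^ 3 * b ^ 3 + 2 * a ^ 2 * b ^ 4 - a * b ^ 5
  | .C10, a, b => -(a ^ 3 * b ^ 3) + 3 * a ^ 2 * b ^ 4 - 2 * a * b ^ 5
  | .C12, a, b => b * (a - 2 * b) * (a - b) ^ 2 * (a ^ 2 - 3 * a * b + 3 * b ^ 2) *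
      (a ^ 2 - 2 * a * b + 2 * b ^ 2)
  | .C2xC6, a, b => -10 * a ^ 4 + 22 * a ^ 3 * b - 14 * a ^ 2 * b ^ 2 + 2 * a * b ^ 3

/-- The coefficient `a₃` of the parametrized model `y² + a₁ x y + a₃ y = x³ + a₂ x²`. -/
def OddTorsionFamily.coeffA₃ : OddTorsionFamily → ℤ → ℤ → ℤ
  | .C3, a, b => a ^ 2 * b
  | .C5, a, b => -(a ^ 2 * b)
  | .C6, a, b => -(a ^ 2 * b) - a * b ^ 2
  | .C7, a, b => a ^ 4 * b ^ 2 - a ^ 3 * b ^ 3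
  | .C9, a, b => a ^ 3 * OddTorsionFamily.C9.coeffA₂ a b
  | .C10, a, b => (a ^ 3 - 3 * a ^ 2 * b + a * b ^ 2) * OddTorsionFamily.C10.coeffA₂ a b
  | .C12, a, b => a * (b - a) ^ 3 * OddTorsionFamily.C12.coeffA₂ a b
  | .C2xC6, a, b => 90 * a ^ 6 - 198 * a ^ 5 * b + 116 * a ^ 4 * b ^ 2 + 4 * a ^ 3 * b ^ 3 -
      14 * a ^ 2 * b ^ 4 + 2 * a * b ^ 5

/-- The curve `E_T(a, b) : y² + a₁ x y + a₃ y = x³ + a₂ x²` over `ℚ`. -/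
def OddTorsionFamily.curve (T : OddTorsionFamily) (a b : ℤ) : WeierstrassCurve ℚ where
  a₁ := T.coeffA₁ a b
  a₂ := T.coeffA₂ a b
  a₃ := T.coeffA₃ a b
  a₄ := 0
  a₆ := 0

/-- `W` has multiplicative reduction at `p` of Néron type `Iₙ`: some minimal model of `W` over
`ℚ_p` (any two have the same reduction) satisfies `v_p(Δ) > 0` and `v_p(c₄) = 0`, and the
valuation of its discriminant is `n`. -/
def HasMultiplicativeReductionOfType (W : WeierstrassCurve ℚ) (p : ℕ) [Fact p.Prime] (n : ℕ) :
    Prop :=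
  ∃ C : WeierstrassCurve.VariableChange ℚ_[p],
    (C • W.baseChange ℚ_[p]).HasMultiplicativeReduction ℤ_[p] ∧
    (C • W.baseChange ℚ_[p]).Δ.valuation = (n : ℤ)

/-- As `HasMultiplicativeReductionOfType`, the reduction being split: the slopes of the tangent
lines at the node of the reduced curve lie in the residue field. -/
def HasSplitMultiplicativeReductionOfType (W : WeierstrassCurve ℚ) (p : ℕ) [Fact p.Prime]
    (n : ℕ) : Prop :=
  ∃ C : WeierstrassCurve.VariableChange ℚ_[p],
    (C • W.baseChange ℚ_[p]).HasSplitMultiplicativeReduction ℤ_[p] ∧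
    (C • W.baseChange ℚ_[p]).Δ.valuation = (n : ℤ)

/-- As `HasMultiplicativeReductionOfType`, the reduction being non-split (multiplicative, but not
split). -/
def HasNonsplitMultiplicativeReductionOfType (W : WeierstrassCurve ℚ) (p : ℕ) [Fact p.Prime]
    (n : ℕ) : Prop :=
  ∃ C : WeierstrassCurve.VariableChange ℚ_[p],
    (C • W.baseChange ℚ_[p]).HasMultiplicativeReduction ℤ_[p] ∧
    ¬ (C • W.baseChange ℚ_[p]).HasSplitMultiplicativeReduction ℤ_[p] ∧
    (C • W.baseChange ℚ_[p]).Δ.valuation = (n : ℤ)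

/-- The `p`-adic valuation of an integer, with `v_p(0) = ∞`. -/
noncomputable def intVal (p : ℕ) (x : ℤ) : ℕ∞ := emultiplicity (p : ℤ) x

/-- The table of multiplicative reduction (the requirement `n > 0` is stated separately).
Each disjunct is one row: label, prime(s), value of `n`, additional condition.
A subtracted constant in the value of `n` is moved to the left-hand side. -/
def MultRedTable (T : OddTorsionFamily) (p : ℕ) [Fact p.Prime] (a b : ℤ) (n : ℕ)
    (ℓ : ReductionLabel) : Prop :=
  match T with
  | .C3 =>
      (ℓ = .S ∧ n = 3 * intVal p b) ∨
      (ℓ = .S ∧ p ≠ 3 ∧ n = intVal p (a - 27 * b) ∧ p ≡ 1 [MOD 6]) ∨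
      (ℓ = .NS ∧ p ≠ 3 ∧ n = intVal p (a - 27 * b) ∧ (p ≡ 5 [MOD 6] ∨ p = 2))
  | .C5 =>
      (ℓ = .S ∧ n = 5 * intVal p (a * b)) ∨
      (ℓ = .S ∧ 7 ≤ p ∧ n = intVal p (a ^ 2 + 11 * a * b - b ^ 2) ∧
        legendreSym p (-5 * (a ^ 2 + b ^ 2)) = 1) ∨
      (ℓ = .NS ∧ 7 ≤ p ∧ n = intVal p (a ^ 2 + 11 * a * b - b ^ 2) ∧
        legendreSym p (-5 * (a ^ 2 + b ^ 2)) = -1)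
  | .C6 =>
      (ℓ = .S ∧ n = 6 * intVal p b) ∨
      (ℓ = .S ∧ p ≠ 3 ∧ n = 2 * intVal p a ∧ p ≡ 1 [MOD 6]) ∨
      (ℓ = .NS ∧ p ≠ 3 ∧ n = 2 * intVal p a ∧ (p ≡ 5 [MOD 6] ∨ p = 2)) ∨
      (ℓ = .S ∧ 3 < p ∧ n = intVal p (a + 9 * b) ∧ p ≡ 1 [MOD 6]) ∨
      (ℓ = .NS ∧ 3 < p ∧ n = intVal p (a + 9 * b) ∧ p ≡ 5 [MOD 6]) ∨
      (ℓ = .S ∧ 3 ≤ p ∧ n = 3 * intVal p (a + b) ∧ (p = 3 → intVal 3 a = 0)) ∨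
      (ℓ = .NS ∧ p = 2 ∧ n + 3 = intVal 2 (a + 9 * b) ∧ intVal 2 (a + b) = 3) ∨
      (ℓ = .S ∧ p = 2 ∧ n + 9 = 3 * intVal 2 (a + b) ∧ 3 < intVal 2 (a + b))
  | .C7 =>
      (ℓ = .S ∧ n = 7 * intVal p (a * b * (a - b))) ∨
      (ℓ = .S ∧ 13 ≤ p ∧ n = intVal p (a ^ 3 + 5 * a ^ 2 * b - 8 * a * b ^ 2 + b ^ 3) ∧
        legendreSym p (-7 * (a ^ 2 - a * b + b ^ 2)) = 1) ∨
      (ℓ = .NS ∧ 13 ≤ p ∧ n = intVal p (a ^ 3 + 5 * a ^ 2 * b - 8 * a * b ^ 2 + b ^ 3) ∧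
        legendreSym p (-7 * (a ^ 2 - a * b + b ^ 2)) = -1)
  | .C9 =>
      (ℓ = .S ∧ n = 9 * intVal p (a * b * (a - b))) ∨
      (ℓ = .S ∧ 7 ≤ p ∧
        n = 3 * intVal p (a ^ 2 - a * b + b ^ 2) +
          intVal p (a ^ 3 + 3 * a ^ 2 * b - 6 * a * b ^ 2 + b ^ 3) ∧
        p ≡ 1 [MOD 6]) ∨
      (ℓ = .NS ∧ 7 ≤ p ∧
        n = 3 * intVal p (a ^ 2 - a * b + b ^ 2) +
          intVal p (a ^ 3 + 3 * a ^ 2 * b - 6 * a * b ^ 2 + b ^ 3) ∧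
        p ≡ 5 [MOD 6])
  | .C10 =>
      (ℓ = .S ∧ n = intVal p (a ^ 5 * b ^ 10 * (a - 2 * b) ^ 5 * (a - b) ^ 10) ∧
        (p = 2 → intVal 2 a = 0)) ∨
      (ℓ = .S ∧ p = 2 ∧
        n + 12 = intVal 2 (a ^ 5 * (a - 2 * b) ^ 5) + intVal 2 (a ^ 2 + 2 * a * b - 4 * b ^ 2) ∧
        0 < intVal 2 a) ∨
      (ℓ = .S ∧ 7 ≤ p ∧ n = intVal p (a ^ 2 + 2 * a * b - 4 * b ^ 2) ∧
        legendreSym p (b ^ 2 - a ^ 2) = 1) ∨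
      (ℓ = .NS ∧ 7 ≤ p ∧ n = intVal p (a ^ 2 + 2 * a * b - 4 * b ^ 2) ∧
        legendreSym p (b ^ 2 - a ^ 2) = -1) ∨
      (ℓ = .S ∧ 7 ≤ p ∧ n = 2 * intVal p (a ^ 2 - 3 * a * b + b ^ 2) ∧
        legendreSym p (-(a * b + b ^ 2)) = 1) ∨
      (ℓ = .NS ∧ 7 ≤ p ∧ n = 2 * intVal p (a ^ 2 - 3 * a * b + b ^ 2) ∧
        legendreSym p (-(a * b + b ^ 2)) = -1)
  | .C12 =>
      (ℓ = .S ∧ n = intVal p (b ^ 12 * (a - b) ^ 12 * (a - 2 * b) ^ 6) ∧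
        (p = 2 → intVal 2 a = 0) ∧ (p = 3 → intVal 3 a = 0)) ∨
      (ℓ = .S ∧ p = 2 ∧ n + 6 = 6 * intVal 2 (a - 2 * b) ∧ intVal 2 a = 1) ∨
      (ℓ = .NS ∧ p = 2 ∧ n + 2 = 2 * intVal 2 a ∧ 2 ≤ intVal 2 a) ∨
      (ℓ = .S ∧ 5 ≤ p ∧ n = 2 * intVal p a + intVal p (a ^ 2 - 6 * a * b + 6 * b ^ 2) ∧
        p ≡ 1 [MOD 6]) ∨
      (ℓ = .NS ∧ 5 ≤ p ∧ n = 2 * intVal p a + intVal p (a ^ 2 - 6 * a * b + 6 * b ^ 2) ∧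
        p ≡ 5 [MOD 6]) ∨
      (ℓ = .S ∧ 5 ≤ p ∧
        n = 3 * intVal p (a ^ 2 - 2 * a * b + 2 * b ^ 2) +
          4 * intVal p (a ^ 2 - 3 * a * b + 3 * b ^ 2))
  | .C2xC6 =>
      (ℓ = .S ∧ n = 6 * intVal p (2 * a * (b - 5 * a) * (b - a)) ∧
        (p = 3 → intVal 3 b = 0) ∧ (p = 2 → intVal 2 (a + b) = 0)) ∨
      (ℓ = .S ∧ 5 ≤ p ∧ n = 2 * intVal p ((b ^ 2 - 9 * a ^ 2) * (b - 9 * a)) ∧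
        p ≡ 1 [MOD 6]) ∨
      (ℓ = .NS ∧ 5 ≤ p ∧ n = 2 * intVal p ((b ^ 2 - 9 * a ^ 2) * (b - 9 * a)) ∧
        p ≡ 5 [MOD 6]) ∨
      (ℓ = .NS ∧ p = 2 ∧ n + 24 = 6 * intVal 2 (b - 5 * a) + 2 * intVal 2 (b + 3 * a) ∧
        intVal 2 (a - b) = 2 ∧ a * b - b ^ 2 ≡ 4 [ZMOD 16]) ∨
      (ℓ = .S ∧ p = 2 ∧ n + 24 = 6 * intVal 2 (b - 5 * a) + 2 * intVal 2 (b + 3 * a) ∧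
        intVal 2 (a - b) = 2 ∧ a * b - b ^ 2 ≡ 12 [ZMOD 16]) ∨
      (ℓ = .S ∧ p = 2 ∧ n + 18 = 6 * intVal 2 (b - a) ∧ 4 ≤ intVal 2 (a - b)) ∨
      (ℓ = .NS ∧ p = 2 ∧ n + 6 = 2 * intVal 2 (b - 9 * a) ∧ intVal 2 (a - b) = 3) ∨
      (ℓ = .NS ∧ p = 2 ∧ n + 2 = 2 * intVal 2 (b - 3 * a) ∧ intVal 2 (a - b) = 1)

open WeierstrassCurve IsDedekindDomain.HeightOneSpectrum

/-! ### Minimal models and split nodes over `ℤ_[p]`. -/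

section Reduction

variable {p : ℕ} [Fact p.Prime]

lemma valuation_algebraMap_eq_one_iff (r : ℤ_[p]) :
    valuation ℚ_[p] (IsDiscreteValuationRing.maximalIdeal ℤ_[p]) (algebraMap ℤ_[p] ℚ_[p] r) = 1 ↔
      IsUnit r := by
  rw [valuation_eq_one_iff_notMem]
  change r ∉ IsLocalRing.maximalIdeal ℤ_[p] ↔ _
  simp

lemma valuation_algebraMap_lt_one_iff (r : ℤ_[p]) :
    valuation ℚ_[p] (IsDiscreteValuationRing.maximalIdeal ℤ_[p]) (algebraMap ℤ_[p] ℚ_[p] r) < 1 ↔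
      ¬ IsUnit r := by
  rw [← valuation_algebraMap_eq_one_iff, lt_iff_le_and_ne]
  exact and_iff_right (valuation_le_one _ _)

/-- An integral model with unit `c₄` is minimal. -/
lemma isMinimal_of_isUnit_c₄ (I : WeierstrassCurve ℤ_[p]) (h : IsUnit I.c₄) :
    IsMinimal ℤ_[p] (I.map (algebraMap ℤ_[p] ℚ_[p])) := by
  have hI : IsIntegral ℤ_[p] (I.map (algebraMap ℤ_[p] ℚ_[p])) := ⟨I, rfl⟩
  refine ⟨⟨by simpa using hI, fun C hC _ ↦ ?_⟩⟩
  beta_reduce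
  rw [one_smul, ← Subtype.coe_le_coe, valuation_Δ_aux_eq_of_isIntegral,
    valuation_Δ_aux_eq_of_isIntegral, variableChange_Δ, map_mul, map_pow]
  refine mul_le_of_le_one_left' (pow_le_one' ?_ 12)
  obtain ⟨J, hJ⟩ := hC
  have h4 : valuation ℚ_[p] (IsDiscreteValuationRing.maximalIdeal ℤ_[p])
      (C • I.map (algebraMap ℤ_[p] ℚ_[p])).c₄ ≤ 1 := by
    rw [hJ, baseChange, map_c₄]
    exact valuation_le_one _ _
  -- As `c₄` is a unit, integrality of `u⁻⁴ c₄` makes `u⁻¹` integral, so the factor `u⁻¹²` cannot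
  -- lower the additive valuation of the discriminant.
  rw [variableChange_c₄, map_mul, map_c₄, (valuation_algebraMap_eq_one_iff _).2 h, mul_one,
    map_pow] at h4
  exact (pow_le_one_iff (by norm_num)).1 h4

/-- Minimality disappears from the criterion because a unit `c₄` forces it. -/
lemma hasMultiplicativeReduction_iff_exists (V : WeierstrassCurve ℚ_[p]) :
    V.HasMultiplicativeReduction ℤ_[p] ↔
      ∃ I : WeierstrassCurve ℤ_[p], V = I.map (algebraMap ℤ_[p] ℚ_[p]) ∧
        IsUnit I.c₄ ∧ ¬ IsUnit I.Δ := by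
  constructor
  · intro h
    refine ⟨V.integralModel ℤ_[p], (baseChange_integralModel_eq ℤ_[p] V).symm, ?_, ?_⟩
    · rw [← valuation_algebraMap_eq_one_iff, integralModel_c₄_eq]
      exact h.multiplicativeReduction
    · rw [← valuation_algebraMap_lt_one_iff, integralModel_Δ_eq]
      exact h.badReduction
  · rintro ⟨I, rfl, h4, hΔ⟩
    have := isMinimal_of_isUnit_c₄ I h4
    refine ⟨?_, ?_⟩
    · rwa [map_Δ, valuation_algebraMap_lt_one_iff]
    · rwa [map_c₄, valuation_algebraMap_eq_one_iff]

/-- The tangent lines at the node of a nodal Weierstrass curve have slopes in the base. -/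
def WeierstrassCurve.NodeSplits {F : Type*} [CommRing F] (W : WeierstrassCurve F) : Prop :=
  ∃ t : F, W.c₄ * t ^ 2 + W.a₁ * W.c₄ * t - (54 * W.b₆ - 3 * W.b₂ * W.b₄ + W.a₂ * W.c₄) = 0

lemma nodeSplits_map_equiv {F G : Type*} [CommRing F] [CommRing G] (e : F ≃+* G)
    (W : WeierstrassCurve F) : (W.map (e : F →+* G)).NodeSplits ↔ W.NodeSplits := by
  constructor
  · rintro ⟨t, ht⟩
    refine ⟨e.symm t, e.injective ?_⟩
    simpa [map_ofNat e] using ht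
  · rintro ⟨t, ht⟩
    refine ⟨e t, ?_⟩
    simpa [map_ofNat e] using congrArg e ht

/-- The tangent polynomial stays quadratic over the residue field because `c₄` is a unit, and a
quadratic splits as soon as it has one root. -/
lemma hasSplitMultiplicativeReduction_iff_nodeSplits (I : WeierstrassCurve ℤ_[p])
    (h : (I.map (algebraMap ℤ_[p] ℚ_[p])).HasMultiplicativeReduction ℤ_[p]) :
    (I.map (algebraMap ℤ_[p] ℚ_[p])).HasSplitMultiplicativeReduction ℤ_[p] ↔
      (I.map (PadicInt.toZMod (p := p))).NodeSplits := by
  rw [hasSplitMultiplicativeReduction_iff]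
  have hI : integralModel ℤ_[p] (I.map (algebraMap ℤ_[p] ℚ_[p])) = I :=
    WeierstrassCurve.map_injective (IsFractionRing.injective ℤ_[p] ℚ_[p])
      (baseChange_integralModel_eq ℤ_[p] _)
  have h4 : IsUnit I.c₄ := by
    have := h.multiplicativeReduction
    rwa [map_c₄, valuation_algebraMap_eq_one_iff] at this
  have hk : IsLocalRing.residue ℤ_[p] I.c₄ ≠ 0 := by
    rw [Ne, IsLocalRing.residue_eq_zero_iff]
    simpa using h4
  rw [PadicInt.toZMod_eq_residueField_comp_residue, ← map_map]
  refine Iff.trans ?_ (nodeSplits_map_equiv PadicInt.residueField _).symm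
  simp only [h, exists_true_left, hI]
  set f := IsLocalRing.residue ℤ_[p]
  have hP := Polynomial.natDegree_quadratic (b := f (I.a₁ * I.c₄))
    (c := -f (54 * I.b₆ - 3 * I.b₂ * I.b₄ + I.a₂ * I.c₄)) hk
  have hP' : (Polynomial.C I.c₄ * Polynomial.X ^ 2 + Polynomial.C (I.a₁ * I.c₄) * Polynomial.X -
      Polynomial.C (54 * I.b₆ - 3 * I.b₂ * I.b₄ + I.a₂ * I.c₄)).map
        (algebraMap ℤ_[p] (IsLocalRing.ResidueField ℤ_[p])) =
      Polynomial.C (f I.c₄) * Polynomial.X ^ 2 + Polynomial.C (f (I.a₁ * I.c₄)) * Polynomial.X +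
      Polynomial.C (-f (54 * I.b₆ - 3 * I.b₂ * I.b₄ + I.a₂ * I.c₄)) := by
    simp only [Polynomial.map_add, Polynomial.map_sub, Polynomial.map_mul, Polynomial.map_pow,
      Polynomial.map_C, Polynomial.map_X, Polynomial.C_neg, ← sub_eq_add_neg]
    rfl
  rw [hP']
  have key (t) : Polynomial.eval t (Polynomial.C (f I.c₄) * Polynomial.X ^ 2 +
      Polynomial.C (f (I.a₁ * I.c₄)) * Polynomial.X +
      Polynomial.C (-f (54 * I.b₆ - 3 * I.b₂ * I.b₄ + I.a₂ * I.c₄))) = 0 ↔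
      (I.map f).c₄ * t ^ 2 + (I.map f).a₁ * (I.map f).c₄ * t -
        (54 * (I.map f).b₆ - 3 * (I.map f).b₂ * (I.map f).b₄ +
          (I.map f).a₂ * (I.map f).c₄) = 0 := by
    simp [sub_eq_add_neg, map_ofNat f]
  constructor
  · intro hs
    obtain ⟨t, ht⟩ := hs.exists_eval_eq_zero fun hd ↦ 
      absurd (hP.symm.trans (Polynomial.natDegree_eq_zero_iff_degree_le_zero.2 hd.le)) two_ne_zero
    exact ⟨t, (key t).1 ht⟩
  · rintro ⟨t, ht⟩
    exact Polynomial.Splits.of_natDegree_eq_two hP ((key t).2 ht)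

/-- The node has abscissa `x = (18 b₆ - b₂ b₄) / c₄` and its slopes satisfy `t² + a₁ t - (a₂ + 3x) =
0`. `NodeSplits` uses `c₄` times this quadratic, and the right-hand side is its discriminant. -/
lemma neg_c₄_mul_c₆_eq {F : Type*} [CommRing F] (W : WeierstrassCurve F) :
    -(W.c₄ * W.c₆) = (W.a₁ * W.c₄) ^ 2 +
      4 * W.c₄ * (54 * W.b₆ - 3 * W.b₂ * W.b₄ + W.a₂ * W.c₄) := by
  simp only [c₄, c₆, b₂, b₄, b₆]
  ring

lemma isUnit_c₆ (I : WeierstrassCurve ℤ_[p]) (h4 : IsUnit I.c₄) (hΔ : ¬ IsUnit I.Δ) :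
    IsUnit I.c₆ := by
  by_contra h6
  have hm := I.c_relation
  have h1 : I.Δ ∈ IsLocalRing.maximalIdeal ℤ_[p] := hΔ
  have h2 : I.c₆ ∈ IsLocalRing.maximalIdeal ℤ_[p] := h6
  have h3 : I.c₄ ^ 3 ∈ IsLocalRing.maximalIdeal ℤ_[p] := by
    have : I.c₄ ^ 3 = 1728 * I.Δ + I.c₆ * I.c₆ := by linear_combination -hm
    rw [this]
    exact add_mem (Ideal.mul_mem_left _ _ h1) (Ideal.mul_mem_left _ _ h2)
  exact h3 (h4.pow 3)

lemma toZMod_eq_zero_iff (x : ℤ_[p]) : PadicInt.toZMod x = 0 ↔ ¬ IsUnit x := by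
  rw [← RingHom.mem_ker, PadicInt.ker_toZMod]
  rfl

/-- The node of the reduction splits if and only if `-c₄ c₆` is a square. -/
lemma nodeSplits_iff_isSquare (I : WeierstrassCurve ℤ_[p]) (h4 : IsUnit I.c₄)
    (hΔ : ¬ IsUnit I.Δ) :
    (I.map (PadicInt.toZMod (p := p))).NodeSplits ↔ IsSquare (-(I.c₄ * I.c₆ : ℚ_[p])) := by
  have h6 := isUnit_c₆ I h4 hΔ
  have hd := neg_c₄_mul_c₆_eq I
  set e := 54 * I.b₆ - 3 * I.b₂ * I.b₄ + I.a₂ * I.c₄ with he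
  have hred (t : ℤ_[p]) : PadicInt.toZMod (I.c₄ * t ^ 2 + I.a₁ * I.c₄ * t - e) =
      (I.map PadicInt.toZMod).c₄ * (PadicInt.toZMod t) ^ 2 +
        (I.map PadicInt.toZMod).a₁ * (I.map PadicInt.toZMod).c₄ * PadicInt.toZMod t -
        (54 * (I.map PadicInt.toZMod).b₆ - 3 * (I.map PadicInt.toZMod).b₂ *
          (I.map PadicInt.toZMod).b₄ +
          (I.map PadicInt.toZMod).a₂ * (I.map PadicInt.toZMod).c₄) := by
    simp [he, map_ofNat PadicInt.toZMod]
  constructor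
  · rintro ⟨t, ht⟩
    obtain ⟨t, rfl⟩ := ZMod.ringHom_surjective (PadicInt.toZMod (p := p)) t
    rw [← hred, toZMod_eq_zero_iff] at ht
    let F : Polynomial ℤ_[p] :=
      Polynomial.C I.c₄ * Polynomial.X ^ 2 + Polynomial.C (I.a₁ * I.c₄) * Polynomial.X -
        Polynomial.C e
    have hF (x : ℤ_[p]) : Polynomial.aeval x F = I.c₄ * x ^ 2 + I.a₁ * I.c₄ * x - e := by
      simp [F]
    have hF' (x : ℤ_[p]) : Polynomial.aeval x F.derivative = 2 * I.c₄ * x + I.a₁ * I.c₄ := by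
      simp [F]
      ring
    -- The square of the derivative differs from the unit `-c₄ c₆` by a multiple of the value at
    -- `t`. The root modulo `p` is therefore simple, even for `p = 2`, and Hensel's lemma lifts it.
    have hu : IsUnit (2 * I.c₄ * t + I.a₁ * I.c₄) := by
      by_contra hn
      have h1 : 2 * I.c₄ * t + I.a₁ * I.c₄ ∈ IsLocalRing.maximalIdeal ℤ_[p] := hn
      have h2 : I.c₄ * t ^ 2 + I.a₁ * I.c₄ * t - e ∈ IsLocalRing.maximalIdeal ℤ_[p] := ht
      have h3 : -(I.c₄ * I.c₆) ∈ IsLocalRing.maximalIdeal ℤ_[p] := by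
        have : -(I.c₄ * I.c₆) = (2 * I.c₄ * t + I.a₁ * I.c₄) * (2 * I.c₄ * t + I.a₁ * I.c₄) -
          4 * I.c₄ * (I.c₄ * t ^ 2 + I.a₁ * I.c₄ * t - e) := by rw [hd]; ring
        rw [this]
        exact sub_mem (Ideal.mul_mem_left _ _ h1) (Ideal.mul_mem_left _ _ h2)
      exact h3 (h4.mul h6).neg
    obtain ⟨z, hz, -⟩ := hensels_lemma (F := F) (a := t) (by
      rw [hF, hF', PadicInt.isUnit_iff.1 hu]
      simpa using PadicInt.not_isUnit_iff.1 ht)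
    rw [hF] at hz
    refine ⟨((2 * I.c₄ * z + I.a₁ * I.c₄ : ℤ_[p]) : ℚ_[p]), ?_⟩
    have : -(I.c₄ * I.c₆) = (2 * I.c₄ * z + I.a₁ * I.c₄) * (2 * I.c₄ * z + I.a₁ * I.c₄) := by
      rw [hd]
      linear_combination (-4 * I.c₄) * hz
    exact_mod_cast congrArg (fun x : ℤ_[p] ↦ (x : ℚ_[p])) this
  · rintro ⟨s, hs⟩
    have hc : (I.c₄ : ℚ_[p]) ≠ 0 := by simpa using h4.ne_zero
    -- Division by 2 is harmless in `ℚ_[p]`. The resulting root is integral over `ℤ_[p]`, since the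
    -- quadratic becomes monic after division by the unit `c₄`, and so it can be reduced modulo `p`.
    set x : ℚ_[p] := (s - I.a₁ * I.c₄) / (2 * I.c₄) with hx
    have hx2 : (I.c₄ : ℚ_[p]) * x ^ 2 + I.a₁ * I.c₄ * x - e = 0 := by
      have hd' : (-(I.c₄ * I.c₆) : ℚ_[p]) = (I.a₁ * I.c₄) ^ 2 + 4 * I.c₄ * e := by
        exact_mod_cast congrArg (fun x : ℤ_[p] ↦ (x : ℚ_[p])) hd
      rw [hs] at hd'
      rw [hx]
      field_simp
      linear_combination hd'
    obtain ⟨w, hw⟩ := h4.exists_left_inv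
    have hint : _root_.IsIntegral ℤ_[p] x := by
      refine ⟨Polynomial.X ^ 2 + (Polynomial.C I.a₁ * Polynomial.X +
        Polynomial.C (-(w * e))), ?_, ?_⟩
      · refine Polynomial.monic_X_pow_add (lt_of_le_of_lt Polynomial.degree_linear_le ?_)
        norm_num
      · have hw' : (w : ℚ_[p]) * I.c₄ = 1 := by
          simpa using congrArg (fun x : ℤ_[p] ↦ (x : ℚ_[p])) hw
        simp
        linear_combination (w : ℚ_[p]) * hx2 - (x ^ 2 + I.a₁ * x) * hw'
    obtain ⟨z, hz⟩ := IsIntegrallyClosed.isIntegral_iff.1 hint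
    change (z : ℚ_[p]) = x at hz
    refine ⟨PadicInt.toZMod z, ?_⟩
    rw [← hred]
    rw [← hz] at hx2
    have : I.c₄ * z ^ 2 + I.a₁ * I.c₄ * z - e = 0 := PadicInt.ext (by push_cast; exact hx2)
    rw [this, map_zero]

end Reduction

/-! ### From integer models to reduction types at `p`. -/

section IntegralModels

variable {p : ℕ} [Fact p.Prime]

lemma intVal_eq_padicValInt {x : ℤ} (hx : x ≠ 0) : intVal p x = padicValInt p x := by
  have hf : FiniteMultiplicity (p : ℤ) x :=
    Int.finiteMultiplicity_iff.2 ⟨by simpa using (Fact.out : p.Prime).ne_one, hx⟩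
  rw [intVal, hf.emultiplicity_eq_multiplicity, padicValInt.of_ne_one_ne_zero
    (Fact.out : p.Prime).ne_one hx]

lemma baseChange_map_int (W : WeierstrassCurve ℤ) :
    (W.map (Int.castRingHom ℚ)).baseChange ℚ_[p] =
      (W.map (Int.castRingHom ℤ_[p])).map (algebraMap ℤ_[p] ℚ_[p]) := by
  rw [baseChange, map_map, map_map]
  congr 1

lemma isUnit_intCast_iff (x : ℤ) : IsUnit (x : ℤ_[p]) ↔ ¬ (p : ℤ) ∣ x := by
  rw [← PadicInt.norm_int_lt_one_iff_dvd, ← PadicInt.not_isUnit_iff, not_not]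

/-- Splitness of multiplicative reduction does not depend on the minimal model. -/
lemma hasSplitMultiplicativeReduction_smul_iff (V : WeierstrassCurve ℚ_[p])
    (C : VariableChange ℚ_[p]) (h : (C • V).HasMultiplicativeReduction ℤ_[p]) :
    (C • V).HasSplitMultiplicativeReduction ℤ_[p] ↔ IsSquare (-(V.c₄ * V.c₆)) := by
  obtain ⟨I, hI, h4, hΔ⟩ := (hasMultiplicativeReduction_iff_exists _).1 h
  -- The weights 4 and 6 add up to the even number 10, so the square class is unchanged.
  have hsq : -(V.c₄ * V.c₆) = (C.u : ℚ_[p]) ^ 5 * C.u ^ 5 * -(I.c₄ * I.c₆ : ℚ_[p]) := by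
    have e4 : (I.c₄ : ℚ_[p]) = C.u⁻¹ ^ 4 * V.c₄ := by
      rw [← variableChange_c₄, hI, map_c₄]
      rfl
    have e6 : (I.c₆ : ℚ_[p]) = C.u⁻¹ ^ 6 * V.c₆ := by
      rw [← variableChange_c₆, hI, map_c₆]
      rfl
    rw [e4, e6]
    have := C.u.ne_zero
    push_cast
    field_simp
  have hu : (C.u : ℚ_[p]) ^ 5 ≠ 0 := pow_ne_zero _ C.u.ne_zero
  have : IsSquare (-(V.c₄ * V.c₆)) ↔ IsSquare (-(I.c₄ * I.c₆ : ℚ_[p])) := by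
    rw [hsq]
    constructor
    · rintro ⟨s, hs⟩
      refine ⟨s / C.u ^ 5, ?_⟩
      rw [div_mul_div_comm, ← hs]
      field_simp
    · rintro ⟨s, hs⟩
      exact ⟨C.u ^ 5 * s, by rw [hs]; ring⟩
  rw [this, ← nodeSplits_iff_isSquare I h4 hΔ,
    ← hasSplitMultiplicativeReduction_iff_nodeSplits I (hI ▸ h), hI]

/-- Here `k` is the valuation of the scaling that leads to a model with unit `c₄`. All proofs that a
reduction is not multiplicative rest on these two equations. -/
lemma HasMultiplicativeReductionOfType.exists_valuation {W : WeierstrassCurve ℤ} {n : ℕ}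
    (hΔ : W.Δ ≠ 0) (h : HasMultiplicativeReductionOfType (W.map (Int.castRingHom ℚ)) p n) :
    0 < n ∧ ∃ k : ℕ, intVal p W.c₄ = 4 * k ∧ intVal p W.Δ = 12 * k + n := by
  obtain ⟨C, hC, hn⟩ := h
  obtain ⟨I, hI, h4, hnu⟩ := (hasMultiplicativeReduction_iff_exists _).1 hC
  rw [baseChange_map_int] at hI hn
  have eΔ : (I.Δ : ℚ_[p]) = C.u⁻¹ ^ 12 * (W.Δ : ℚ_[p]) := by
    have := congrArg WeierstrassCurve.Δ hI
    rw [variableChange_Δ, map_Δ, map_Δ, map_Δ] at this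
    simpa using this.symm
  have e4 : (I.c₄ : ℚ_[p]) = C.u⁻¹ ^ 4 * (W.c₄ : ℚ_[p]) := by
    have := congrArg WeierstrassCurve.c₄ hI
    rw [variableChange_c₄, map_c₄, map_c₄, map_c₄] at this
    simpa using this.symm
  rw [hI, map_Δ] at hn
  change (I.Δ : ℚ_[p]).valuation = n at hn
  have hu := C.u⁻¹.ne_zero
  have hΔ' : (W.Δ : ℚ_[p]) ≠ 0 := by exact_mod_cast hΔ
  have hI0 : (I.Δ : ℚ_[p]) ≠ 0 := by rw [eΔ]; exact mul_ne_zero (pow_ne_zero _ hu) hΔ'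
  have hc4 : (W.c₄ : ℚ_[p]) ≠ 0 := by
    intro h0
    rw [h0, mul_zero] at e4
    exact h4.ne_zero (by simpa using e4)
  have v4 : (I.c₄ : ℚ_[p]).valuation = 0 := by
    have := PadicInt.isUnit_iff.1 h4
    obtain ⟨w, hw⟩ := h4.exists_right_inv
    have h0 : I.c₄ ≠ 0 := h4.ne_zero
    have hw0 : w ≠ 0 := right_ne_zero_of_mul (hw ▸ one_ne_zero)
    have hv := congrArg PadicInt.valuation hw
    rw [PadicInt.valuation_mul h0 hw0, PadicInt.valuation_one] at hv
    rw [PadicInt.valuation_coe]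
    omega
  have hpos : 0 < n := by
    rw [PadicInt.not_isUnit_iff, PadicInt.norm_eq_zpow_neg_valuation (by simpa using hI0)] at hnu
    rw [PadicInt.valuation_coe] at hn
    have : (I.Δ.valuation) = n := by exact_mod_cast hn
    rcases Nat.eq_zero_or_pos n with rfl | h
    · simp [this] at hnu
    · exact h
  rw [eΔ, Padic.valuation_mul (pow_ne_zero _ hu) hΔ', Padic.valuation_pow,
    Padic.valuation_intCast] at hn
  rw [e4, Padic.valuation_mul (pow_ne_zero _ hu) hc4, Padic.valuation_pow,
    Padic.valuation_intCast] at v4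
  have hc4' : W.c₄ ≠ 0 := by exact_mod_cast hc4
  push_cast at hn v4
  -- `toNat` loses nothing: `4 v(u) = v(W.c₄)` is non-negative because `W` is integral.
  refine ⟨hpos, (-(((C.u⁻¹ : ℚ_[p]ˣ) : ℚ_[p]).valuation)).toNat, ?_, ?_⟩
  · rw [intVal_eq_padicValInt hc4']
    norm_cast
    push_cast at *
    omega
  · rw [intVal_eq_padicValInt hΔ]
    norm_cast
    push_cast at *
    omega

lemma hasMultiplicativeReduction_of_not_dvd {W : WeierstrassCurve ℤ} (h4 : ¬ (p : ℤ) ∣ W.c₄)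
    (hΔ : (p : ℤ) ∣ W.Δ) :
    ((W.map (Int.castRingHom ℤ_[p])).map (algebraMap ℤ_[p] ℚ_[p])).HasMultiplicativeReduction
      ℤ_[p] := by
  refine (hasMultiplicativeReduction_iff_exists _).2 ⟨_, rfl, ?_, ?_⟩
  · rw [map_c₄]
    exact (isUnit_intCast_iff _).2 h4
  · rw [map_Δ]
    exact fun h ↦ (isUnit_intCast_iff _).1 h hΔ

lemma intVal_eq_zero_iff {p : ℕ} {x : ℤ} : intVal p x = 0 ↔ ¬ (p : ℤ) ∣ x := by
  rw [intVal, emultiplicity_eq_zero]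

/-- Reduction type of a curve over `ℚ` with an integral model whose `c₄` is prime to `p`. -/
theorem reduction_of_not_dvd_c₄ {W : WeierstrassCurve ℤ} (hΔ : W.Δ ≠ 0)
    (h4 : ¬ (p : ℤ) ∣ W.c₄) (n : ℕ) :
    (HasMultiplicativeReductionOfType (W.map (Int.castRingHom ℚ)) p n ↔
      0 < n ∧ n = intVal p W.Δ) ∧
    (HasSplitMultiplicativeReductionOfType (W.map (Int.castRingHom ℚ)) p n ↔
      0 < n ∧ n = intVal p W.Δ ∧ (W.map (Int.castRingHom (ZMod p))).NodeSplits) ∧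
    (HasNonsplitMultiplicativeReductionOfType (W.map (Int.castRingHom ℚ)) p n ↔
      0 < n ∧ n = intVal p W.Δ ∧ ¬ (W.map (Int.castRingHom (ZMod p))).NodeSplits) := by
  have hfw (h : HasMultiplicativeReductionOfType (W.map (Int.castRingHom ℚ)) p n) :
      0 < n ∧ n = intVal p W.Δ := by
    obtain ⟨hn, k, hk, hk'⟩ := h.exists_valuation hΔ
    rw [intVal_eq_zero_iff.2 h4] at hk
    have : k = 0 := by
      have : 0 = 4 * k := by exact_mod_cast hk
      omega
    subst this
    exact ⟨hn, by simp [hk']⟩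
  have hdvd (h : 0 < n ∧ n = intVal p W.Δ) : (p : ℤ) ∣ W.Δ := by
    by_contra hd
    rw [intVal_eq_zero_iff.2 hd] at h
    have : n = 0 := by exact_mod_cast h.2
    omega
  have hval (h : n = intVal p W.Δ) :
      (((W.map (Int.castRingHom ℤ_[p])).map (algebraMap ℤ_[p] ℚ_[p])).Δ).valuation = (n : ℤ) := by
    rw [intVal_eq_padicValInt hΔ] at h
    have h' : n = padicValInt p W.Δ := by exact_mod_cast h
    rw [map_Δ, map_Δ, h', ← Padic.valuation_intCast]
    simp
  -- Splitness of the model at hand is turned into a square condition over `ℚ_[p]`, the form in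
  -- which it can be compared with an arbitrary change of variables `C`.
  have hsq (hd : (p : ℤ) ∣ W.Δ) : (W.map (Int.castRingHom (ZMod p))).NodeSplits ↔
      IsSquare (-(((W.map (Int.castRingHom ℚ)).baseChange ℚ_[p]).c₄ *
        ((W.map (Int.castRingHom ℚ)).baseChange ℚ_[p]).c₆)) := by
    have := nodeSplits_iff_isSquare (W.map (Int.castRingHom ℤ_[p]))
      (by rw [map_c₄]; exact (isUnit_intCast_iff _).2 h4)
      (by rw [map_Δ]; exact fun h ↦ (isUnit_intCast_iff _).1 h hd)
    rw [map_map, Subsingleton.elim (PadicInt.toZMod.comp (Int.castRingHom ℤ_[p]))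
      (Int.castRingHom (ZMod p))] at this
    rw [this, baseChange_map_int, map_c₄ _ (algebraMap ℤ_[p] ℚ_[p]),
      map_c₆ _ (algebraMap ℤ_[p] ℚ_[p])]
    rfl
  have hbw (h : 0 < n ∧ n = intVal p W.Δ) :
      ((1 : VariableChange ℚ_[p]) •
        (W.map (Int.castRingHom ℚ)).baseChange ℚ_[p]).HasMultiplicativeReduction ℤ_[p] := by
    rw [one_smul, baseChange_map_int]
    exact hasMultiplicativeReduction_of_not_dvd h4 (hdvd h)
  have hbw' (h : 0 < n ∧ n = intVal p W.Δ) :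
      ((1 : VariableChange ℚ_[p]) •
        (W.map (Int.castRingHom ℚ)).baseChange ℚ_[p]).Δ.valuation = (n : ℤ) := by
    rw [one_smul, baseChange_map_int, hval h.2]
  refine ⟨⟨hfw, fun h ↦ ⟨1, hbw h, hbw' h⟩⟩, ⟨?_, ?_⟩, ⟨?_, ?_⟩⟩
  · rintro ⟨C, hC, hn⟩
    have h := hfw ⟨C, hC.toHasMultiplicativeReduction, hn⟩
    refine ⟨h.1, h.2, (hsq (hdvd h)).2 ?_⟩
    exact (hasSplitMultiplicativeReduction_smul_iff _ C hC.toHasMultiplicativeReduction).1 hC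
  · rintro ⟨h1, h2, h3⟩
    exact ⟨1, (hasSplitMultiplicativeReduction_smul_iff _ 1 (hbw ⟨h1, h2⟩)).2
      ((hsq (hdvd ⟨h1, h2⟩)).1 h3), hbw' ⟨h1, h2⟩⟩
  · rintro ⟨C, hC, hns, hn⟩
    have h := hfw ⟨C, hC, hn⟩
    refine ⟨h.1, h.2, fun hs ↦ hns ?_⟩
    exact (hasSplitMultiplicativeReduction_smul_iff _ C hC).2 ((hsq (hdvd h)).1 hs)
  · rintro ⟨h1, h2, h3⟩
    refine ⟨1, hbw ⟨h1, h2⟩, fun hs ↦ h3 ?_, hbw' ⟨h1, h2⟩⟩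
    exact (hsq (hdvd ⟨h1, h2⟩)).2
      ((hasSplitMultiplicativeReduction_smul_iff _ 1 (hbw ⟨h1, h2⟩)).1 hs)

/-- A rational change of model is absorbed by the existential over changes of variables on `ℚ_[p]`,
so `E_T` may be rescaled before its reduction is studied. -/
lemma exists_smul_baseChange_iff (V : WeierstrassCurve ℚ) (D : VariableChange ℚ)
    (P : WeierstrassCurve ℚ_[p] → Prop) :
    (∃ C : VariableChange ℚ_[p], P (C • (D • V).baseChange ℚ_[p])) ↔
      ∃ C : VariableChange ℚ_[p], P (C • V.baseChange ℚ_[p]) := by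
  have h : (D • V).baseChange ℚ_[p] = D.map (algebraMap ℚ ℚ_[p]) • V.baseChange ℚ_[p] :=
    (map_variableChange V D (algebraMap ℚ ℚ_[p])).symm
  constructor
  · rintro ⟨C, hC⟩
    exact ⟨C * D.map (algebraMap ℚ ℚ_[p]), by rwa [mul_smul, ← h]⟩
  · rintro ⟨C, hC⟩
    exact ⟨C * (D.map (algebraMap ℚ ℚ_[p]))⁻¹, by rwa [h, mul_smul, inv_smul_smul]⟩

end IntegralModels

/-! ### The parametrized model and the correctness of the table. -/

/-- The Weierstrass curve `y² + a₁ x y + a₃ y = x³ + a₂ x²`. -/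
def originCurve {R : Type*} [CommRing R] (a₁ a₂ a₃ : R) : WeierstrassCurve R := ⟨a₁, a₂, a₃, 0, 0⟩

lemma originCurve_map {R S : Type*} [CommRing R] [CommRing S] (f : R →+* S) (a₁ a₂ a₃ : R) :
    (originCurve a₁ a₂ a₃).map f = originCurve (f a₁) (f a₂) (f a₃) := by
  ext <;> simp [originCurve]

lemma originCurve_c₄ {R : Type*} [CommRing R] (a₁ a₂ a₃ : R) :
    (originCurve a₁ a₂ a₃).c₄ = (a₁ ^ 2 + 4 * a₂) ^ 2 - 24 * (a₁ * a₃) := by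
  simp only [originCurve, c₄, b₂, b₄]
  ring

lemma originCurve_Δ {R : Type*} [CommRing R] (a₁ a₂ a₃ : R) :
    (originCurve a₁ a₂ a₃).Δ =
      a₃ ^ 2 * (a₁ ^ 3 * a₃ - a₁ ^ 4 * a₂ - 8 * a₁ ^ 2 * a₂ ^ 2 + 36 * a₁ * a₂ * a₃ -
        16 * a₂ ^ 3 - 27 * a₃ ^ 2) := by
  simp only [originCurve, Δ, b₂, b₄, b₆, b₈]
  ring

lemma OddTorsionFamily.curve_eq (T : OddTorsionFamily) (a b : ℤ) :
    T.curve a b = (originCurve (T.coeffA₁ a b) (T.coeffA₂ a b) (T.coeffA₃ a b)).map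
      (Int.castRingHom ℚ) := by
  ext <;> simp [OddTorsionFamily.curve, originCurve]

lemma OddTorsionFamily.Δ_ne_zero {T : OddTorsionFamily} {a b : ℤ}
    (hE : (T.curve a b).IsElliptic) :
    (originCurve (T.coeffA₁ a b) (T.coeffA₂ a b) (T.coeffA₃ a b)).Δ ≠ 0 := by
  intro h
  have := hE.isUnit.ne_zero
  rw [T.curve_eq, map_Δ, h, map_zero] at this
  exact this rfl

/-- The table gives the reduction type of `E_T(a, b)` at `p`. -/
def TableCorrect (T : OddTorsionFamily) (p : ℕ) [Fact p.Prime] (a b : ℤ) (n : ℕ) : Prop :=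
  (HasMultiplicativeReductionOfType (T.curve a b) p n ↔
    0 < n ∧ ∃ ℓ : ReductionLabel, MultRedTable T p a b n ℓ) ∧
  (HasSplitMultiplicativeReductionOfType (T.curve a b) p n ↔
    0 < n ∧ MultRedTable T p a b n .S) ∧
  (HasNonsplitMultiplicativeReductionOfType (T.curve a b) p n ↔
    0 < n ∧ MultRedTable T p a b n .NS)

/-! ### The positive and the negative criterion. -/

section Criteria

variable {T : OddTorsionFamily} {p : ℕ} [Fact p.Prime] {a b : ℤ} {n : ℕ}

/-- The table is correct where the rescaled model `a₁ / m, a₂ / m², a₃ / m³` has `c₄` prime to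
`p`, provided it lists the valuation of the discriminant and the splitness of the node. -/
lemma tableCorrect_of_scaled (m a₁ a₂ a₃ : ℤ) (hm : m ≠ 0) (h₁ : T.coeffA₁ a b = m * a₁)
    (h₂ : T.coeffA₂ a b = m ^ 2 * a₂) (h₃ : T.coeffA₃ a b = m ^ 3 * a₃)
    (hE : (T.curve a b).IsElliptic)
    (h4 : ((originCurve (a₁ : ZMod p) a₂ a₃).c₄ ≠ 0))
    (hS : 0 < n → (MultRedTable T p a b n .S ↔ n = intVal p (originCurve a₁ a₂ a₃).Δ ∧
      (originCurve (a₁ : ZMod p) a₂ a₃).NodeSplits))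
    (hNS : 0 < n → (MultRedTable T p a b n .NS ↔ n = intVal p (originCurve a₁ a₂ a₃).Δ ∧
      ¬ (originCurve (a₁ : ZMod p) a₂ a₃).NodeSplits)) :
    TableCorrect T p a b n := by
  have hmq : (m : ℚ) ≠ 0 := by exact_mod_cast hm
  have hW : (originCurve a₁ a₂ a₃).map (Int.castRingHom ℚ) =
      (⟨Units.mk0 (m : ℚ) hmq, 0, 0, 0⟩ : VariableChange ℚ) • T.curve a b := by
    rw [T.curve_eq]
    ext <;> simp [originCurve, variableChange_def, h₁, h₂, h₃] <;> field_simp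
  have hΔ : (originCurve a₁ a₂ a₃).Δ ≠ 0 := by
    intro h0
    apply OddTorsionFamily.Δ_ne_zero hE
    rw [h₁, h₂, h₃]
    rw [originCurve_Δ] at h0 ⊢
    linear_combination m ^ 12 * h0
  have h4' : ¬ (p : ℤ) ∣ (originCurve a₁ a₂ a₃).c₄ := by
    rw [← ZMod.intCast_zmod_eq_zero_iff_dvd]
    have := map_c₄ (originCurve a₁ a₂ a₃) (Int.castRingHom (ZMod p))
    rw [originCurve_map] at this
    exact fun h ↦ h4 (this.trans h)
  have hr := reduction_of_not_dvd_c₄ hΔ h4' n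
  have hmap : (originCurve a₁ a₂ a₃).map (Int.castRingHom (ZMod p)) =
    originCurve (a₁ : ZMod p) a₂ a₃ := originCurve_map _ _ _ _
  rw [hW, hmap] at hr
  have e1 := exists_smul_baseChange_iff (p := p) (T.curve a b)
    ⟨Units.mk0 (m : ℚ) hmq, 0, 0, 0⟩ fun V ↦
      V.HasMultiplicativeReduction ℤ_[p] ∧ V.Δ.valuation = (n : ℤ)
  have e2 := exists_smul_baseChange_iff (p := p) (T.curve a b)
    ⟨Units.mk0 (m : ℚ) hmq, 0, 0, 0⟩ fun V ↦
      V.HasSplitMultiplicativeReduction ℤ_[p] ∧ V.Δ.valuation = (n : ℤ)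
  have e3 := exists_smul_baseChange_iff (p := p) (T.curve a b)
    ⟨Units.mk0 (m : ℚ) hmq, 0, 0, 0⟩ fun V ↦
      V.HasMultiplicativeReduction ℤ_[p] ∧ ¬ V.HasSplitMultiplicativeReduction ℤ_[p] ∧
        V.Δ.valuation = (n : ℤ)
  refine ⟨e1.symm.trans (hr.1.trans ?_), e2.symm.trans (hr.2.1.trans ?_),
    e3.symm.trans (hr.2.2.trans ?_)⟩
  · constructor
    · rintro ⟨hn, hv⟩
      by_cases hs : (originCurve (a₁ : ZMod p) a₂ a₃).NodeSplits
      · exact ⟨hn, .S, (hS hn).2 ⟨hv, hs⟩⟩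
      · exact ⟨hn, .NS, (hNS hn).2 ⟨hv, hs⟩⟩
    · rintro ⟨hn, ℓ, hℓ⟩
      cases ℓ
      · exact ⟨hn, ((hS hn).1 hℓ).1⟩
      · exact ⟨hn, ((hNS hn).1 hℓ).1⟩
  · exact and_congr_right fun hn ↦ (hS hn).symm
  · exact and_congr_right fun hn ↦ (hNS hn).symm

/-- The table is correct where it is void and the valuations of `c₄` and `Δ` exclude
multiplicative reduction. -/
lemma tableCorrect_of_not_multiplicative (hE : (T.curve a b).IsElliptic)
    (hv : ∀ k : ℕ, 0 < n →
      intVal p (originCurve (T.coeffA₁ a b) (T.coeffA₂ a b) (T.coeffA₃ a b)).c₄ = 4 * k →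
      intVal p (originCurve (T.coeffA₁ a b) (T.coeffA₂ a b) (T.coeffA₃ a b)).Δ = 12 * k + n →
      False)
    (ht : ∀ ℓ, 0 < n → ¬ MultRedTable T p a b n ℓ) : TableCorrect T p a b n := by
  have hno : ¬ HasMultiplicativeReductionOfType (T.curve a b) p n := by
    intro h
    rw [T.curve_eq] at h
    obtain ⟨hn, k, h4, hΔ⟩ := h.exists_valuation (OddTorsionFamily.Δ_ne_zero hE)
    exact hv k hn h4 hΔ
  refine ⟨⟨fun h ↦ (hno h).elim, fun h ↦ (ht _ h.1 h.2.choose_spec).elim⟩,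
    ⟨fun ⟨C, hC, hn⟩ ↦ (hno ⟨C, hC.toHasMultiplicativeReduction, hn⟩).elim,
      fun h ↦ (ht _ h.1 h.2).elim⟩,
    ⟨fun ⟨C, hC, _, hn⟩ ↦ (hno ⟨C, hC, hn⟩).elim, fun h ↦ (ht _ h.1 h.2).elim⟩⟩

end Criteria

/-! ### Tangent directions at a node over a field. -/

section Nodes

variable {F : Type*} [Field F]

/-- The singular point `(0, 0)` has rational tangents `y = 0` and `y = -a₁ x`. -/
lemma nodeSplits_origin_of_eq_zero {a₁ a₂ a₃ : F} (h₁ : a₁ ≠ 0) (h₂ : a₂ = 0) (h₃ : a₃ = 0) :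
    (originCurve a₁ a₂ a₃).c₄ ≠ 0 ∧ (originCurve a₁ a₂ a₃).NodeSplits := by
  subst h₂ h₃
  refine ⟨by simp [originCurve_c₄, h₁], 0, ?_⟩
  simp [originCurve, b₂, b₄, b₆]

/-- With `a₃ = 0` the origin is singular and its slopes are the roots of `t² + a₁ t - a₂`; `c₄` is
the square of the discriminant of this quadratic. The characteristic is arbitrary, which serves the
cases `p = 2`. -/
lemma nodeSplits_origin_iff {a₁ a₂ a₃ : F} (hb : a₁ ^ 2 + 4 * a₂ ≠ 0) (h₃ : a₃ = 0) :
    (originCurve a₁ a₂ a₃).c₄ ≠ 0 ∧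
      ((originCurve a₁ a₂ a₃).NodeSplits ↔ ∃ t : F, t ^ 2 + a₁ * t - a₂ = 0) := by
  subst h₃
  have h4 : (originCurve a₁ a₂ 0).c₄ ≠ 0 := by simp [originCurve_c₄, hb]
  refine ⟨h4, exists_congr fun t ↦ ?_⟩
  have : (originCurve a₁ a₂ 0).c₄ * t ^ 2 + (originCurve a₁ a₂ 0).a₁ * (originCurve a₁ a₂ 0).c₄ * t
      - (54 * (originCurve a₁ a₂ 0).b₆ - 3 * (originCurve a₁ a₂ 0).b₂ * (originCurve a₁ a₂ 0).b₄ +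
        (originCurve a₁ a₂ 0).a₂ * (originCurve a₁ a₂ 0).c₄) =
      (originCurve a₁ a₂ 0).c₄ * (t ^ 2 + a₁ * t - a₂) := by
    simp only [originCurve, b₂, b₄, b₆]
    ring
  rw [this, mul_eq_zero, or_iff_right h4]

/-- If `4 x³ + b₂ x² + 2 b₄ x + b₆` has a double root at `X / r`, then the tangent slopes at
the node are rational if and only if `b₂ + 12 X / r` is a square. -/
lemma nodeSplits_iff_isSquare_of_double_root {a₁ a₂ a₃ X r s y D : F} (h2 : (2 : F) ≠ 0)
    (hr : r ≠ 0) (hs : s ≠ 0)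
    (hd : 6 * X ^ 2 + (a₁ ^ 2 + 4 * a₂) * X * r + a₁ * a₃ * r ^ 2 = 0)
    (hc : 4 * X ^ 3 + (a₁ ^ 2 + 4 * a₂) * X ^ 2 * r + 2 * (a₁ * a₃) * X * r ^ 2 +
      a₃ ^ 2 * r ^ 3 = 0)
    (hβ : (a₁ ^ 2 + 4 * a₂) * r + 12 * X ≠ 0)
    (hD : ((a₁ ^ 2 + 4 * a₂) * r + 12 * X) * r * s ^ 2 = D * y ^ 2) :
    D ≠ 0 ∧ (originCurve a₁ a₂ a₃).c₄ ≠ 0 ∧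
      ((originCurve a₁ a₂ a₃).NodeSplits ↔ IsSquare D) := by
  set β := (a₁ ^ 2 + 4 * a₂) * r + 12 * X with hβd
  set W := originCurve a₁ a₂ a₃ with hW
  have hDy : D * y ^ 2 ≠ 0 := hD ▸ mul_ne_zero (mul_ne_zero hβ hr) (pow_ne_zero 2 hs)
  have hD0 : D ≠ 0 := left_ne_zero_of_mul hDy
  have hy0 : y ≠ 0 := fun h ↦ hDy (by simp [h])
  -- In terms of `x = X / r`, `hc` and `hd` express the vanishing of the cubic and of half its
  -- derivative, with `b₄ = a₁ a₃` and `b₆ = a₃²`. Then `c₄ = (β/r)²` and `c₆ = -(β/r)³`, so `-c₄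
  -- c₆` is `β r` up to squares, and `hD` says that `β r` is `D` up to squares.
  have h4 : W.c₄ * r ^ 2 = β ^ 2 := by
    rw [hW, originCurve_c₄, hβd]
    linear_combination (-24) * hd
  have h6 : W.c₆ * r ^ 3 = -β ^ 3 := by
    simp only [hW, originCurve, c₆, b₂, b₄, b₆, hβd]
    linear_combination (-216) * hc + (36 * r * (a₁ ^ 2 + 4 * a₂) + 432 * X) * hd
  have h40 : W.c₄ ≠ 0 := fun h ↦ pow_ne_zero 2 hβ (by rw [← h4, h, zero_mul])
  refine ⟨hD0, h40, ?_⟩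
  have hq := neg_c₄_mul_c₆_eq W
  have hsq : W.NodeSplits ↔ IsSquare (-(W.c₄ * W.c₆)) := by
    constructor
    · rintro ⟨t, ht⟩
      refine ⟨2 * W.c₄ * t + W.a₁ * W.c₄, ?_⟩
      rw [hq]
      linear_combination (-4 * W.c₄) * ht
    · rintro ⟨w, hw⟩
      refine ⟨(w - W.a₁ * W.c₄) / (2 * W.c₄), ?_⟩
      rw [hq] at hw
      field_simp
      linear_combination (-1) * hw
  have hcc : -(W.c₄ * W.c₆) * (r ^ 3 * s) ^ 2 = (β ^ 2 * y) ^ 2 * D := by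
    linear_combination (-W.c₆ * r ^ 4 * s ^ 2) * h4 - (β ^ 2 * r * s ^ 2) * h6 + β ^ 4 * hD
  rw [hsq]
  constructor
  · rintro ⟨w, hw⟩
    refine ⟨w * (r ^ 3 * s) / (β ^ 2 * y), ?_⟩
    rw [hw] at hcc
    field_simp
    linear_combination (-1) * hcc
  · rintro ⟨w, hw⟩
    refine ⟨β ^ 2 * y * w / (r ^ 3 * s), ?_⟩
    rw [hw] at hcc
    field_simp
    linear_combination hcc

end Nodes

/-! ### Primitive cube roots of unity and the square class of `-3`. -/

section CubeRoots

variable {p : ℕ} [Fact p.Prime]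

/-- A root is a unit of order 3 in a group of order `p - 1`: Lagrange gives one direction, Cauchy
the other. Working with the polynomial instead of its discriminant `-3` keeps `p = 2` in scope. -/
lemma exists_sq_add_self_add_one_eq_zero_iff (h3 : p ≠ 3) :
    (∃ s : ZMod p, s ^ 2 + s + 1 = 0) ↔ p ≡ 1 [MOD 3] := by
  have hp : p.Prime := Fact.out
  have h3' : (3 : ZMod p) ≠ 0 := by
    have : ((3 : ℕ) : ZMod p) ≠ 0 := by
      rw [Ne, ZMod.natCast_eq_zero_iff, Nat.prime_dvd_prime_iff_eq hp Nat.prime_three]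
      exact h3
    exact_mod_cast this
  have hcard : Nat.card (ZMod p)ˣ = p - 1 := by
    rw [Nat.card_eq_fintype_card, ZMod.card_units]
  have hmod : p ≡ 1 [MOD 3] ↔ 3 ∣ p - 1 := by
    rw [Nat.ModEq.comm, Nat.modEq_iff_dvd' hp.one_le]
  rw [hmod]
  constructor
  · rintro ⟨s, hs⟩
    have hs3 : s ^ 3 = 1 := by linear_combination (s - 1) * hs
    have hs1 : s ≠ 1 := by
      rintro rfl
      apply h3'
      linear_combination hs
    have h0 : s ≠ 0 := by
      rintro rfl
      simp at hs
    have : orderOf (Units.mk0 s h0) = 3 := orderOf_eq_prime (by ext; simpa using hs3)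
      (fun h ↦ hs1 (by simpa using congrArg Units.val h))
    rw [← this, ← hcard]
    exact orderOf_dvd_natCard _
  · intro h
    have : Fact (Nat.Prime 3) := ⟨Nat.prime_three⟩
    obtain ⟨u, hu⟩ := exists_prime_orderOf_dvd_card' (G := (ZMod p)ˣ) 3 (hcard ▸ h)
    have hu3 : (u : ZMod p) ^ 3 = 1 := by
      have := pow_orderOf_eq_one u
      rw [hu] at this
      simpa using congrArg Units.val this
    have hu1 : (u : ZMod p) - 1 ≠ 0 := by
      intro h1
      have : u = 1 := by ext; simpa using sub_eq_zero.1 h1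
      simp [this] at hu
    refine ⟨u, (mul_eq_zero.1 ?_).resolve_left hu1⟩
    linear_combination hu3

/-- `-3` is the discriminant of `s² + s + 1`, and for odd `p` the congruences `p ≡ 1` modulo 3 and
modulo 6 agree. -/
lemma isSquare_neg_three_iff (h5 : 5 ≤ p) : IsSquare (-3 : ZMod p) ↔ p ≡ 1 [MOD 6] := by
  have hp : p.Prime := Fact.out
  have h2 : (2 : ZMod p) ≠ 0 := by
    have : ((2 : ℕ) : ZMod p) ≠ 0 := by
      rw [Ne, ZMod.natCast_eq_zero_iff, Nat.prime_dvd_prime_iff_eq hp Nat.prime_two]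
      omega
    exact_mod_cast this
  have hodd : p % 2 = 1 := Nat.odd_iff.1 (hp.odd_of_ne_two (by omega))
  have : p ≡ 1 [MOD 6] ↔ p ≡ 1 [MOD 3] := by
    simp only [Nat.ModEq]
    omega
  rw [this, ← exists_sq_add_self_add_one_eq_zero_iff (by omega)]
  constructor
  · rintro ⟨w, hw⟩
    refine ⟨(w - 1) / 2, ?_⟩
    field_simp
    linear_combination (-1) * hw
  · rintro ⟨s, hs⟩
    exact ⟨2 * s + 1, by linear_combination (-4) * hs⟩

lemma modEq_five_iff (h5 : 5 ≤ p) : p ≡ 5 [MOD 6] ↔ ¬ p ≡ 1 [MOD 6] := by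
  have hp : p.Prime := Fact.out
  have h2 : ¬ 2 ∣ p := fun h ↦ by
    have := (Nat.prime_dvd_prime_iff_eq Nat.prime_two hp).1 h
    omega
  have h3 : ¬ 3 ∣ p := fun h ↦ by
    have := (Nat.prime_dvd_prime_iff_eq Nat.prime_three hp).1 h
    omega
  simp only [Nat.ModEq]
  omega

end CubeRoots

/-! ### Valuations of integers and coprimality modulo `p`. -/

section Valuations

variable {p : ℕ}

lemma intVal_mul [Fact p.Prime] (x y : ℤ) : intVal p (x * y) = intVal p x + intVal p y :=
  emultiplicity_mul (Nat.prime_iff_prime_int.1 Fact.out)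

lemma intVal_pow [Fact p.Prime] (x : ℤ) (k : ℕ) : intVal p (x ^ k) = k * intVal p x :=
  emultiplicity_pow (Nat.prime_iff_prime_int.1 Fact.out)

lemma intVal_neg (x : ℤ) : intVal p (-x) = intVal p x := emultiplicity_neg _ _

lemma intVal_eq_zero_of_ne {x : ℤ} (h : (x : ZMod p) ≠ 0) : intVal p x = 0 :=
  intVal_eq_zero_iff.2 fun hd ↦ h ((ZMod.intCast_zmod_eq_zero_iff_dvd _ _).2 hd)

lemma cast_ne_zero_of_isCoprime [Fact p.Prime] {a b : ℤ} (h : IsCoprime a b) :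
    ¬ ((a : ZMod p) = 0 ∧ (b : ZMod p) = 0) := by
  rintro ⟨ha, hb⟩
  obtain ⟨u, v, huv⟩ := h
  have := congrArg (Int.cast : ℤ → ZMod p) huv
  push_cast at this
  rw [ha, hb] at this
  simp at this

end Valuations

/-! ### Criteria adapted to the position of the node and to additive reduction. -/

section Regions

variable {T : OddTorsionFamily} {p : ℕ} [Fact p.Prime] {a b : ℤ} {n : ℕ}

/-- For primes dividing both `a₂` and `a₃`: the node is the origin, its tangents are rational, and
only rows labeled S may hold. -/
lemma tableCorrect_of_split (m a₁ a₂ a₃ : ℤ) (hm : m ≠ 0) (h₁ : T.coeffA₁ a b = m * a₁)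
    (h₂ : T.coeffA₂ a b = m ^ 2 * a₂) (h₃ : T.coeffA₃ a b = m ^ 3 * a₃)
    (hE : (T.curve a b).IsElliptic)
    (h1 : (a₁ : ZMod p) ≠ 0) (h2 : (a₂ : ZMod p) = 0) (h3 : (a₃ : ZMod p) = 0)
    (hS : 0 < n → (MultRedTable T p a b n .S ↔ n = intVal p (originCurve a₁ a₂ a₃).Δ))
    (hNS : 0 < n → ¬ MultRedTable T p a b n .NS) :
    TableCorrect T p a b n := by
  obtain ⟨h4, hs⟩ := nodeSplits_origin_of_eq_zero h1 h2 h3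
  exact tableCorrect_of_scaled m a₁ a₂ a₃ hm h₁ h₂ h₃ hE h4 (fun hn ↦ by simp [hS hn, hs])
    (fun hn ↦ by simp [hNS hn, hs])

lemma tableCorrect_of_origin (m a₁ a₂ a₃ : ℤ) (hm : m ≠ 0) (h₁ : T.coeffA₁ a b = m * a₁)
    (h₂ : T.coeffA₂ a b = m ^ 2 * a₂) (h₃ : T.coeffA₃ a b = m ^ 3 * a₃)
    (hE : (T.curve a b).IsElliptic)
    (h12 : (a₁ : ZMod p) ^ 2 + 4 * a₂ ≠ 0) (h3 : (a₃ : ZMod p) = 0)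
    (hS : 0 < n → (MultRedTable T p a b n .S ↔ n = intVal p (originCurve a₁ a₂ a₃).Δ ∧
      ∃ t : ZMod p, t ^ 2 + a₁ * t - a₂ = 0))
    (hNS : 0 < n → (MultRedTable T p a b n .NS ↔ n = intVal p (originCurve a₁ a₂ a₃).Δ ∧
      ¬ ∃ t : ZMod p, t ^ 2 + a₁ * t - a₂ = 0)) :
    TableCorrect T p a b n := by
  obtain ⟨h4, hs⟩ := nodeSplits_origin_iff h12 h3
  exact tableCorrect_of_scaled m a₁ a₂ a₃ hm h₁ h₂ h₃ hE h4 (fun hn ↦ by rw [hS hn, hs])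
    (fun hn ↦ by rw [hNS hn, hs])

/-- The residues `A₁`, `A₂`, `A₃` are separate variables so that a congruence between `a` and `b`
can be substituted before the node equations are checked. -/
lemma tableCorrect_of_double_root {X r s y : ZMod p} (D : ZMod p) (hp : p ≠ 2)
    (hE : (T.curve a b).IsElliptic) {A₁ A₂ A₃ : ZMod p} (h1 : (T.coeffA₁ a b : ZMod p) = A₁)
    (h2 : (T.coeffA₂ a b : ZMod p) = A₂) (h3 : (T.coeffA₃ a b : ZMod p) = A₃)
    (hr : r ≠ 0) (hs : s ≠ 0)
    (hd : 6 * X ^ 2 + (A₁ ^ 2 + 4 * A₂) * X * r + A₁ * A₃ * r ^ 2 = 0)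
    (hc : 4 * X ^ 3 + (A₁ ^ 2 + 4 * A₂) * X ^ 2 * r + 2 * (A₁ * A₃) * X * r ^ 2 +
      A₃ ^ 2 * r ^ 3 = 0)
    (hβ : (A₁ ^ 2 + 4 * A₂) * r + 12 * X ≠ 0)
    (hD : ((A₁ ^ 2 + 4 * A₂) * r + 12 * X) * r * s ^ 2 = D * y ^ 2)
    (hS : 0 < n → D ≠ 0 → (MultRedTable T p a b n .S ↔
      n = intVal p (originCurve (T.coeffA₁ a b) (T.coeffA₂ a b) (T.coeffA₃ a b)).Δ ∧ IsSquare D))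
    (hNS : 0 < n → D ≠ 0 → (MultRedTable T p a b n .NS ↔
      n = intVal p (originCurve (T.coeffA₁ a b) (T.coeffA₂ a b) (T.coeffA₃ a b)).Δ ∧
        ¬ IsSquare D)) :
    TableCorrect T p a b n := by
  have h2' : (2 : ZMod p) ≠ 0 := by
    have : ((2 : ℕ) : ZMod p) ≠ 0 := by
      rw [Ne, ZMod.natCast_eq_zero_iff, Nat.prime_dvd_prime_iff_eq Fact.out Nat.prime_two]
      exact hp
    exact_mod_cast this
  subst h1 h2 h3
  obtain ⟨hD0, h4, hsq⟩ := nodeSplits_iff_isSquare_of_double_root h2' hr hs hd hc hβ hD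
  exact tableCorrect_of_scaled 1 _ _ _ one_ne_zero (by ring) (by ring) (by ring) hE h4
    (fun hn ↦ by rw [hS hn hD0, hsq]) (fun hn ↦ by rw [hNS hn hD0, hsq])

lemma tableCorrect_of_intVal_Δ_eq_zero (hE : (T.curve a b).IsElliptic)
    (h : intVal p (originCurve (T.coeffA₁ a b) (T.coeffA₂ a b) (T.coeffA₃ a b)).Δ = 0)
    (ht : ∀ ℓ, 0 < n → ¬ MultRedTable T p a b n ℓ) : TableCorrect T p a b n := by
  refine tableCorrect_of_not_multiplicative hE (fun k hn _ hΔ ↦ ?_) ht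
  rw [h] at hΔ
  have : 0 = 12 * k + n := by exact_mod_cast hΔ
  omega

/-- From `12k + n < 12` one gets `k = 0`, and then `c₄` would be a unit. -/
lemma tableCorrect_of_dvd_of_not_pow_dvd (hE : (T.curve a b).IsElliptic)
    (h4 : (p : ℤ) ∣ (originCurve (T.coeffA₁ a b) (T.coeffA₂ a b) (T.coeffA₃ a b)).c₄)
    (hΔ : intVal p (originCurve (T.coeffA₁ a b) (T.coeffA₂ a b) (T.coeffA₃ a b)).Δ < 12)
    (ht : ∀ ℓ, 0 < n → ¬ MultRedTable T p a b n ℓ) : TableCorrect T p a b n := by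
  refine tableCorrect_of_not_multiplicative hE (fun k hn hk hk' ↦ ?_) ht
  rw [hk'] at hΔ
  have h1 : 12 * k + n < 12 := by exact_mod_cast hΔ
  have h0 : k = 0 := by omega
  subst h0
  exact intVal_eq_zero_iff.1 (by simpa using hk) h4

lemma tableCorrect_of_intVal_c₄_mod (hE : (T.curve a b).IsElliptic) {j : ℕ} (hj : j % 4 ≠ 0)
    (h4 : intVal p (originCurve (T.coeffA₁ a b) (T.coeffA₂ a b) (T.coeffA₃ a b)).c₄ = j)
    (ht : ∀ ℓ, 0 < n → ¬ MultRedTable T p a b n ℓ) : TableCorrect T p a b n := by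
  refine tableCorrect_of_not_multiplicative hE (fun k hn hk hk' ↦ ?_) ht
  rw [h4] at hk
  have h1 : j = 4 * k := by exact_mod_cast hk
  omega

/-- Multiplicative reduction requires a pole of the `j`-invariant: `v(Δ) - 3 v(c₄) = n > 0`. -/
lemma tableCorrect_of_intVal_Δ_le (hE : (T.curve a b).IsElliptic)
    (h : intVal p (originCurve (T.coeffA₁ a b) (T.coeffA₂ a b) (T.coeffA₃ a b)).Δ ≤
      3 * intVal p (originCurve (T.coeffA₁ a b) (T.coeffA₂ a b) (T.coeffA₃ a b)).c₄)
    (ht : ∀ ℓ, 0 < n → ¬ MultRedTable T p a b n ℓ) : TableCorrect T p a b n := by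
  refine tableCorrect_of_not_multiplicative hE (fun k hn hk hk' ↦ ?_) ht
  rw [hk, hk'] at h
  have h1 : 12 * k + n ≤ 3 * (4 * k) := by exact_mod_cast h
  omega

end Regions

lemma ZMod.eq_one_of_ne_zero_two : ∀ x : ZMod 2, x ≠ 0 → x = 1 := by
  decide

/-- `y² + xy + y = x³` over `𝔽₂` is the reduction in the non-split cases at 2 whose node, `(1, 1)`,
is not the origin. Its tangent quadratic is `t² + t + 1`. -/
lemma c₄_ne_zero_and_not_nodeSplits : (originCurve (1 : ZMod 2) 0 1).c₄ ≠ 0 ∧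
    ¬ (originCurve (1 : ZMod 2) 0 1).NodeSplits := by
  simp only [NodeSplits, originCurve, c₄, b₂, b₄, b₆]
  decide

/-- The tangent quadratic of the non-split nodes at the origin for `p = 2`, where `a₁` and `a₂` are
odd. -/
lemma not_exists_sq_add_self_sub_one : ¬ ∃ t : ZMod 2, t ^ 2 + 1 * t - 1 = 0 := by
  decide

/-! ### Small constants and small primes. -/

section Constants

variable {p : ℕ} [Fact p.Prime]

lemma prime_cast_ne_zero {q : ℕ} (hq : q.Prime) (h : p ≠ q) : ((q : ℕ) : ZMod p) ≠ 0 := by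
  rw [Ne, ZMod.natCast_eq_zero_iff, Nat.prime_dvd_prime_iff_eq Fact.out hq]
  exact h

/-- Zero is a square with symbol 0, so `D ≠ 0` is needed here but not for the value `-1`. -/
lemma legendreSym_eq_one_iff {x : ℤ} {D : ZMod p} (h : (x : ZMod p) = D) (hD : D ≠ 0) :
    legendreSym p x = 1 ↔ IsSquare D := by
  subst h
  exact legendreSym.eq_one_iff p hD

lemma legendreSym_eq_neg_one_iff {x : ℤ} {D : ZMod p} (h : (x : ZMod p) = D) :
    legendreSym p x = -1 ↔ ¬ IsSquare D := by
  subst h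
  exact legendreSym.eq_neg_one_iff p

lemma intVal_eq_coe {x : ℤ} (hx : x ≠ 0) : ∃ m : ℕ, intVal p x = m :=
  ⟨_, intVal_eq_padicValInt hx⟩

lemma intVal_pow_mul {m : ℕ} {x : ℤ} (hx : ¬ (p : ℤ) ∣ x) : intVal p (p ^ m * x) = m := by
  have h1 : intVal p p = 1 :=
    FiniteMultiplicity.emultiplicity_self (Int.finiteMultiplicity_iff.2
      ⟨by simpa using (Fact.out : p.Prime).ne_one, by simpa using (Fact.out : p.Prime).ne_zero⟩)
  rw [intVal_mul, intVal_pow, h1, intVal_eq_zero_iff.2 hx]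
  simp

lemma two_cast_ne_zero (h : p ≠ 2) : (2 : ZMod p) ≠ 0 :=
  mod_cast prime_cast_ne_zero Nat.prime_two h

lemma three_cast_ne_zero (h : p ≠ 3) : (3 : ZMod p) ≠ 0 :=
  mod_cast prime_cast_ne_zero Nat.prime_three h

lemma five_cast_ne_zero (h : p ≠ 5) : (5 : ZMod p) ≠ 0 :=
  mod_cast prime_cast_ne_zero Nat.prime_five h

lemma seven_cast_ne_zero (h : p ≠ 7) : (7 : ZMod p) ≠ 0 :=
  mod_cast prime_cast_ne_zero (by norm_num) h

variable (p) in
lemma eq_two_or_eq_three_or_five_le : p = 2 ∨ p = 3 ∨ 5 ≤ p := by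
  have := (Fact.out : p.Prime).two_le
  rcases (show p = 2 ∨ p = 3 ∨ p = 4 ∨ 5 ≤ p by omega) with h | h | rfl | h
  · exact .inl h
  · exact .inr (.inl h)
  · exact absurd (Fact.out : Nat.Prime 4) (by norm_num)
  · exact .inr (.inr h)

variable (p) in
lemma eq_two_or_eq_three_or_eq_five_or_seven_le : p = 2 ∨ p = 3 ∨ p = 5 ∨ 7 ≤ p := by
  rcases eq_two_or_eq_three_or_five_le p with h | h | h
  · exact .inl h
  · exact .inr (.inl h)
  · rcases (show p = 5 ∨ p = 6 ∨ 7 ≤ p by omega) with h | rfl | h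
    · exact .inr (.inr (.inl h))
    · exact absurd (Fact.out : Nat.Prime 6) (by norm_num)
    · exact .inr (.inr (.inr h))

lemma intVal_prime_mul (x : ℤ) : intVal p (p * x) = 1 + intVal p x := by
  have h1 : ¬ (p : ℤ) ∣ 1 := fun h ↦
    (Nat.prime_iff_prime_int.1 (Fact.out : p.Prime)).not_isUnit (isUnit_of_dvd_one h)
  have := intVal_pow_mul (m := 1) h1
  rw [pow_one, mul_one] at this
  rw [intVal_mul, this]
  rfl

lemma two_mul_intVal (x : ℤ) : intVal 2 (2 * x) = 1 + intVal 2 x := intVal_prime_mul (p := 2) x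

lemma three_mul_intVal (x : ℤ) : intVal 3 (3 * x) = 1 + intVal 3 x := intVal_prime_mul (p := 3) x

lemma intVal_two_eq_zero {x : ℤ} (h : x % 2 ≠ 0) : intVal 2 x = 0 :=
  intVal_eq_zero_iff.2 fun hd ↦ h (Int.emod_eq_zero_of_dvd hd)

lemma intVal_three_eq_zero {x : ℤ} (h : x % 3 ≠ 0) : intVal 3 x = 0 :=
  intVal_eq_zero_iff.2 fun hd ↦ h (Int.emod_eq_zero_of_dvd hd)

lemma cast_zmod_eq_zero_iff {m : ℕ} {x : ℤ} : (x : ZMod m) = 0 ↔ x % m = 0 := by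
  rw [ZMod.intCast_zmod_eq_zero_iff_dvd, Int.dvd_iff_emod_eq_zero]

lemma modEq_one_six_iff (_ : p ≠ 2) : p ≡ 1 [MOD 6] ↔ p ≡ 1 [MOD 3] := by
  have := (Fact.out : p.Prime).eq_two_or_odd
  unfold Nat.ModEq
  omega

end Constants

/-! ### The family `C₃`. -/

section C3

variable {p : ℕ} [Fact p.Prime] {a b : ℤ} {n : ℕ}

lemma C3_Δ (a b : ℤ) : (originCurve (OddTorsionFamily.C3.coeffA₁ a b)
    (OddTorsionFamily.C3.coeffA₂ a b) (OddTorsionFamily.C3.coeffA₃ a b)).Δ =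
    a ^ 8 * b ^ 3 * (a - 27 * b) := by
  simp only [originCurve_Δ, OddTorsionFamily.coeffA₁, OddTorsionFamily.coeffA₂,
    OddTorsionFamily.coeffA₃]
  ring

lemma C3_c₄ (a b : ℤ) : (originCurve (OddTorsionFamily.C3.coeffA₁ a b)
    (OddTorsionFamily.C3.coeffA₂ a b) (OddTorsionFamily.C3.coeffA₃ a b)).c₄ =
    a ^ 3 * (a - 24 * b) := by
  simp only [originCurve_c₄, OddTorsionFamily.coeffA₁, OddTorsionFamily.coeffA₂,
    OddTorsionFamily.coeffA₃]
  ring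

/-- The reduction is not multiplicative when `p ∣ a`. In general `v(a - 27b) ≤ v(a) + 3 v(a - 24b)`,
so `v(Δ) ≤ 3 v(c₄)`; this can fail only for `p = 3` and `a = 27δ` with `δ ≡ b` modulo 3. -/
lemma tableCorrect_C3_of_dvd (hE : (OddTorsionFamily.C3.curve a b).IsElliptic)
    (hb : (b : ZMod p) ≠ 0) (ha : (a : ZMod p) = 0) : TableCorrect .C3 p a b n := by
  have hΔ0 := OddTorsionFamily.Δ_ne_zero hE
  rw [C3_Δ] at hΔ0
  have hb' := intVal_eq_zero_of_ne hb
  have hf (h3 : p ≠ 3) : intVal p (a - 27 * b) = 0 := intVal_eq_zero_of_ne (by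
    push_cast
    have : (27 : ZMod p) * b ≠ 0 := by
      rw [show (27 : ZMod p) = 3 ^ 3 by norm_num]
      exact mul_ne_zero (pow_ne_zero _ (three_cast_ne_zero h3)) hb
    simpa [ha])
  have ht (ℓ) (hn : 0 < n) : ¬ MultRedTable .C3 p a b n ℓ := by
    rcases eq_or_ne p 3 with rfl | h3
    · cases ℓ <;> simp [MultRedTable, hb', hn.ne']
    · cases ℓ <;> simp [MultRedTable, hb', hf h3, hn.ne']
  have hle (h : intVal p (a - 27 * b) ≤ intVal p a + 3 * intVal p (a - 24 * b)) :
      TableCorrect .C3 p a b n := by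
    refine tableCorrect_of_intVal_Δ_le hE ?_ ht
    rw [C3_Δ, C3_c₄]
    simp only [intVal_mul, intVal_pow, hb', mul_zero, add_zero]
    calc _ ≤ (8 : ℕ) * intVal p a + (intVal p a + 3 * intVal p (a - 24 * b)) := by gcongr
      _ = _ := by push_cast; ring
  rcases eq_or_ne p 3 with rfl | h3
  · obtain ⟨α, rfl⟩ := (ZMod.intCast_zmod_eq_zero_iff_dvd a 3).1 ha
    rw [Ne, cast_zmod_eq_zero_iff] at hb
    push_cast at *
    by_cases hα : α % 3 = 0
    · obtain ⟨γ, rfl⟩ := Int.dvd_of_emod_eq_zero hα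
      have e2 : intVal 3 (3 * (3 * γ) - 24 * b) = 1 := by
        rw [show 3 * (3 * γ) - 24 * b = 3 * (3 * γ - 8 * b) by ring, three_mul_intVal,
          intVal_three_eq_zero (by omega), add_zero]
      rw [show 3 * (3 * γ) - 27 * b = 3 * (3 * (γ - 3 * b)) by ring] at hle hΔ0
      simp only [e2, three_mul_intVal] at hle
      by_cases hγ : γ % 3 = 0
      · obtain ⟨δ, rfl⟩ := Int.dvd_of_emod_eq_zero hγ
        have hδ0 : δ ≠ 0 := by
          rintro rfl
          simp at hΔ0
        obtain ⟨m, hm⟩ := intVal_eq_coe (p := 3) hδ0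
        rw [← mul_sub, three_mul_intVal, three_mul_intVal, hm] at hle
        by_cases hδ : (δ - b) % 3 = 0
        -- There is no bound on `v₃(a - 27b)` here, but `v₃(c₄) = 3 * 3 + 1` is not a multiple of 4.
        · refine tableCorrect_of_intVal_c₄_mod hE (j := 10) (by norm_num) ?_ ht
          rw [C3_c₄, intVal_mul, e2, intVal_pow, three_mul_intVal, three_mul_intVal,
            three_mul_intVal, intVal_three_eq_zero (x := δ) (by omega)]
          norm_num
        · rw [intVal_three_eq_zero hδ] at hle
          refine hle ?_
          norm_cast
          omega
      · rw [intVal_three_eq_zero (x := γ - 3 * b) (by omega),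
          intVal_three_eq_zero (x := γ) (by omega)] at hle
        exact hle (by norm_num)
    · rw [show 3 * α - 27 * b = 3 * (α - 9 * b) by ring, three_mul_intVal, three_mul_intVal,
        intVal_three_eq_zero (x := α - 9 * b) (by omega),
        intVal_three_eq_zero (x := α) (by omega)] at hle
      refine hle ?_
      rw [add_zero]
      exact le_self_add
  · refine hle ?_
    rw [hf h3]
    exact zero_le

lemma tableCorrect_C3 (hab : IsCoprime a b) (hE : (OddTorsionFamily.C3.curve a b).IsElliptic) :
    TableCorrect .C3 p a b n := by
  have hco := cast_ne_zero_of_isCoprime (p := p) hab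
  by_cases hb : (b : ZMod p) = 0
  · have ha : (a : ZMod p) ≠ 0 := fun h ↦ hco ⟨h, hb⟩
    have ha' := intVal_eq_zero_of_ne ha
    have hf' : intVal p (a - 27 * b) = 0 := intVal_eq_zero_of_ne (by push_cast; simpa [hb])
    refine tableCorrect_of_split 1 _ _ _ one_ne_zero (by ring) (by ring) (by ring) hE ?_ ?_ ?_
      (fun hn ↦ ?_) (fun hn ↦ ?_)
    · simpa [OddTorsionFamily.coeffA₁]
    · simp [OddTorsionFamily.coeffA₂]
    · simp [OddTorsionFamily.coeffA₃, hb]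
    · rw [C3_Δ]
      simp [MultRedTable, intVal_mul, intVal_pow, ha', hf', hn.ne']
    · simp [MultRedTable, hf', hn.ne']
  have hb' := intVal_eq_zero_of_ne hb
  by_cases ha : (a : ZMod p) = 0
  · exact tableCorrect_C3_of_dvd hE hb ha
  have ha' := intVal_eq_zero_of_ne ha
  by_cases hf : (a : ZMod p) - 27 * b = 0
  · have hA : (a : ZMod p) = 27 * b := sub_eq_zero.1 hf
    have h3 : p ≠ 3 := by
      rintro rfl
      exact ha (by rw [hA]; reduce_mod_char)
    have h3' : (3 : ZMod p) ≠ 0 := prime_cast_ne_zero Nat.prime_three h3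
    have hv : intVal p (originCurve (OddTorsionFamily.C3.coeffA₁ a b)
        (OddTorsionFamily.C3.coeffA₂ a b) (OddTorsionFamily.C3.coeffA₃ a b)).Δ =
        intVal p (a - 27 * b) := by
      simp [C3_Δ, intVal_mul, intVal_pow, ha', hb']
    rcases eq_two_or_eq_three_or_five_le p with rfl | h | h5
    · have hb1 : (b : ZMod 2) = 1 := ZMod.eq_one_of_ne_zero_two _ hb
      have ha1 : (a : ZMod 2) = 1 := ZMod.eq_one_of_ne_zero_two _ ha
      have e : originCurve (OddTorsionFamily.C3.coeffA₁ a b : ZMod 2)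
          (OddTorsionFamily.C3.coeffA₂ a b : ZMod 2) (OddTorsionFamily.C3.coeffA₃ a b : ZMod 2) =
          originCurve 1 0 1 := by
        simp [OddTorsionFamily.coeffA₁, OddTorsionFamily.coeffA₂, OddTorsionFamily.coeffA₃, ha1,
          hb1]
      refine tableCorrect_of_scaled 1 _ _ _ one_ne_zero (by ring) (by ring) (by ring) hE ?_
        (fun hn ↦ ?_) (fun hn ↦ ?_)
      · rw [e]
        exact c₄_ne_zero_and_not_nodeSplits.1
      · rw [e, hv]
        simp [MultRedTable, hb', hn.ne', c₄_ne_zero_and_not_nodeSplits.2, Nat.ModEq]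
      · rw [e, hv]
        simp [MultRedTable, c₄_ne_zero_and_not_nodeSplits.2]
    · exact absurd h h3
    have h2 : p ≠ 2 := by omega
    -- For `a ≡ 27b` the double root is `-81 b²`, and `β = 729 b² - 972 b² = -3 (9b)²`.
    refine tableCorrect_of_double_root (X := -81 * b ^ 2) (r := 1) (s := 1) (y := 9 * b)
      (-3) h2 hE (by push_cast [OddTorsionFamily.coeffA₁]; exact hA)
      (by simp [OddTorsionFamily.coeffA₂]; rfl)
      (by push_cast [OddTorsionFamily.coeffA₃]; rw [hA]) one_ne_zero one_ne_zero ?_ ?_ ?_ ?_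
      (fun hn _ ↦ ?_) (fun hn _ ↦ ?_)
    · ring
    · ring
    · have : (-3 : ZMod p) ^ 5 * b ^ 2 ≠ 0 :=
        mul_ne_zero (pow_ne_zero _ (neg_ne_zero.2 h3')) (pow_ne_zero _ hb)
      contrapose! this
      linear_combination this
    · ring
    · rw [hv, isSquare_neg_three_iff h5]
      simp [MultRedTable, hb', hn.ne', h3]
    · rw [hv, isSquare_neg_three_iff h5, ← modEq_five_iff h5]
      simp [MultRedTable, h3, h2]
  have hf' : intVal p (a - 27 * b) = 0 := intVal_eq_zero_of_ne (by push_cast; exact hf)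
  refine tableCorrect_of_intVal_Δ_eq_zero hE ?_ (fun ℓ hn ↦ ?_)
  · rw [C3_Δ]
    simp [intVal_mul, intVal_pow, ha', hf', hb']
  · cases ℓ <;> simp [MultRedTable, hf', hb', hn.ne']

end C3

/-! ### The family `C₅`. -/

section C5

variable {p : ℕ} [Fact p.Prime] {a b : ℤ} {n : ℕ}

lemma C5_Δ (a b : ℤ) : (originCurve (OddTorsionFamily.C5.coeffA₁ a b)
    (OddTorsionFamily.C5.coeffA₂ a b) (OddTorsionFamily.C5.coeffA₃ a b)).Δ =
    -((a * b) ^ 5 * (a ^ 2 + 11 * a * b - b ^ 2)) := by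
  simp only [originCurve_Δ, OddTorsionFamily.coeffA₁, OddTorsionFamily.coeffA₂,
    OddTorsionFamily.coeffA₃]
  ring

lemma C5_ne_zero_mod_two : ∀ x y : ZMod 2, x ≠ 0 → y ≠ 0 → x ^ 2 + 11 * x * y - y ^ 2 ≠ 0 := by
  decide

lemma C5_ne_zero_mod_three : ∀ x y : ZMod 3, x ≠ 0 → y ≠ 0 → x ^ 2 + 11 * x * y - y ^ 2 ≠ 0 := by
  decide

/-- The form has discriminant 125 and equals `(x - 2y)²` modulo 5. -/
lemma C5_eq_mod_five : ∀ x y : ZMod 5, x ^ 2 + 11 * x * y - y ^ 2 = 0 → x = 2 * y := by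
  decide

/-- For `a = 2b + 5u` the form is `25 (b² + 3ub + u²)`, with bracket `(u - b)²` modulo 5; putting `u
= b + 5w` turns the bracket into `5 (b² + 5bw + 5w²)`. The valuation is thus at most 3, which keeps
`v₅(Δ)` below 12. -/
lemma C5_not_dvd {a b : ℤ} (hb : b % 5 ≠ 0) (h : (5 : ℤ) ∣ a - 2 * b) :
    ¬ (5 : ℤ) ^ 4 ∣ a ^ 2 + 11 * a * b - b ^ 2 := by
  have h5 : Prime (5 : ℤ) := by norm_num
  obtain ⟨u, hu⟩ := h
  obtain rfl : a = 2 * b + 5 * u := by omega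
  rintro ⟨k, hk⟩
  have h1 : b ^ 2 + 3 * u * b + u ^ 2 = 25 * k := by linarith
  have h2 : (5 : ℤ) ∣ (u - b) ^ 2 := ⟨5 * k - u * b, by linear_combination h1⟩
  obtain ⟨w, hw⟩ := h5.dvd_of_dvd_pow h2
  obtain rfl : u = b + 5 * w := by omega
  have h3 : b ^ 2 = 5 * (k - b * w - w ^ 2) := by linarith
  obtain ⟨v, hv⟩ := h5.dvd_of_dvd_pow (Dvd.intro _ h3.symm)
  omega

lemma tableCorrect_C5_of_dvd_mul (hab : IsCoprime a b)
    (hE : (OddTorsionFamily.C5.curve a b).IsElliptic) (h : (a : ZMod p) * b = 0) :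
    TableCorrect .C5 p a b n := by
  have hco := cast_ne_zero_of_isCoprime (p := p) hab
  have hf : (a : ZMod p) ^ 2 + 11 * a * b - b ^ 2 ≠ 0 := fun hf ↦ hco (by
    rcases mul_eq_zero.1 h with h | h <;> simpa [h] using hf)
  have hf' : intVal p (a ^ 2 + 11 * a * b - b ^ 2) = 0 :=
    intVal_eq_zero_of_ne (by push_cast; exact hf)
  refine tableCorrect_of_split 1 _ _ _ one_ne_zero (by ring) (by ring) (by ring) hE ?_ ?_ ?_
    (fun hn ↦ ?_) (fun hn ↦ ?_)
  · intro h1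
    push_cast [OddTorsionFamily.coeffA₁] at h1
    exact hf (by linear_combination (a + b : ZMod p) * h1 + 11 * h)
  · push_cast [OddTorsionFamily.coeffA₂]
    rw [h, neg_zero]
  · push_cast [OddTorsionFamily.coeffA₃]
    linear_combination (-a : ZMod p) * h
  · simp only [MultRedTable, C5_Δ, intVal_neg, intVal_mul, intVal_pow, hf']
    simp [hn.ne', mul_add]
  · simp [MultRedTable, hf', hn.ne']

lemma tableCorrect_C5_of_dvd (hE : (OddTorsionFamily.C5.curve a b).IsElliptic)
    (ha : (a : ZMod p) ≠ 0) (hb : (b : ZMod p) ≠ 0)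
    (hf : (a : ZMod p) ^ 2 + 11 * a * b - b ^ 2 = 0) : TableCorrect .C5 p a b n := by
  have ha' := intVal_eq_zero_of_ne ha
  have hb' := intVal_eq_zero_of_ne hb
  have hv : intVal p (originCurve (OddTorsionFamily.C5.coeffA₁ a b)
      (OddTorsionFamily.C5.coeffA₂ a b) (OddTorsionFamily.C5.coeffA₃ a b)).Δ =
      intVal p (a ^ 2 + 11 * a * b - b ^ 2) := by
    simp [C5_Δ, intVal_neg, intVal_mul, intVal_pow, ha', hb']
  rcases eq_two_or_eq_three_or_eq_five_or_seven_le p with rfl | rfl | rfl | h7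
  · exact (C5_ne_zero_mod_two _ _ ha hb hf).elim
  · exact (C5_ne_zero_mod_three _ _ ha hb hf).elim
  · have hA : (a : ZMod 5) = 2 * b := C5_eq_mod_five _ _ hf
    refine tableCorrect_of_dvd_of_not_pow_dvd hE ?_ ?_ fun ℓ hn ↦ ?_
    · rw [← ZMod.intCast_zmod_eq_zero_iff_dvd, originCurve_c₄]
      push_cast [OddTorsionFamily.coeffA₁, OddTorsionFamily.coeffA₂, OddTorsionFamily.coeffA₃]
      rw [hA]
      ring_nf
      reduce_mod_char
    · rw [hv]
      refine lt_of_lt_of_le (emultiplicity_lt_iff_not_dvd.2 (C5_not_dvd (a := a) (b := b) ?_ ?_))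
        (by norm_num)
      · rwa [Ne, cast_zmod_eq_zero_iff] at hb
      · rw [← sub_eq_zero] at hA
        exact (ZMod.intCast_zmod_eq_zero_iff_dvd _ 5).1 (by push_cast; exact hA)
    · cases ℓ <;> simp [MultRedTable, intVal_mul, ha', hb', hn.ne']
  · have h5 := five_cast_ne_zero (p := p) (by omega)
    have hD : ((-5 * (a ^ 2 + b ^ 2) : ℤ) : ZMod p) = -5 * a ^ 2 - 5 * b ^ 2 := by
      push_cast
      ring
    -- Modulo the quadratic form the double root is `(8ab - b²) / 5`, linear in `a`. The cofactors
    -- in the identities below are quotients by that form.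
    refine tableCorrect_of_double_root (X := 8 * a * b - b ^ 2) (r := 5) (s := 1) (y := 1)
      (-5 * a ^ 2 - 5 * b ^ 2) (by omega) hE (by push_cast [OddTorsionFamily.coeffA₁]; rfl)
      (by push_cast [OddTorsionFamily.coeffA₂]; rfl) (by push_cast [OddTorsionFamily.coeffA₃]; rfl)
      h5 one_ne_zero ?_ ?_ ?_ ?_ (fun hn hD0 ↦ ?_) (fun hn _ ↦ ?_)
    · linear_combination (15 * a * b - b ^ 2 : ZMod p) * hf
    · linear_combination (45 * a ^ 2 * b ^ 2 + 3 * a * b ^ 3 - b ^ 4 : ZMod p) * hf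
    -- A Bézout identity in `a`: a common zero of `β` and the quadratic form would give `5³ b³ = 0`.
    -- The later families use the same device.
    · have : (5 : ZMod p) ^ 3 * b ^ 3 ≠ 0 := mul_ne_zero (pow_ne_zero _ h5) (pow_ne_zero _ hb)
      contrapose! this
      linear_combination (-11 * a - 123 * b : ZMod p) * this - (-55 * a - 736 * b) * hf
    · linear_combination 30 * hf
    · rw [hv, ← legendreSym_eq_one_iff hD hD0]
      simp [MultRedTable, intVal_mul, ha', hb', hn.ne', h7]
    · rw [hv, ← legendreSym_eq_neg_one_iff hD]
      simp [MultRedTable, h7]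

theorem tableCorrect_C5 (hab : IsCoprime a b) (hE : (OddTorsionFamily.C5.curve a b).IsElliptic) :
    TableCorrect .C5 p a b n := by
  by_cases h : (a : ZMod p) * b = 0
  · exact tableCorrect_C5_of_dvd_mul hab hE h
  obtain ⟨ha, hb⟩ := mul_ne_zero_iff.1 h
  by_cases hf : (a : ZMod p) ^ 2 + 11 * a * b - b ^ 2 = 0
  · exact tableCorrect_C5_of_dvd hE ha hb hf
  have ha' := intVal_eq_zero_of_ne ha
  have hb' := intVal_eq_zero_of_ne hb
  have hf' : intVal p (a ^ 2 + 11 * a * b - b ^ 2) = 0 :=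
    intVal_eq_zero_of_ne (by push_cast; exact hf)
  refine tableCorrect_of_intVal_Δ_eq_zero hE ?_ (fun ℓ hn ↦ ?_)
  · simp [C5_Δ, intVal_neg, intVal_mul, intVal_pow, ha', hb', hf']
  · cases ℓ <;> simp [MultRedTable, intVal_mul, ha', hb', hf', hn.ne']

end C5

/-! ### The family `C₆`. -/

section C6

variable {p : ℕ} [Fact p.Prime] {a b : ℤ} {n : ℕ}

lemma C6_Δ (a b : ℤ) : (originCurve (OddTorsionFamily.C6.coeffA₁ a b)
    (OddTorsionFamily.C6.coeffA₂ a b) (OddTorsionFamily.C6.coeffA₃ a b)).Δ =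
    a ^ 2 * b ^ 6 * (a + b) ^ 3 * (a + 9 * b) := by
  simp only [originCurve_Δ, OddTorsionFamily.coeffA₁, OddTorsionFamily.coeffA₂,
    OddTorsionFamily.coeffA₃]
  ring

lemma C6_c₄ (a b : ℤ) : (originCurve (OddTorsionFamily.C6.coeffA₁ a b)
    (OddTorsionFamily.C6.coeffA₂ a b) (OddTorsionFamily.C6.coeffA₃ a b)).c₄ =
    (a + 3 * b) * (a ^ 3 + 9 * a ^ 2 * b + 3 * a * b ^ 2 + 3 * b ^ 3) := by
  simp only [originCurve_c₄, OddTorsionFamily.coeffA₁, OddTorsionFamily.coeffA₂,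
    OddTorsionFamily.coeffA₃]
  ring

lemma tableCorrect_C6_of_dvd_right (hE : (OddTorsionFamily.C6.curve a b).IsElliptic)
    (ha : (a : ZMod p) ≠ 0) (hb : (b : ZMod p) = 0) : TableCorrect .C6 p a b n := by
  have ha' := intVal_eq_zero_of_ne ha
  have h1' : intVal p (a + b) = 0 := intVal_eq_zero_of_ne (by simpa [hb])
  have h9' : intVal p (a + 9 * b) = 0 := intVal_eq_zero_of_ne (by simpa [hb])
  refine tableCorrect_of_split 1 _ _ _ one_ne_zero (by ring) (by ring) (by ring) hE ?_ ?_ ?_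
    (fun hn ↦ ?_) (fun hn ↦ ?_)
  · simpa [OddTorsionFamily.coeffA₁, hb]
  · simp [OddTorsionFamily.coeffA₂, hb]
  · simp [OddTorsionFamily.coeffA₃, hb]
  · rw [C6_Δ]
    rcases eq_or_ne p 2 with rfl | h2
    · simp [MultRedTable, intVal_mul, intVal_pow, ha', h1', h9', hn.ne']
    · simp [MultRedTable, intVal_mul, intVal_pow, ha', h1', h9', hn.ne', h2]
  · rcases eq_or_ne p 2 with rfl | h2
    · simp [MultRedTable, ha', h1', hn.ne']
    · simp [MultRedTable, ha', h9', hn.ne', h2]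

/-- If `9 ∣ a` then `v₃(c₄) = 2`; if `3` divides `a` exactly once then `v₃(Δ) = 3` while `3 ∣ c₄`.
Neither is compatible with multiplicative reduction. -/
lemma tableCorrect_C6_of_three_dvd_left (hE : (OddTorsionFamily.C6.curve a b).IsElliptic)
    [Fact (Nat.Prime 3)]
    (ha : a % 3 = 0) (hb : b % 3 ≠ 0) : TableCorrect .C6 3 a b n := by
  obtain ⟨α, rfl⟩ := Int.dvd_of_emod_eq_zero ha
  have ht (ℓ) (hn : 0 < n) : ¬ MultRedTable .C6 3 (3 * α) b n ℓ := by
    have hb' := intVal_three_eq_zero hb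
    cases ℓ <;> simp [MultRedTable, hb', hn.ne', three_mul_intVal]
  by_cases hα : α % 3 = 0
  · obtain ⟨γ, rfl⟩ := Int.dvd_of_emod_eq_zero hα
    refine tableCorrect_of_intVal_c₄_mod hE (j := 2) (by norm_num) ?_ ht
    rw [C6_c₄, intVal_mul, show 3 * (3 * γ) + 3 * b = 3 * (3 * γ + b) by ring,
      show (3 * (3 * γ)) ^ 3 + 9 * (3 * (3 * γ)) ^ 2 * b + 3 * (3 * (3 * γ)) * b ^ 2 + 3 * b ^ 3 =
        3 * (3 * (81 * γ ^ 3 + 81 * γ ^ 2 * b + 3 * γ * b ^ 2) + b ^ 3) by ring, three_mul_intVal,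
      three_mul_intVal, intVal_three_eq_zero (by omega), intVal_three_eq_zero]
    · norm_num
    · intro h
      have : (3 : ℤ) ∣ b ^ 3 := by omega
      have := Int.prime_three.dvd_of_dvd_pow this
      omega
  · refine tableCorrect_of_dvd_of_not_pow_dvd hE ?_ ?_ ht
    · rw [C6_c₄]
      exact Dvd.dvd.mul_right ⟨α + b, by push_cast; ring⟩ _
    · rw [C6_Δ, show 3 * α + 9 * b = 3 * (α + 3 * b) by ring]
      rw [intVal_mul, intVal_mul, intVal_mul, intVal_pow, intVal_pow, intVal_pow,
        three_mul_intVal, three_mul_intVal, intVal_three_eq_zero hα, intVal_three_eq_zero hb,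
        intVal_three_eq_zero (x := 3 * α + b) (by omega),
        intVal_three_eq_zero (x := α + 3 * b) (by omega)]
      norm_num

lemma tableCorrect_C6_of_dvd_left (hE : (OddTorsionFamily.C6.curve a b).IsElliptic)
    (ha : (a : ZMod p) = 0) (hb : (b : ZMod p) ≠ 0) : TableCorrect .C6 p a b n := by
  rcases eq_or_ne p 3 with rfl | h3
  · rw [cast_zmod_eq_zero_iff] at ha
    rw [Ne, cast_zmod_eq_zero_iff] at hb
    exact tableCorrect_C6_of_three_dvd_left hE ha hb
  have h3' := three_cast_ne_zero h3
  have hb' := intVal_eq_zero_of_ne hb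
  have h1' : intVal p (a + b) = 0 := intVal_eq_zero_of_ne (by simpa [ha])
  have h9' : intVal p (a + 9 * b) = 0 := intVal_eq_zero_of_ne (by
    push_cast
    rw [ha, zero_add, show (9 : ZMod p) = 3 ^ 2 by norm_num]
    exact mul_ne_zero (pow_ne_zero _ h3') hb)
  have hv : intVal p (originCurve (OddTorsionFamily.C6.coeffA₁ a b)
      (OddTorsionFamily.C6.coeffA₂ a b) (OddTorsionFamily.C6.coeffA₃ a b)).Δ =
      2 * intVal p a := by
    simp [C6_Δ, intVal_mul, intVal_pow, h1', hb', h9']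
  -- With `a ≡ 0` the quadratic is `t² - bt + b²`, which is `b² (s² + s + 1)` for `t = -bs`.
  have hroot : (∃ t : ZMod p, t ^ 2 + (OddTorsionFamily.C6.coeffA₁ a b : ZMod p) * t -
      (OddTorsionFamily.C6.coeffA₂ a b : ZMod p) = 0) ↔ p ≡ 1 [MOD 3] := by
    rw [← exists_sq_add_self_add_one_eq_zero_iff h3]
    push_cast [OddTorsionFamily.coeffA₁, OddTorsionFamily.coeffA₂]
    rw [ha]
    constructor
    · rintro ⟨t, ht⟩
      refine ⟨-t / b, ?_⟩
      field_simp
      linear_combination ht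
    · rintro ⟨s, hs⟩
      exact ⟨-b * s, by linear_combination (b ^ 2 : ZMod p) * hs⟩
  have hcase : p = 2 ∨ (p ≠ 2 ∧ 5 ≤ p) := by
    rcases eq_two_or_eq_three_or_five_le p with h | h | h <;> omega
  refine tableCorrect_of_origin 1 _ _ _ one_ne_zero (by ring) (by ring) (by ring) hE ?_ ?_
    (fun hn ↦ ?_) (fun hn ↦ ?_)
  · have : (-3 : ZMod p) * b ^ 2 ≠ 0 := mul_ne_zero (neg_ne_zero.2 h3') (pow_ne_zero _ hb)
    convert this using 1
    push_cast [OddTorsionFamily.coeffA₁, OddTorsionFamily.coeffA₂]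
    rw [ha]
    ring
  · simp [OddTorsionFamily.coeffA₃, ha]
  · rw [hv, hroot]
    rcases hcase with rfl | ⟨h2, h5⟩
    · simp [MultRedTable, hb', h1', hn.ne', Nat.ModEq]
    · rw [← modEq_one_six_iff h2]
      simp [MultRedTable, hb', h1', h9', hn.ne', h2, h3]
  · rw [hv, hroot]
    rcases hcase with rfl | ⟨h2, h5⟩
    · simp [MultRedTable, h1', Nat.ModEq]
    · rw [← modEq_one_six_iff h2, ← modEq_five_iff h5]
      simp [MultRedTable, h9', hn.ne', h2, h3]

/-- Both `a₂` and `a₃` are multiples of `a + b`. For odd `p` the residues `a₁ ≡ -2b` and `a + 9b ≡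
8b` are units. -/
lemma tableCorrect_C6_of_dvd_add (hE : (OddTorsionFamily.C6.curve a b).IsElliptic) (h2 : p ≠ 2)
    (ha : (a : ZMod p) ≠ 0) (hb : (b : ZMod p) ≠ 0) (h : (a + b : ZMod p) = 0) :
    TableCorrect .C6 p a b n := by
  have h2' := two_cast_ne_zero h2
  have hA : (a : ZMod p) = -b := eq_neg_of_add_eq_zero_left h
  have ha' := intVal_eq_zero_of_ne ha
  have hb' := intVal_eq_zero_of_ne hb
  have h9' : intVal p (a + 9 * b) = 0 := intVal_eq_zero_of_ne (by
    push_cast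
    rw [hA, show (-b + 9 * b : ZMod p) = 2 ^ 3 * b by ring]
    exact mul_ne_zero (pow_ne_zero _ h2') hb)
  have h3 : 3 ≤ p := by
    have := (Fact.out : p.Prime).two_le
    omega
  have h3' : p = 3 → intVal 3 a = 0 := by
    rintro rfl
    exact ha'
  refine tableCorrect_of_split 1 _ _ _ one_ne_zero (by ring) (by ring) (by ring) hE ?_ ?_ ?_
    (fun hn ↦ ?_) (fun hn ↦ ?_)
  · push_cast [OddTorsionFamily.coeffA₁]
    rw [hA, show (-b - b : ZMod p) = -(2 * b) by ring]
    exact neg_ne_zero.2 (mul_ne_zero h2' hb)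
  · push_cast [OddTorsionFamily.coeffA₂]
    linear_combination (-b : ZMod p) * h
  · push_cast [OddTorsionFamily.coeffA₃]
    linear_combination (-a * b : ZMod p) * h
  · rw [C6_Δ]
    simp [MultRedTable, intVal_mul, intVal_pow, ha', hb', h9', hn.ne', h2, h3]
    exact fun _ ↦ h3'
  · simp [MultRedTable, ha', h9', hn.ne', h2]

lemma tableCorrect_C6_of_dvd_add_nine (hE : (OddTorsionFamily.C6.curve a b).IsElliptic)
    (ha : (a : ZMod p) ≠ 0) (hb : (b : ZMod p) ≠ 0) (h1 : (a + b : ZMod p) ≠ 0)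
    (h : (a + 9 * b : ZMod p) = 0) : TableCorrect .C6 p a b n := by
  have hA : (a : ZMod p) = -9 * b := by linear_combination h
  have ha' := intVal_eq_zero_of_ne ha
  have hb' := intVal_eq_zero_of_ne hb
  have h1' : intVal p (a + b) = 0 := intVal_eq_zero_of_ne (by push_cast; exact h1)
  have h2 : p ≠ 2 := by
    rintro rfl
    apply h1
    rw [hA]
    ring_nf
    reduce_mod_char
  have h3 : p ≠ 3 := by
    rintro rfl
    apply ha
    rw [hA]
    reduce_mod_char
  have h5 : 5 ≤ p := by
    rcases eq_two_or_eq_three_or_five_le p with h | h | h <;> omega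
  have hv : intVal p (originCurve (OddTorsionFamily.C6.coeffA₁ a b)
      (OddTorsionFamily.C6.coeffA₂ a b) (OddTorsionFamily.C6.coeffA₃ a b)).Δ =
      intVal p (a + 9 * b) := by
    simp [C6_Δ, intVal_mul, intVal_pow, h1', hb', ha']
  refine tableCorrect_of_double_root (X := -12 * b ^ 2) (r := 1) (s := 1) (y := 2 * b)
    (A₁ := -10 * b) (A₂ := 8 * b ^ 2) (A₃ := -72 * b ^ 3)
    (-3) h2 hE ?_ ?_ ?_ one_ne_zero one_ne_zero (by ring) (by ring) ?_ (by ring)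
    (fun hn _ ↦ ?_) (fun hn _ ↦ ?_)
  · push_cast [OddTorsionFamily.coeffA₁]
    rw [hA]
    ring
  · push_cast [OddTorsionFamily.coeffA₂]
    rw [hA]
    ring
  · push_cast [OddTorsionFamily.coeffA₃]
    rw [hA]
    ring
  · have : (2 : ZMod p) ^ 2 * 3 * b ^ 2 ≠ 0 := mul_ne_zero (mul_ne_zero
      (pow_ne_zero _ (two_cast_ne_zero h2)) (three_cast_ne_zero h3)) (pow_ne_zero _ hb)
    contrapose! this
    linear_combination -this
  · rw [hv, isSquare_neg_three_iff h5]
    simp [MultRedTable, hb', ha', h1', hn.ne', h2, show 3 < p by omega]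
  · rw [hv, isSquare_neg_three_iff h5, ← modEq_five_iff h5]
    simp [MultRedTable, ha', h2, hn.ne', show 3 < p by omega]

/-- If `a + b = 8u`, scaling by 2 leaves `a₁` odd, `a₂` even and `a₃ ≡ u`, with `v(Δ) = 3 v(u) + v(u
+ b)`. Since `b` is odd only one summand can be nonzero, and the parity of `u` decides between split
and non-split. If `8 ∤ a + b`, then `v(Δ)` is 4 or 8 and `c₄` is even: additive. -/
lemma tableCorrect_C6_two [Fact (Nat.Prime 2)]
    (hE : (OddTorsionFamily.C6.curve a b).IsElliptic) (ha : a % 2 = 1) (hb : b % 2 = 1) :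
    TableCorrect .C6 2 a b n := by
  have ha' := intVal_two_eq_zero (x := a) (by omega)
  have hb' := intVal_two_eq_zero (x := b) (by omega)
  have hΔ0 := OddTorsionFamily.Δ_ne_zero hE
  rw [C6_Δ] at hΔ0
  by_cases h8 : (a + b) % 8 = 0
  · obtain ⟨u, hu⟩ := Int.dvd_of_emod_eq_zero h8
    obtain rfl : a = 8 * u - b := by omega
    have e1 : intVal 2 (8 * u - b + b) = 3 + intVal 2 u := by
      rw [show 8 * u - b + b = 2 * (2 * (2 * u)) by ring]
      simp only [two_mul_intVal]
      ring
    have e9 : intVal 2 (8 * u - b + 9 * b) = 3 + intVal 2 (u + b) := by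
      rw [show 8 * u - b + 9 * b = 2 * (2 * (2 * (u + b))) by ring]
      simp only [two_mul_intVal]
      ring
    have hv : intVal 2 (originCurve (4 * u - b) (-2 * b * u) (-((8 * u - b) * b * u))).Δ =
        3 * intVal 2 u + intVal 2 (u + b) := by
      rw [show (originCurve (4 * u - b) (-2 * b * u) (-((8 * u - b) * b * u))).Δ =
        (8 * u - b) ^ 2 * b ^ 6 * u ^ 3 * (u + b) by rw [originCurve_Δ]; ring,
        intVal_mul, intVal_mul, intVal_mul, intVal_pow, intVal_pow, intVal_pow, ha', hb']
      simp
    have hb1 : (b : ZMod 2) = 1 := ZMod.eq_one_of_ne_zero_two _ (by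
      rw [Ne, cast_zmod_eq_zero_iff]
      push_cast
      omega)
    have hu0 : u ≠ 0 := by
      rintro rfl
      simp at hΔ0
    have hub0 : u + b ≠ 0 := by
      intro h
      apply hΔ0
      rw [show 8 * u - b + 9 * b = 8 * (u + b) by ring, h]
      ring
    obtain ⟨k, hk⟩ := intVal_eq_coe (p := 2) hu0
    obtain ⟨l, hl⟩ := intVal_eq_coe (p := 2) hub0
    by_cases hue : u % 2 = 0
    · have hl0 := intVal_two_eq_zero (x := u + b) (by omega)
      have hu2 : (u : ZMod 2) = 0 := cast_zmod_eq_zero_iff.2 hue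
      have hk0 : k ≠ 0 := by
        rintro rfl
        exact intVal_eq_zero_iff.1 hk (Int.dvd_of_emod_eq_zero hue)
      refine tableCorrect_of_split 2 (4 * u - b) (-2 * b * u) (-((8 * u - b) * b * u)) two_ne_zero
        ?_ ?_ ?_ hE ?_ ?_ ?_ (fun hn ↦ ?_) (fun hn ↦ ?_)
      · simp only [OddTorsionFamily.coeffA₁]
        ring
      · simp only [OddTorsionFamily.coeffA₂]
        ring
      · simp only [OddTorsionFamily.coeffA₃]
        ring
      · push_cast
        rw [hb1, hu2, mul_zero, zero_sub]
        exact neg_ne_zero.2 one_ne_zero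
      · push_cast
        simp [hu2]
      · push_cast
        simp [hu2]
      · rw [hv, hk, hl0]
        simp only [MultRedTable, e1, hk, ha', hb']
        norm_cast
        simp [hn.ne']
        omega
      · simp only [MultRedTable, e1, hk, ha']
        norm_cast
        simp [hn.ne']
        omega
    · have hk0 := intVal_two_eq_zero hue
      have hu2 : (u : ZMod 2) = 1 := ZMod.eq_one_of_ne_zero_two _ (by
        rw [Ne, cast_zmod_eq_zero_iff]
        exact hue)
      obtain ⟨h4, hs⟩ := c₄_ne_zero_and_not_nodeSplits
      have e : originCurve (((4 * u - b : ℤ)) : ZMod 2) ((-2 * b * u : ℤ) : ZMod 2)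
          ((-((8 * u - b) * b * u) : ℤ) : ZMod 2) = originCurve 1 0 1 := by
        push_cast
        rw [hb1, hu2]
        congr 1
        reduce_mod_char
      refine tableCorrect_of_scaled 2 (4 * u - b) (-2 * b * u) (-((8 * u - b) * b * u)) two_ne_zero
        ?_ ?_ ?_ hE ?_ (fun hn ↦ ?_) (fun hn ↦ ?_)
      · simp only [OddTorsionFamily.coeffA₁]
        ring
      · simp only [OddTorsionFamily.coeffA₂]
        ring
      · simp only [OddTorsionFamily.coeffA₃]
        ring
      · rwa [e]
      · rw [e]
        simp only [MultRedTable, e1, hk0, hb', ha', hs]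
        simp [hn.ne']
      · rw [e, hv, hk0, hl]
        simp only [MultRedTable, e1, e9, hk0, hl, ha']
        norm_cast
        simp [hn.ne', hs]
        omega
  · obtain ⟨u, hu⟩ : ∃ u, a + b = 2 * u := ⟨(a + b) / 2, by omega⟩
    obtain rfl : a = 2 * u - b := by omega
    have e1 : intVal 2 (2 * u - b + b) = 1 + intVal 2 u := by
      rw [show 2 * u - b + b = 2 * u by ring, two_mul_intVal]
    have e9 : intVal 2 (2 * u - b + 9 * b) = 1 + intVal 2 (u + 4 * b) := by
      rw [show 2 * u - b + 9 * b = 2 * (u + 4 * b) by ring, two_mul_intVal]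
    have hu2 : (intVal 2 u = 0 ∧ intVal 2 (u + 4 * b) = 0) ∨
        (intVal 2 u = 1 ∧ intVal 2 (u + 4 * b) = 1) := by
      by_cases hue : u % 2 = 0
      · obtain ⟨w, rfl⟩ := Int.dvd_of_emod_eq_zero hue
        right
        rw [show 2 * w + 4 * b = 2 * (w + 2 * b) by ring, two_mul_intVal, two_mul_intVal,
          intVal_two_eq_zero (x := w) (by omega), intVal_two_eq_zero (x := w + 2 * b) (by omega)]
        simp
      · exact .inl ⟨intVal_two_eq_zero hue, intVal_two_eq_zero (by omega)⟩
    refine tableCorrect_of_dvd_of_not_pow_dvd hE ?_ ?_ fun ℓ hn ↦ ?_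
    · rw [C6_c₄]
      exact Dvd.dvd.mul_right ⟨u + b, by push_cast; ring⟩ _
    · rw [C6_Δ, intVal_mul, intVal_mul, intVal_mul, intVal_pow, intVal_pow, intVal_pow, ha', hb',
        e1, e9]
      rcases hu2 with ⟨h, h'⟩ | ⟨h, h'⟩ <;> rw [h, h'] <;> norm_num
    · cases ℓ <;> rcases hu2 with ⟨h, h'⟩ | ⟨h, h'⟩ <;>
        simp only [MultRedTable, ha', hb', e1, h] <;> simp [hn.ne'] <;> norm_num

lemma tableCorrect_C6 (hab : IsCoprime a b) (hE : (OddTorsionFamily.C6.curve a b).IsElliptic) :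
    TableCorrect .C6 p a b n := by
  have hne := cast_ne_zero_of_isCoprime (p := p) hab
  by_cases hb : (b : ZMod p) = 0
  · exact tableCorrect_C6_of_dvd_right hE (fun ha ↦ hne ⟨ha, hb⟩) hb
  by_cases ha : (a : ZMod p) = 0
  · exact tableCorrect_C6_of_dvd_left hE ha hb
  by_cases h1 : (a + b : ZMod p) = 0
  · rcases eq_or_ne p 2 with rfl | h2
    · rw [cast_zmod_eq_zero_iff] at ha hb
      push_cast at ha hb
      exact tableCorrect_C6_two hE (by omega) (by omega)
    · exact tableCorrect_C6_of_dvd_add hE h2 ha hb h1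
  by_cases h9 : (a + 9 * b : ZMod p) = 0
  · exact tableCorrect_C6_of_dvd_add_nine hE ha hb h1 h9
  have ha' := intVal_eq_zero_of_ne ha
  have hb' := intVal_eq_zero_of_ne hb
  have h1' : intVal p (a + b) = 0 := intVal_eq_zero_of_ne (by push_cast; exact h1)
  have h9' : intVal p (a + 9 * b) = 0 := intVal_eq_zero_of_ne (by push_cast; exact h9)
  refine tableCorrect_of_intVal_Δ_eq_zero hE ?_ fun ℓ hn ↦ ?_
  · simp [C6_Δ, intVal_mul, intVal_pow, ha', hb', h1', h9']
  · rcases eq_or_ne p 2 with rfl | h2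
    · simp [MultRedTable, ha', hb', h1', hn.ne']
    · simp [MultRedTable, ha', hb', h1', h9', hn.ne', h2]

end C6

/-! ### The family `C₇`. -/

section C7

variable {p : ℕ} [Fact p.Prime] {a b : ℤ} {n : ℕ}

lemma C7_Δ (a b : ℤ) : (originCurve (OddTorsionFamily.C7.coeffA₁ a b)
    (OddTorsionFamily.C7.coeffA₂ a b) (OddTorsionFamily.C7.coeffA₃ a b)).Δ =
    -((a * b * (a - b)) ^ 7 * (a ^ 3 + 5 * a ^ 2 * b - 8 * a * b ^ 2 + b ^ 3)) := by
  simp only [originCurve_Δ, OddTorsionFamily.coeffA₁, OddTorsionFamily.coeffA₂,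
    OddTorsionFamily.coeffA₃]
  ring

/-- The cubic is irreducible of discriminant `7⁴`, so it defines the cyclic cubic field of conductor
7. Apart from 7, only primes `≡ ±1` modulo 7 give it a zero, the first being 13; the smaller primes
are settled by enumeration. -/
lemma C7_ne_zero_mod_two : ∀ x y : ZMod 2, y ≠ 0 →
    x ^ 3 + 5 * x ^ 2 * y - 8 * x * y ^ 2 + y ^ 3 ≠ 0 := by
  decide

lemma C7_ne_zero_mod_three : ∀ x y : ZMod 3, y ≠ 0 →
    x ^ 3 + 5 * x ^ 2 * y - 8 * x * y ^ 2 + y ^ 3 ≠ 0 := by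
  decide

lemma C7_ne_zero_mod_five : ∀ x y : ZMod 5, y ≠ 0 →
    x ^ 3 + 5 * x ^ 2 * y - 8 * x * y ^ 2 + y ^ 3 ≠ 0 := by
  decide

/-- Modulo 7 the cubic is `(x - 3y)³`. -/
lemma C7_eq_mod_seven : ∀ x y : ZMod 7,
    x ^ 3 + 5 * x ^ 2 * y - 8 * x * y ^ 2 + y ^ 3 = 0 → x = 3 * y := by
  decide

lemma C7_ne_zero_mod_eleven : ∀ x y : ZMod 11, y ≠ 0 →
    x ^ 3 + 5 * x ^ 2 * y - 8 * x * y ^ 2 + y ^ 3 ≠ 0 := by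
  decide

/-- For `a = 3b + 7u` the cubic is 49 times a number congruent to `b³` modulo 7. -/
lemma C7_not_dvd {a b : ℤ} (hb : b % 7 ≠ 0) (h : (7 : ℤ) ∣ a - 3 * b) :
    ¬ (7 : ℤ) ^ 3 ∣ a ^ 3 + 5 * a ^ 2 * b - 8 * a * b ^ 2 + b ^ 3 := by
  have h7 : Prime (7 : ℤ) := by norm_num
  obtain ⟨u, hu⟩ := h
  obtain rfl : a = 3 * b + 7 * u := by omega
  rintro ⟨k, hk⟩
  have h1 : b ^ 3 = 7 * (k - b ^ 2 * u - 2 * u ^ 2 * b - u ^ 3) := by linarith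
  obtain ⟨v, hv⟩ := h7.dvd_of_dvd_pow (Dvd.intro _ h1.symm)
  omega

lemma tableCorrect_C7_of_dvd_mul (hab : IsCoprime a b)
    (hE : (OddTorsionFamily.C7.curve a b).IsElliptic)
    (h : (a : ZMod p) * b * (a - b) = 0) : TableCorrect .C7 p a b n := by
  have hco := cast_ne_zero_of_isCoprime (p := p) hab
  have h' : (a : ZMod p) = 0 ∨ (b : ZMod p) = 0 ∨ (a : ZMod p) = b := by
    rcases mul_eq_zero.1 h with h | h
    · exact (mul_eq_zero.1 h).imp id .inl
    · exact .inr (.inr (sub_eq_zero.1 h))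
  have hf' : intVal p (a ^ 3 + 5 * a ^ 2 * b - 8 * a * b ^ 2 + b ^ 3) = 0 := by
    refine intVal_eq_zero_of_ne fun hf ↦ hco ?_
    push_cast at hf
    rcases h' with h | h | h
    · simpa [h] using hf
    · simpa [h] using hf
    · have : (b : ZMod p) ^ 3 = 0 := by
        rw [h] at hf
        linear_combination -hf
      simpa [h] using this
  refine tableCorrect_of_split 1 _ _ _ one_ne_zero (by ring) (by ring) (by ring) hE ?_ ?_ ?_
    (fun hn ↦ ?_) (fun hn ↦ ?_)
  · intro h1
    push_cast [OddTorsionFamily.coeffA₁] at h1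
    refine hco ?_
    rcases h' with h | h | h
    · simpa [h] using h1
    · simpa [h] using h1
    · simpa [h, sq] using h1
  · push_cast [OddTorsionFamily.coeffA₂]
    linear_combination (b : ZMod p) * h
  · push_cast [OddTorsionFamily.coeffA₃]
    linear_combination (a ^ 2 * b : ZMod p) * h
  · simp only [MultRedTable, C7_Δ, intVal_neg, intVal_mul, intVal_pow, hf']
    simp [hn.ne']
  · simp [MultRedTable, hf', hn.ne']

lemma tableCorrect_C7_of_dvd (hE : (OddTorsionFamily.C7.curve a b).IsElliptic)
    (hP : (a : ZMod p) * b * (a - b) ≠ 0)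
    (hf : (a : ZMod p) ^ 3 + 5 * a ^ 2 * b - 8 * a * b ^ 2 + b ^ 3 = 0) :
    TableCorrect .C7 p a b n := by
  have hb : (b : ZMod p) ≠ 0 := right_ne_zero_of_mul (left_ne_zero_of_mul hP)
  have hP' : intVal p (a * b * (a - b)) = 0 := intVal_eq_zero_of_ne (by push_cast; exact hP)
  have hv : intVal p (originCurve (OddTorsionFamily.C7.coeffA₁ a b)
      (OddTorsionFamily.C7.coeffA₂ a b) (OddTorsionFamily.C7.coeffA₃ a b)).Δ =
      intVal p (a ^ 3 + 5 * a ^ 2 * b - 8 * a * b ^ 2 + b ^ 3) := by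
    rw [C7_Δ, intVal_neg, intVal_mul, intVal_pow, hP', mul_zero, zero_add]
  by_cases h13 : 13 ≤ p
  · have h7 := seven_cast_ne_zero (p := p) (by omega)
    have hD : ((-7 * (a ^ 2 - a * b + b ^ 2) : ℤ) : ZMod p) =
        -7 * a ^ 2 + 7 * a * b - 7 * b ^ 2 := by
      push_cast
      ring
    -- The double root is `X / 7`, with `X` reduced modulo the cubic to degree two in `a`. The
    -- witness `y` is the derivative of the cubic in `a`; with `s = 7b` both sides of the
    -- square-class identity are homogeneous of degree six.
    refine tableCorrect_of_double_root
      (X := -19 * a ^ 2 * b ^ 2 + 23 * a * b ^ 3 - 3 * b ^ 4) (r := 7) (s := 7 * b)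
      (y := 3 * a ^ 2 + 10 * a * b - 8 * b ^ 2) (-7 * a ^ 2 + 7 * a * b - 7 * b ^ 2) (by omega) hE
      (by push_cast [OddTorsionFamily.coeffA₁]; rfl) (by push_cast [OddTorsionFamily.coeffA₂]; rfl)
      (by push_cast [OddTorsionFamily.coeffA₃]; rfl) h7 (mul_ne_zero h7 hb) ?_ ?_ ?_ ?_
      (fun hn hD0 ↦ ?_) (fun hn _ ↦ ?_)
    · linear_combination (-84 * a ^ 3 * b ^ 2 + 315 * a ^ 2 * b ^ 3 - 277 * a * b ^ 4 +
        33 * b ^ 5 : ZMod p) * hf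
    · linear_combination (1008 * a ^ 5 * b ^ 4 - 4536 * a ^ 4 * b ^ 5 + 6927 * a ^ 3 * b ^ 6 -
        4145 * a ^ 2 * b ^ 7 + 780 * a * b ^ 8 - 45 * b ^ 9 : ZMod p) * hf
    · have : (7 : ZMod p) ^ 2 * b ^ 6 ≠ 0 := mul_ne_zero (pow_ne_zero _ h7) (pow_ne_zero _ hb)
      contrapose! this
      linear_combination (5 * a ^ 2 + 21 * a * b - 66 * b ^ 2 : ZMod p) * this -
        (35 * a ^ 3 + 42 * a ^ 2 * b - 1133 * a * b ^ 2 + 1865 * b ^ 3) * hf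
    · linear_combination
        (63 * a ^ 3 + 42 * a ^ 2 * b + 2702 * a * b ^ 2 - 9499 * b ^ 3 : ZMod p) * hf
    · rw [hv, ← legendreSym_eq_one_iff hD hD0]
      simp [MultRedTable, hP', hn.ne', h13]
    · rw [hv, ← legendreSym_eq_neg_one_iff hD]
      simp [MultRedTable, h13]
  have ht (ℓ) (hn : 0 < n) : ¬ MultRedTable .C7 p a b n ℓ := by
    cases ℓ <;> simp [MultRedTable, hP', hn.ne', h13]
  have hp : p.Prime := Fact.out
  have h12 : p ≤ 12 := by omega
  interval_cases p
  any_goals (revert hp; norm_num; done)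
  · exact (C7_ne_zero_mod_two _ _ hb hf).elim
  · exact (C7_ne_zero_mod_three _ _ hb hf).elim
  · exact (C7_ne_zero_mod_five _ _ hb hf).elim
  · have hA : (a : ZMod 7) = 3 * b := C7_eq_mod_seven _ _ hf
    refine tableCorrect_of_dvd_of_not_pow_dvd hE ?_ ?_ ht
    · rw [← ZMod.intCast_zmod_eq_zero_iff_dvd, originCurve_c₄]
      push_cast [OddTorsionFamily.coeffA₁, OddTorsionFamily.coeffA₂, OddTorsionFamily.coeffA₃]
      rw [hA]
      ring_nf
      reduce_mod_char
    · rw [hv]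
      refine lt_of_lt_of_le (emultiplicity_lt_iff_not_dvd.2 (C7_not_dvd (a := a) (b := b) ?_ ?_))
        (by norm_num)
      · rwa [Ne, cast_zmod_eq_zero_iff] at hb
      · rw [← sub_eq_zero] at hA
        exact (ZMod.intCast_zmod_eq_zero_iff_dvd _ 7).1 (by push_cast; exact hA)
  · exact (C7_ne_zero_mod_eleven _ _ hb hf).elim

theorem tableCorrect_C7 (hab : IsCoprime a b) (hE : (OddTorsionFamily.C7.curve a b).IsElliptic) :
    TableCorrect .C7 p a b n := by
  by_cases hP : (a : ZMod p) * b * (a - b) = 0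
  · exact tableCorrect_C7_of_dvd_mul hab hE hP
  by_cases hf : (a : ZMod p) ^ 3 + 5 * a ^ 2 * b - 8 * a * b ^ 2 + b ^ 3 = 0
  · exact tableCorrect_C7_of_dvd hE hP hf
  have hP' : intVal p (a * b * (a - b)) = 0 := intVal_eq_zero_of_ne (by push_cast; exact hP)
  have hf' : intVal p (a ^ 3 + 5 * a ^ 2 * b - 8 * a * b ^ 2 + b ^ 3) = 0 :=
    intVal_eq_zero_of_ne (by push_cast; exact hf)
  refine tableCorrect_of_intVal_Δ_eq_zero hE ?_ (fun ℓ hn ↦ ?_)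
  · rw [C7_Δ, intVal_neg, intVal_mul, intVal_pow, hP', hf', mul_zero, zero_add]
  · cases ℓ <;> simp [MultRedTable, hP', hf', hn.ne']

end C7

/-! ### The family `C₉`. -/

section C9

variable {p : ℕ} [Fact p.Prime] {a b : ℤ} {n : ℕ}

lemma C9_Δ (a b : ℤ) : (originCurve (OddTorsionFamily.C9.coeffA₁ a b)
    (OddTorsionFamily.C9.coeffA₂ a b) (OddTorsionFamily.C9.coeffA₃ a b)).Δ =
    -((a * b * (a - b)) ^ 9 * ((a ^ 2 - a * b + b ^ 2) ^ 3 *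
      (a ^ 3 + 3 * a ^ 2 * b - 6 * a * b ^ 2 + b ^ 3))) := by
  simp only [originCurve_Δ, OddTorsionFamily.coeffA₁, OddTorsionFamily.coeffA₂,
    OddTorsionFamily.coeffA₃]
  ring

lemma C9_ne_zero_mod_two : ∀ x y : ZMod 2, y ≠ 0 →
    (x ^ 2 - x * y + y ^ 2) * (x ^ 3 + 3 * x ^ 2 * y - 6 * x * y ^ 2 + y ^ 3) ≠ 0 := by
  decide

/-- Modulo 3 the two factors are `(x + y)²` and `(x + y)³`. -/
lemma C9_eq_mod_three : ∀ x y : ZMod 3,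
    (x ^ 2 - x * y + y ^ 2) * (x ^ 3 + 3 * x ^ 2 * y - 6 * x * y ^ 2 + y ^ 3) = 0 → x = -y := by
  decide

lemma C9_ne_zero_mod_five : ∀ x y : ZMod 5, y ≠ 0 →
    (x ^ 2 - x * y + y ^ 2) * (x ^ 3 + 3 * x ^ 2 * y - 6 * x * y ^ 2 + y ^ 3) ≠ 0 := by
  decide

/-- For `a = 3u - b` the forms are `3 (b² + 3(…))` and `9 (b³ + 3(…))`, so the discriminant has
small valuation at 3. -/
lemma C9_not_dvd {a b : ℤ} (hb : b % 3 ≠ 0) (h : (3 : ℤ) ∣ a + b) :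
    ¬ (3 : ℤ) ^ 2 ∣ a ^ 2 - a * b + b ^ 2 ∧
      ¬ (3 : ℤ) ^ 3 ∣ a ^ 3 + 3 * a ^ 2 * b - 6 * a * b ^ 2 + b ^ 3 := by
  have h3 : Prime (3 : ℤ) := Int.prime_three
  obtain ⟨u, hu⟩ := h
  obtain rfl : a = 3 * u - b := by omega
  constructor
  · rintro ⟨k, hk⟩
    have h1 : b ^ 2 = 3 * (k - u ^ 2 + u * b) := by linarith
    obtain ⟨v, hv⟩ := h3.dvd_of_dvd_pow (Dvd.intro _ h1.symm)
    omega
  · rintro ⟨k, hk⟩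
    have h1 : b ^ 3 = 3 * (k - u ^ 3 + u * b ^ 2) := by linarith
    obtain ⟨v, hv⟩ := h3.dvd_of_dvd_pow (Dvd.intro _ h1.symm)
    omega

lemma tableCorrect_C9_of_dvd_mul (hab : IsCoprime a b)
    (hE : (OddTorsionFamily.C9.curve a b).IsElliptic)
    (h : (a : ZMod p) * b * (a - b) = 0) : TableCorrect .C9 p a b n := by
  have hco := cast_ne_zero_of_isCoprime (p := p) hab
  have h' : (a : ZMod p) = 0 ∨ (b : ZMod p) = 0 ∨ (a : ZMod p) = b := by
    rcases mul_eq_zero.1 h with h | h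
    · exact (mul_eq_zero.1 h).imp id .inl
    · exact .inr (.inr (sub_eq_zero.1 h))
  have hq' : intVal p (a ^ 2 - a * b + b ^ 2) = 0 := by
    refine intVal_eq_zero_of_ne fun hf ↦ hco ?_
    push_cast at hf
    rcases h' with h | h | h
    · simpa [h] using hf
    · simpa [h] using hf
    · simpa [h, sq] using hf
  have hf' : intVal p (a ^ 3 + 3 * a ^ 2 * b - 6 * a * b ^ 2 + b ^ 3) = 0 := by
    refine intVal_eq_zero_of_ne fun hf ↦ hco ?_
    push_cast at hf
    rcases h' with h | h | h
    · simpa [h] using hf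
    · simpa [h] using hf
    · have : (b : ZMod p) ^ 3 = 0 := by
        rw [h] at hf
        linear_combination -hf
      simpa [h] using this
  refine tableCorrect_of_split 1 _ _ _ one_ne_zero (by ring) (by ring) (by ring) hE ?_ ?_ ?_
    (fun hn ↦ ?_) (fun hn ↦ ?_)
  · intro h1
    push_cast [OddTorsionFamily.coeffA₁] at h1
    refine hco ?_
    rcases h' with h | h | h
    · simpa [h] using h1
    · simpa [h] using h1
    · rw [h] at h1 ⊢
      have : (b : ZMod p) ^ 3 = 0 := by linear_combination h1
      simpa using this
  · push_cast [OddTorsionFamily.coeffA₂]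
    linear_combination (b * (a ^ 2 - a * b + b ^ 2) : ZMod p) * h
  · push_cast [OddTorsionFamily.coeffA₃, OddTorsionFamily.coeffA₂]
    linear_combination (a ^ 3 * b * (a ^ 2 - a * b + b ^ 2) : ZMod p) * h
  · simp only [MultRedTable, C9_Δ, intVal_neg, intVal_mul, intVal_pow, hf', hq']
    simp [hn.ne']
  · simp [MultRedTable, hf', hq', hn.ne']

/-- The quadratic divides `a₂` and `a₃`, so the node is the origin and is split. The table agrees,
since `-3 = ((2a - b)/b)²` forces `p ≡ 1` modulo 6. -/
lemma tableCorrect_C9_of_dvd_quadratic (hE : (OddTorsionFamily.C9.curve a b).IsElliptic)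
    (h7 : 7 ≤ p) (hP : (a : ZMod p) * b * (a - b) ≠ 0)
    (hq : (a : ZMod p) ^ 2 - a * b + b ^ 2 = 0) : TableCorrect .C9 p a b n := by
  have hb : (b : ZMod p) ≠ 0 := right_ne_zero_of_mul (left_ne_zero_of_mul hP)
  have hP' : intVal p (a * b * (a - b)) = 0 := intVal_eq_zero_of_ne (by push_cast; exact hP)
  have h3 := three_cast_ne_zero (p := p) (by omega)
  have hf' : intVal p (a ^ 3 + 3 * a ^ 2 * b - 6 * a * b ^ 2 + b ^ 3) = 0 := by
    refine intVal_eq_zero_of_ne fun hf ↦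
      mul_ne_zero (pow_ne_zero 2 h3) (pow_ne_zero 4 hb) ?_
    push_cast at hf
    linear_combination ((a + 4 * b) * (2 * b - a) + 3 * b ^ 2 : ZMod p) * hq -
      (2 * b - a : ZMod p) * hf
  have h1 : p ≡ 1 [MOD 6] := by
    rw [← isSquare_neg_three_iff (by omega)]
    refine ⟨(2 * a - b) / b, ?_⟩
    field_simp
    linear_combination (-4 : ZMod p) * hq
  have h5 : ¬ p ≡ 5 [MOD 6] := fun h ↦ (modEq_five_iff (by omega)).1 h h1
  refine tableCorrect_of_split 1 _ _ _ one_ne_zero (by ring) (by ring) (by ring) hE ?_ ?_ ?_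
    (fun hn ↦ ?_) (fun hn ↦ ?_)
  · have : (3 : ZMod p) * b ^ 4 ≠ 0 := mul_ne_zero h3 (pow_ne_zero _ hb)
    contrapose! this
    push_cast [OddTorsionFamily.coeffA₁] at this
    linear_combination ((a + b) ^ 2 + b ^ 2 : ZMod p) * hq - (a + b : ZMod p) * this
  · push_cast [OddTorsionFamily.coeffA₂]
    linear_combination (a * b ^ 2 * (a - b) : ZMod p) * hq
  · push_cast [OddTorsionFamily.coeffA₃, OddTorsionFamily.coeffA₂]
    linear_combination (a ^ 4 * b ^ 2 * (a - b) : ZMod p) * hq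
  · rw [C9_Δ, intVal_neg, intVal_mul, intVal_pow, hP', intVal_mul, hf', intVal_pow]
    simp [MultRedTable, hP', hf', hn.ne', h7, h1]
  · simp [MultRedTable, h5]

lemma tableCorrect_C9_of_dvd_cubic (hE : (OddTorsionFamily.C9.curve a b).IsElliptic)
    (h7 : 7 ≤ p) (hP : (a : ZMod p) * b * (a - b) ≠ 0)
    (hq : (a : ZMod p) ^ 2 - a * b + b ^ 2 ≠ 0)
    (hf : (a : ZMod p) ^ 3 + 3 * a ^ 2 * b - 6 * a * b ^ 2 + b ^ 3 = 0) :
    TableCorrect .C9 p a b n := by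
  have hb : (b : ZMod p) ≠ 0 := right_ne_zero_of_mul (left_ne_zero_of_mul hP)
  have hP' : intVal p (a * b * (a - b)) = 0 := intVal_eq_zero_of_ne (by push_cast; exact hP)
  have hq' : intVal p (a ^ 2 - a * b + b ^ 2) = 0 := intVal_eq_zero_of_ne (by push_cast; exact hq)
  have h3 := three_cast_ne_zero (p := p) (by omega)
  have hv : intVal p (originCurve (OddTorsionFamily.C9.coeffA₁ a b)
      (OddTorsionFamily.C9.coeffA₂ a b) (OddTorsionFamily.C9.coeffA₃ a b)).Δ =
      intVal p (a ^ 3 + 3 * a ^ 2 * b - 6 * a * b ^ 2 + b ^ 3) := by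
    rw [C9_Δ, intVal_neg, intVal_mul, intVal_pow, hP', intVal_mul, intVal_pow, hq']
    simp
  -- Modulo the cubic, `β` is `-3 (ab(a - b))²`.
  refine tableCorrect_of_double_root
    (X := -40 * a ^ 2 * b ^ 4 + 56 * a * b ^ 5 - 9 * b ^ 6) (r := 1) (s := 1)
    (y := a ^ 2 * b - a * b ^ 2) (-3) (by omega) hE
    (by push_cast [OddTorsionFamily.coeffA₁]; rfl) (by push_cast [OddTorsionFamily.coeffA₂]; rfl)
    (by push_cast [OddTorsionFamily.coeffA₃, OddTorsionFamily.coeffA₂]; rfl)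
    one_ne_zero one_ne_zero ?_ ?_ ?_ ?_ (fun hn hD0 ↦ ?_) (fun hn _ ↦ ?_)
  · linear_combination (a ^ 7 * b ^ 2 - 5 * a ^ 6 * b ^ 3 - 16 * a ^ 5 * b ^ 4 +
      69 * a ^ 4 * b ^ 5 - 543 * a ^ 3 * b ^ 6 + 2792 * a ^ 2 * b ^ 7 - 3076 * a * b ^ 8 +
      477 * b ^ 9 : ZMod p) * hf
  · linear_combination (a ^ 11 * b ^ 4 - 7 * a ^ 10 * b ^ 5 - 45 * a ^ 9 * b ^ 6 +
      354 * a ^ 8 * b ^ 7 - 199 * a ^ 7 * b ^ 8 - 1026 * a ^ 6 * b ^ 9 + 14165 * a ^ 5 * b ^ 10 -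
      91580 * a ^ 4 * b ^ 11 + 186685 * a ^ 3 * b ^ 12 - 142862 * a ^ 2 * b ^ 13 +
      35928 * a * b ^ 14 - 2835 * b ^ 15 : ZMod p) * hf
  · have : (3 : ZMod p) * b ^ 8 ≠ 0 := mul_ne_zero h3 (pow_ne_zero _ hb)
    contrapose! this
    linear_combination (7 * a ^ 2 + 20 * a * b - 48 * b ^ 2 : ZMod p) * this -
      (7 * a ^ 5 - a ^ 4 * b + 39 * a ^ 3 * b ^ 2 - 80 * a ^ 2 * b ^ 3 - 3310 * a * b ^ 4 +
        5133 * b ^ 5) * hf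
  · linear_combination (a ^ 3 - 3 * a ^ 2 * b + 24 * a * b ^ 2 - 107 * b ^ 3 : ZMod p) * hf
  · rw [hv, isSquare_neg_three_iff (by omega)]
    simp [MultRedTable, hP', hq', hn.ne', h7]
  · rw [hv, isSquare_neg_three_iff (by omega), ← modEq_five_iff (by omega)]
    simp [MultRedTable, hq', h7]

theorem tableCorrect_C9 (hab : IsCoprime a b) (hE : (OddTorsionFamily.C9.curve a b).IsElliptic) :
    TableCorrect .C9 p a b n := by
  by_cases hP : (a : ZMod p) * b * (a - b) = 0
  · exact tableCorrect_C9_of_dvd_mul hab hE hP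
  have hb : (b : ZMod p) ≠ 0 := right_ne_zero_of_mul (left_ne_zero_of_mul hP)
  have hP' : intVal p (a * b * (a - b)) = 0 := intVal_eq_zero_of_ne (by push_cast; exact hP)
  by_cases hqf : ((a : ZMod p) ^ 2 - a * b + b ^ 2) *
      (a ^ 3 + 3 * a ^ 2 * b - 6 * a * b ^ 2 + b ^ 3) = 0
  · rcases eq_two_or_eq_three_or_eq_five_or_seven_le p with rfl | rfl | rfl | h7
    · exact (C9_ne_zero_mod_two _ _ hb hqf).elim
    · have hA : (a : ZMod 3) = -b := C9_eq_mod_three _ _ hqf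
      refine tableCorrect_of_dvd_of_not_pow_dvd hE ?_ ?_ fun ℓ hn ↦ ?_
      · rw [← ZMod.intCast_zmod_eq_zero_iff_dvd, originCurve_c₄]
        push_cast [OddTorsionFamily.coeffA₁, OddTorsionFamily.coeffA₂, OddTorsionFamily.coeffA₃]
        rw [hA]
        ring_nf
        reduce_mod_char
      · have hΔ0 := OddTorsionFamily.Δ_ne_zero hE
        rw [C9_Δ] at hΔ0 ⊢
        obtain ⟨-, h2⟩ := mul_ne_zero_iff.1 (neg_ne_zero.1 hΔ0)
        obtain ⟨h3, h4⟩ := mul_ne_zero_iff.1 h2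
        obtain ⟨m, hm⟩ := intVal_eq_coe (p := 3) (pow_ne_zero_iff (by norm_num)|>.1 h3)
        obtain ⟨k, hk⟩ := intVal_eq_coe (p := 3) h4
        have hd := C9_not_dvd (a := a) (b := b) (by rwa [Ne, cast_zmod_eq_zero_iff] at hb) (by
          rw [eq_neg_iff_add_eq_zero] at hA
          exact (ZMod.intCast_zmod_eq_zero_iff_dvd _ 3).1 (by push_cast; exact hA))
        have h5 := emultiplicity_lt_iff_not_dvd.2 hd.1
        have h6 := emultiplicity_lt_iff_not_dvd.2 hd.2
        change intVal 3 _ < _ at h5 h6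
        rw [hm] at h5
        rw [hk] at h6
        rw [intVal_neg, intVal_mul, intVal_pow, hP', intVal_mul, intVal_pow, hm, hk]
        norm_cast at h5 h6 ⊢
        omega
      · cases ℓ <;> simp [MultRedTable, hP', hn.ne']
    · exact (C9_ne_zero_mod_five _ _ hb hqf).elim
    · by_cases hq : (a : ZMod p) ^ 2 - a * b + b ^ 2 = 0
      · exact tableCorrect_C9_of_dvd_quadratic hE h7 hP hq
      · exact tableCorrect_C9_of_dvd_cubic hE h7 hP hq ((mul_eq_zero.1 hqf).resolve_left hq)
  obtain ⟨hq, hf⟩ := mul_ne_zero_iff.1 hqf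
  have hq' : intVal p (a ^ 2 - a * b + b ^ 2) = 0 := intVal_eq_zero_of_ne (by push_cast; exact hq)
  have hf' : intVal p (a ^ 3 + 3 * a ^ 2 * b - 6 * a * b ^ 2 + b ^ 3) = 0 :=
    intVal_eq_zero_of_ne (by push_cast; exact hf)
  refine tableCorrect_of_intVal_Δ_eq_zero hE ?_ (fun ℓ hn ↦ ?_)
  · rw [C9_Δ, intVal_neg, intVal_mul, intVal_pow, hP', intVal_mul, intVal_pow, hq', hf']
    simp
  · cases ℓ <;> simp [MultRedTable, hP', hq', hf', hn.ne']

end C9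

/-! ### The family `C₁₀`. -/

section C10

variable {p : ℕ} [Fact p.Prime] {a b : ℤ} {n : ℕ}

lemma C10_Δ (a b : ℤ) : (originCurve (OddTorsionFamily.C10.coeffA₁ a b)
    (OddTorsionFamily.C10.coeffA₂ a b) (OddTorsionFamily.C10.coeffA₃ a b)).Δ =
    (a ^ 5 * b ^ 10 * (a - 2 * b) ^ 5 * (a - b) ^ 10) *
      (a ^ 2 + 2 * a * b - 4 * b ^ 2) * (a ^ 2 - 3 * a * b + b ^ 2) ^ 2 := by
  simp only [originCurve_Δ, OddTorsionFamily.coeffA₁, OddTorsionFamily.coeffA₂,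
    OddTorsionFamily.coeffA₃]
  ring

lemma C10_mul_eq_zero_mod_two : ∀ x y : ZMod 2, x * y * (x - y) * (x - 2 * y) = 0 := by
  decide

lemma C10_ne_zero_mod_three : ∀ x y : ZMod 3, y ≠ 0 →
    x ^ 2 + 2 * x * y - 4 * y ^ 2 ≠ 0 ∧ x ^ 2 - 3 * x * y + y ^ 2 ≠ 0 := by
  decide

/-- Both quadratics are `(x + y)²` modulo 5. -/
lemma C10_eq_mod_five : ∀ x y : ZMod 5,
    x ^ 2 + 2 * x * y - 4 * y ^ 2 = 0 ∨ x ^ 2 - 3 * x * y + y ^ 2 = 0 → x = -y := by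
  decide

lemma tableCorrect_C10_of_dvd_mul (hab : IsCoprime a b)
    (hE : (OddTorsionFamily.C10.curve a b).IsElliptic) (h2 : p = 2 → (a : ZMod p) ≠ 0)
    (h : (a : ZMod p) * b * (a - b) * (a - 2 * b) = 0) :
    TableCorrect .C10 p a b n := by
  have hco := cast_ne_zero_of_isCoprime (p := p) hab
  have h2' : (a : ZMod p) = 0 ∨ (a : ZMod p) - 2 * b = 0 → (2 : ZMod p) ≠ 0 := by
    intro h0
    refine two_cast_ne_zero ?_
    rintro rfl
    refine h2 rfl (h0.elim id fun h0 ↦ ?_)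
    rw [← h0]
    ring_nf
    reduce_mod_char
  -- On each line where `a₂` vanishes, `a₁` and both quadratics become powers of `a` or `b` up to
  -- sign and powers of 2; the latter occur only for `a ≡ 0` and `a ≡ 2b`.
  have hP : (OddTorsionFamily.C10.coeffA₁ a b : ZMod p) ≠ 0 ∧
      (a : ZMod p) ^ 2 + 2 * a * b - 4 * b ^ 2 ≠ 0 ∧ (a : ZMod p) ^ 2 - 3 * a * b + b ^ 2 ≠ 0 := by
    push_cast [OddTorsionFamily.coeffA₁]
    rcases mul_eq_zero.1 h with h | h
    · rcases mul_eq_zero.1 h with h | h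
      · rcases mul_eq_zero.1 h with h | h
        · have hb : (b : ZMod p) ≠ 0 := fun hb ↦ hco ⟨h, hb⟩
          have := h2' (.inl h)
          rw [h, show (4 : ZMod p) = 2 ^ 2 by norm_num]
          simp [hb, this]
        · have ha : (a : ZMod p) ≠ 0 := fun ha ↦ hco ⟨ha, h⟩
          rw [h]
          simp [ha]
      · have hA := sub_eq_zero.1 h
        have hb : (b : ZMod p) ≠ 0 := fun hb ↦ hco ⟨hA.trans hb, hb⟩
        rw [hA]
        refine ⟨?_, ?_, ?_⟩
        · rw [show (b ^ 3 - 2 * b ^ 2 * b - 2 * b * b ^ 2 + 2 * b ^ 3 : ZMod p) = -b ^ 3 by ring]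
          exact neg_ne_zero.2 (pow_ne_zero _ hb)
        · rw [show (b ^ 2 + 2 * b * b - 4 * b ^ 2 : ZMod p) = -b ^ 2 by ring]
          exact neg_ne_zero.2 (pow_ne_zero _ hb)
        · rw [show (b ^ 2 - 3 * b * b + b ^ 2 : ZMod p) = -b ^ 2 by ring]
          exact neg_ne_zero.2 (pow_ne_zero _ hb)
    · have hA := sub_eq_zero.1 h
      have hb : (b : ZMod p) ≠ 0 := fun hb ↦ hco ⟨by rw [hA, hb, mul_zero], hb⟩
      have := h2' (.inr h)
      rw [hA]
      refine ⟨?_, ?_, ?_⟩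
      · rw [show ((2 * b) ^ 3 - 2 * (2 * b) ^ 2 * b - 2 * (2 * b) * b ^ 2 + 2 * b ^ 3 : ZMod p) =
          -(2 * b ^ 3) by ring]
        exact neg_ne_zero.2 (mul_ne_zero this (pow_ne_zero _ hb))
      · rw [show ((2 * b) ^ 2 + 2 * (2 * b) * b - 4 * b ^ 2 : ZMod p) = (2 * b) ^ 2 by ring]
        exact pow_ne_zero _ (mul_ne_zero this hb)
      · rw [show ((2 * b) ^ 2 - 3 * (2 * b) * b + b ^ 2 : ZMod p) = -b ^ 2 by ring]
        exact neg_ne_zero.2 (pow_ne_zero _ hb)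
  obtain ⟨h1, hq, hr⟩ := hP
  have hq' : intVal p (a ^ 2 + 2 * a * b - 4 * b ^ 2) = 0 :=
    intVal_eq_zero_of_ne (by push_cast; exact hq)
  have hr' : intVal p (a ^ 2 - 3 * a * b + b ^ 2) = 0 :=
    intVal_eq_zero_of_ne (by push_cast; exact hr)
  have h2a : p = 2 → intVal 2 a = 0 := by
    rintro rfl
    exact intVal_eq_zero_of_ne (h2 rfl)
  have h2a' : p = 2 → ¬ 0 < intVal 2 a := fun h ↦ by simp [h2a h]
  have ha₂ : (OddTorsionFamily.C10.coeffA₂ a b : ZMod p) = 0 := by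
    push_cast [OddTorsionFamily.coeffA₂]
    linear_combination (-b ^ 2 : ZMod p) * h
  have hv : intVal p (originCurve (OddTorsionFamily.C10.coeffA₁ a b)
      (OddTorsionFamily.C10.coeffA₂ a b) (OddTorsionFamily.C10.coeffA₃ a b)).Δ =
      intVal p (a ^ 5 * b ^ 10 * (a - 2 * b) ^ 5 * (a - b) ^ 10) := by
    rw [C10_Δ, intVal_mul, intVal_mul, intVal_pow, hq', hr', mul_zero, add_zero, add_zero]
  refine tableCorrect_of_split 1 (OddTorsionFamily.C10.coeffA₁ a b)
    (OddTorsionFamily.C10.coeffA₂ a b) (OddTorsionFamily.C10.coeffA₃ a b) one_ne_zero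
    (one_mul _).symm (by rw [one_pow, one_mul]) (by rw [one_pow, one_mul]) hE h1 ha₂ ?_
    (fun hn ↦ ?_) (fun hn ↦ ?_)
  · rw [OddTorsionFamily.coeffA₃, Int.cast_mul, ha₂, mul_zero]
  · rw [hv]
    constructor
    · rintro (⟨-, h, -⟩ | ⟨-, h, -, h'⟩ | ⟨-, -, h, -⟩ | ⟨h, -⟩ | ⟨-, -, h, -⟩ | ⟨h, -⟩)
      · exact h
      · exact (h2a' h h').elim
      · simp [hq', hn.ne'] at h
      · simp at h
      · simp [hr', hn.ne'] at h
      · simp at h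
    · exact fun h ↦ .inl ⟨rfl, h, h2a⟩
  · simp [MultRedTable, hq', hr', hn.ne']

/-- For `a = 2A` the model scales by 2. The new `a₂` contains `A (A - b)`, even because `b` is odd,
so the node is split. The constant 12 of the row is `5 + 5` from `a⁵ (a - 2b)⁵` plus 2 from the
quadratic. -/
lemma tableCorrect_C10_two [Fact (Nat.Prime 2)] (hE : (OddTorsionFamily.C10.curve a b).IsElliptic)
    (ha : a % 2 = 0) (hb : b % 2 = 1) : TableCorrect .C10 2 a b n := by
  obtain ⟨A, rfl⟩ := Int.dvd_of_emod_eq_zero ha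
  have hb' := intVal_two_eq_zero (x := b) (by omega)
  have hb1 : (b : ZMod 2) = 1 := ZMod.eq_one_of_ne_zero_two _ (by
    rw [Ne, cast_zmod_eq_zero_iff]
    push_cast
    omega)
  have hd : 2 * A - 2 * b = 2 * (A - b) := by ring
  have h1' := intVal_two_eq_zero (x := 2 * A - b) (by omega)
  have hq0 : intVal 2 (A * A + A * b - b ^ 2) = 0 := by
    refine intVal_two_eq_zero ?_
    rcases Int.emod_two_eq_zero_or_one A with h | h <;>
      simp [pow_two, Int.sub_emod, Int.add_emod, Int.mul_emod, h, hb]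
  have hq : intVal 2 ((2 * A) ^ 2 + 2 * (2 * A) * b - 4 * b ^ 2) = 2 := by
    rw [show (2 * A) ^ 2 + 2 * (2 * A) * b - 4 * b ^ 2 = 2 * (2 * (A * A + A * b - b ^ 2)) by ring,
      two_mul_intVal, two_mul_intVal, hq0]
    norm_num
  have hr : intVal 2 (4 * A ^ 2 - 6 * A * b + b ^ 2) = 0 := by
    refine intVal_two_eq_zero ?_
    rw [show 4 * A ^ 2 - 6 * A * b + b ^ 2 = b * b + 2 * (2 * A ^ 2 - 3 * A * b) by ring]
    simp [Int.add_emod, Int.mul_emod, hb]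
  have hΔ0 := OddTorsionFamily.Δ_ne_zero hE
  rw [C10_Δ] at hΔ0
  have hA0 : A ≠ 0 := by
    rintro rfl
    simp at hΔ0
  have hAb0 : A - b ≠ 0 := by
    intro h
    rw [hd, h] at hΔ0
    simp at hΔ0
  obtain ⟨k, hk⟩ := intVal_eq_coe (p := 2) hA0
  obtain ⟨l, hl⟩ := intVal_eq_coe (p := 2) hAb0
  have hkl : intVal 2 ((2 * A) ^ 5 * (2 * A - 2 * b) ^ 5) = 5 * (1 + k) + 5 * (1 + l) := by
    rw [intVal_mul, intVal_pow, intVal_pow, hd, two_mul_intVal, two_mul_intVal, hk, hl]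
    rfl
  have h2A : intVal 2 (2 * A) = 1 + k := by rw [two_mul_intVal, hk]
  have hp2 : 0 < intVal 2 (2 * A) := by
    rw [h2A]
    norm_cast
    omega
  set a₂ := -(A * b ^ 3 * (2 * A - b) * (A - b)) with ha₂
  set a₃ := A * (4 * A ^ 2 - 6 * A * b + b ^ 2) * a₂ with ha₃
  have hv : intVal 2 (originCurve (4 * A ^ 3 - 4 * A ^ 2 * b - 2 * A * b ^ 2 + b ^ 3) a₂ a₃).Δ =
      5 * k + 5 * l := by
    rw [show (originCurve (4 * A ^ 3 - 4 * A ^ 2 * b - 2 * A * b ^ 2 + b ^ 3) a₂ a₃).Δ =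
      A ^ 5 * (A - b) ^ 5 * b ^ 10 * (2 * A - b) ^ 10 * (A * A + A * b - b ^ 2) *
        (4 * A ^ 2 - 6 * A * b + b ^ 2) ^ 2 by rw [originCurve_Δ]; ring,
      intVal_mul, intVal_mul, intVal_mul, intVal_mul, intVal_mul, intVal_pow, intVal_pow,
      intVal_pow, intVal_pow, intVal_pow, hk, hl, hb', h1', hq0, hr]
    simp
  have ha₂' : (a₂ : ZMod 2) = 0 := by
    rw [cast_zmod_eq_zero_iff, ha₂]
    rcases Int.emod_two_eq_zero_or_one A with h | h <;>
      simp [Int.neg_emod, Int.sub_emod, Int.mul_emod, h, hb]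
  refine tableCorrect_of_split 2 (4 * A ^ 3 - 4 * A ^ 2 * b - 2 * A * b ^ 2 + b ^ 3) a₂ a₃
    two_ne_zero ?_ ?_ ?_ hE ?_ ha₂' ?_ (fun hn ↦ ?_) (fun hn ↦ ?_)
  · simp only [OddTorsionFamily.coeffA₁]
    ring
  · simp only [OddTorsionFamily.coeffA₂, ha₂]
    ring
  · simp only [OddTorsionFamily.coeffA₂, OddTorsionFamily.coeffA₃, ha₃, ha₂]
    ring
  · push_cast
    rw [hb1]
    ring_nf
    reduce_mod_char
    exact one_ne_zero
  · rw [ha₃, Int.cast_mul, ha₂', mul_zero]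
  · rw [hv]
    constructor
    · rintro (⟨-, -, h⟩ | ⟨-, -, h, -⟩ | ⟨-, h, -⟩ | ⟨h, -⟩ | ⟨-, h, -⟩ | ⟨h, -⟩)
      · exact (hp2.ne' (h rfl)).elim
      · rw [hkl, hq] at h
        norm_cast at h ⊢
        omega
      · omega
      · simp at h
      · omega
      · simp at h
    · intro h
      refine .inr (.inl ⟨rfl, rfl, ?_, hp2⟩)
      rw [hkl, hq]
      norm_cast at h ⊢
      omega
  · simp [MultRedTable]

lemma tableCorrect_C10_of_dvd_fst (hE : (OddTorsionFamily.C10.curve a b).IsElliptic) (h7 : 7 ≤ p)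
    (hP : (a : ZMod p) * b * (a - b) * (a - 2 * b) ≠ 0)
    (hq : (a : ZMod p) ^ 2 + 2 * a * b - 4 * b ^ 2 = 0)
    (hP' : intVal p (a ^ 5 * b ^ 10 * (a - 2 * b) ^ 5 * (a - b) ^ 10) = 0) :
    TableCorrect .C10 p a b n := by
  obtain ⟨⟨⟨-, hb⟩, hd⟩, -⟩ := by simpa only [mul_ne_zero_iff] using hP
  -- The two quadratics differ by `5b(a - b)`, hence cannot vanish together here.
  have hr : (a : ZMod p) ^ 2 - 3 * a * b + b ^ 2 ≠ 0 := by
    rw [show (a : ZMod p) ^ 2 - 3 * a * b + b ^ 2 = -5 * (b * (a - b)) by linear_combination hq]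
    exact mul_ne_zero (neg_ne_zero.2 (five_cast_ne_zero (by omega))) (mul_ne_zero hb hd)
  have hr' : intVal p (a ^ 2 - 3 * a * b + b ^ 2) = 0 :=
    intVal_eq_zero_of_ne (by push_cast; exact hr)
  have hv : intVal p (originCurve (OddTorsionFamily.C10.coeffA₁ a b)
      (OddTorsionFamily.C10.coeffA₂ a b) (OddTorsionFamily.C10.coeffA₃ a b)).Δ =
      intVal p (a ^ 2 + 2 * a * b - 4 * b ^ 2) := by
    rw [C10_Δ, intVal_mul, intVal_mul, intVal_pow, hr', hP', mul_zero, zero_add, add_zero]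
  have hD : ((b ^ 2 - a ^ 2 : ℤ) : ZMod p) = b ^ 2 - a ^ 2 := by push_cast; rfl
  have h2 : p ≠ 2 := by omega
  refine tableCorrect_of_double_root (X := 58 * a * b ^ 5 - 72 * b ^ 6) (r := 1) (s := 1)
    (y := -2 * a * b + 2 * b ^ 2) (b ^ 2 - a ^ 2) h2 hE
    (by push_cast [OddTorsionFamily.coeffA₁]; rfl) (by push_cast [OddTorsionFamily.coeffA₂]; rfl)
    (by push_cast [OddTorsionFamily.coeffA₂, OddTorsionFamily.coeffA₃]; rfl)
    one_ne_zero one_ne_zero ?_ ?_ ?_ ?_ (fun hn hD0 ↦ ?_) (fun hn _ ↦ ?_)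
  · linear_combination (-a ^ 7 * b ^ 3 + 10 * a ^ 6 * b ^ 4 + 12 * a ^ 5 * b ^ 5 -
      269 * a ^ 4 * b ^ 6 + 890 * a ^ 3 * b ^ 7 - 2430 * a ^ 2 * b ^ 8 + 8330 * a * b ^ 9 -
      7704 * b ^ 10 : ZMod p) * hq
  · linear_combination (a ^ 10 * b ^ 6 - 14 * a ^ 9 * b ^ 7 - 24 * a ^ 8 * b ^ 8 +
      902 * a ^ 7 * b ^ 9 - 1984 * a ^ 6 * b ^ 10 - 9100 * a ^ 5 * b ^ 11 + 48105 * a ^ 4 * b ^ 12 -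
      133182 * a ^ 3 * b ^ 13 + 426908 * a ^ 2 * b ^ 14 - 688896 * a * b ^ 15 +
      368064 * b ^ 16 : ZMod p) * hq
  · have : (2 : ZMod p) ^ 2 * 5 * b ^ 7 ≠ 0 := mul_ne_zero (mul_ne_zero
      (pow_ne_zero _ (two_cast_ne_zero h2)) (five_cast_ne_zero (by omega))) (pow_ne_zero _ hb)
    contrapose! this
    linear_combination (-38 * a - 123 * b : ZMod p) * this - (-38 * a ^ 5 + 105 * a ^ 4 * b +
      130 * a ^ 3 * b ^ 2 - 144 * a ^ 2 * b ^ 3 - 480 * a * b ^ 4 - 26440 * b ^ 5) * hq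
  · linear_combination (a ^ 4 - 6 * a ^ 3 * b + 20 * a ^ 2 * b ^ 2 - 64 * a * b ^ 3 +
      216 * b ^ 4 : ZMod p) * hq
  · rw [hv, ← legendreSym_eq_one_iff hD hD0]
    simp only [MultRedTable, hr', hP']
    simp [hn.ne', h7, h2]
  · rw [hv, ← legendreSym_eq_neg_one_iff hD]
    simp only [MultRedTable, hr', hP']
    simp [hn.ne', h7]

lemma tableCorrect_C10_of_dvd_snd (hE : (OddTorsionFamily.C10.curve a b).IsElliptic) (h7 : 7 ≤ p)
    (hP : (a : ZMod p) * b * (a - b) * (a - 2 * b) ≠ 0)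
    (hr : (a : ZMod p) ^ 2 - 3 * a * b + b ^ 2 = 0)
    (hP' : intVal p (a ^ 5 * b ^ 10 * (a - 2 * b) ^ 5 * (a - b) ^ 10) = 0) :
    TableCorrect .C10 p a b n := by
  obtain ⟨⟨⟨-, hb⟩, hd⟩, -⟩ := by simpa only [mul_ne_zero_iff] using hP
  have hq : (a : ZMod p) ^ 2 + 2 * a * b - 4 * b ^ 2 ≠ 0 := by
    rw [show (a : ZMod p) ^ 2 + 2 * a * b - 4 * b ^ 2 = 5 * (b * (a - b)) by
      linear_combination hr]
    exact mul_ne_zero (five_cast_ne_zero (by omega)) (mul_ne_zero hb hd)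
  have hq' : intVal p (a ^ 2 + 2 * a * b - 4 * b ^ 2) = 0 :=
    intVal_eq_zero_of_ne (by push_cast; exact hq)
  have hv : intVal p (originCurve (OddTorsionFamily.C10.coeffA₁ a b)
      (OddTorsionFamily.C10.coeffA₂ a b) (OddTorsionFamily.C10.coeffA₃ a b)).Δ =
      2 * intVal p (a ^ 2 - 3 * a * b + b ^ 2) := by
    rw [C10_Δ, intVal_mul, intVal_mul, intVal_pow, hq', hP', zero_add, zero_add]
    rfl
  have hD : ((-(a * b + b ^ 2) : ℤ) : ZMod p) = -(a * b + b ^ 2) := by push_cast; rfl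
  have h2 : p ≠ 2 := by omega
  -- The quadratic divides `a₃`, so the node is the origin, and `β = a₁² + 4a₂` is `-(ab + b²)`
  -- times the square of `b(b - a)`.
  refine tableCorrect_of_double_root (X := 0) (r := 1) (s := 1)
    (y := -a * b + b ^ 2) (-(a * b + b ^ 2)) h2 hE
    (by push_cast [OddTorsionFamily.coeffA₁]; rfl) (by push_cast [OddTorsionFamily.coeffA₂]; rfl)
    (by push_cast [OddTorsionFamily.coeffA₂, OddTorsionFamily.coeffA₃]; rfl)
    one_ne_zero one_ne_zero ?_ ?_ ?_ ?_ (fun hn hD0 ↦ ?_) (fun hn _ ↦ ?_)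
  · linear_combination (-a ^ 7 * b ^ 3 + 5 * a ^ 6 * b ^ 4 - 6 * a ^ 5 * b ^ 5 -
      4 * a ^ 4 * b ^ 6 + 10 * a ^ 3 * b ^ 7 - 4 * a ^ 2 * b ^ 8 : ZMod p) * hr
  · linear_combination (a ^ 10 * b ^ 6 - 9 * a ^ 9 * b ^ 7 + 32 * a ^ 8 * b ^ 8 -
      57 * a ^ 7 * b ^ 9 + 53 * a ^ 6 * b ^ 10 - 24 * a ^ 5 * b ^ 11 +
      4 * a ^ 4 * b ^ 12 : ZMod p) * hr
  · have : (5 : ZMod p) * b ^ 7 ≠ 0 := mul_ne_zero (five_cast_ne_zero (by omega))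
      (pow_ne_zero _ hb)
    contrapose! this
    linear_combination (4 * a - 11 * b : ZMod p) * this - (4 * a ^ 5 - 15 * a ^ 4 * b -
      5 * a ^ 3 * b ^ 2 + 32 * a ^ 2 * b ^ 3 + 45 * a * b ^ 4 - 49 * b ^ 5) * hr
  · linear_combination (a ^ 4 - a ^ 3 * b - 4 * a ^ 2 * b ^ 2 - 2 * a * b ^ 3 +
      5 * b ^ 4 : ZMod p) * hr
  · rw [hv, ← legendreSym_eq_one_iff hD hD0]
    simp only [MultRedTable, hq', hP']
    simp [hn.ne', h7, h2]
  · rw [hv, ← legendreSym_eq_neg_one_iff hD]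
    simp only [MultRedTable, hq', hP']
    simp [hn.ne', h7]

/-- With `a = 5u - b` both quadratics have valuation exactly 1, so `v₅(Δ) = 1 + 2` while `5 ∣ c₄`.
-/
lemma tableCorrect_C10_five [Fact (Nat.Prime 5)] (hE : (OddTorsionFamily.C10.curve a b).IsElliptic)
    (hb : (b : ZMod 5) ≠ 0) (hA : (a : ZMod 5) = -b)
    (hP' : intVal 5 (a ^ 5 * b ^ 10 * (a - 2 * b) ^ 5 * (a - b) ^ 10) = 0) :
    TableCorrect .C10 5 a b n := by
  obtain ⟨u, hu⟩ : ∃ u, a + b = 5 * u := by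
    refine (ZMod.intCast_zmod_eq_zero_iff_dvd _ 5).1 ?_
    push_cast
    rw [hA, neg_add_cancel]
  have hval (c : ℤ) : intVal 5 (5 * (b ^ 2 + 5 * c)) = 1 := by
    have h := intVal_pow_mul (p := 5) (m := 1) (x := b ^ 2 + 5 * c) ?_
    · simpa using h
    · rw [← ZMod.intCast_zmod_eq_zero_iff_dvd]
      push_cast
      reduce_mod_char
      exact pow_ne_zero _ hb
  have hq : intVal 5 (a ^ 2 + 2 * a * b - 4 * b ^ 2) = 1 := by
    rw [show a ^ 2 + 2 * a * b - 4 * b ^ 2 = -(5 * (b ^ 2 + 5 * -u ^ 2)) by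
      linear_combination (a + b + 5 * u) * hu, intVal_neg, hval]
  have hr : intVal 5 (a ^ 2 - 3 * a * b + b ^ 2) = 1 := by
    rw [show a ^ 2 - 3 * a * b + b ^ 2 = 5 * (b ^ 2 + 5 * (u ^ 2 - u * b)) by
      linear_combination (a + b + 5 * u - 5 * b) * hu, hval]
  refine tableCorrect_of_dvd_of_not_pow_dvd hE ?_ ?_ fun ℓ hn ↦ ?_
  · rw [← ZMod.intCast_zmod_eq_zero_iff_dvd, originCurve_c₄]
    push_cast [OddTorsionFamily.coeffA₁, OddTorsionFamily.coeffA₂, OddTorsionFamily.coeffA₃]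
    rw [hA]
    ring_nf
    reduce_mod_char
  · rw [C10_Δ, intVal_mul, intVal_mul, intVal_pow, hq, hr, hP']
    norm_num
  · cases ℓ <;> simp only [MultRedTable, hP'] <;> simp [hn.ne']

theorem tableCorrect_C10 (hab : IsCoprime a b) (hE : (OddTorsionFamily.C10.curve a b).IsElliptic) :
    TableCorrect .C10 p a b n := by
  have hco := cast_ne_zero_of_isCoprime (p := p) hab
  by_cases hP : (a : ZMod p) * b * (a - b) * (a - 2 * b) = 0
  · by_cases h2 : p = 2 ∧ (a : ZMod p) = 0
    · obtain ⟨rfl, ha⟩ := h2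
      have hb : (b : ZMod 2) ≠ 0 := fun hb ↦ hco ⟨ha, hb⟩
      rw [cast_zmod_eq_zero_iff] at ha
      rw [Ne, cast_zmod_eq_zero_iff] at hb
      push_cast at ha hb
      exact tableCorrect_C10_two hE ha (by omega)
    · exact tableCorrect_C10_of_dvd_mul hab hE (not_and.1 h2) hP
  have hP' : intVal p (a ^ 5 * b ^ 10 * (a - 2 * b) ^ 5 * (a - b) ^ 10) = 0 :=
    intVal_eq_zero_of_ne (by
      obtain ⟨⟨⟨h1, h2⟩, h3⟩, h4⟩ := by simpa only [mul_ne_zero_iff] using hP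
      push_cast
      exact mul_ne_zero (mul_ne_zero (mul_ne_zero (pow_ne_zero _ h1) (pow_ne_zero _ h2))
        (pow_ne_zero _ h4)) (pow_ne_zero _ h3))
  have hb : (b : ZMod p) ≠ 0 := by
    rintro hb
    simp [hb] at hP
  have h2 : p ≠ 2 := by
    rintro rfl
    exact hP (C10_mul_eq_zero_mod_two _ _)
  by_cases hqr : (a : ZMod p) ^ 2 + 2 * a * b - 4 * b ^ 2 = 0 ∨
      (a : ZMod p) ^ 2 - 3 * a * b + b ^ 2 = 0
  · rcases eq_two_or_eq_three_or_eq_five_or_seven_le p with rfl | rfl | rfl | h7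
    · exact (h2 rfl).elim
    · exact (hqr.elim (C10_ne_zero_mod_three _ _ hb).1 (C10_ne_zero_mod_three _ _ hb).2).elim
    · exact tableCorrect_C10_five hE hb (C10_eq_mod_five _ _ hqr) hP'
    · exact hqr.elim (tableCorrect_C10_of_dvd_fst hE h7 hP · hP')
        (tableCorrect_C10_of_dvd_snd hE h7 hP · hP')
  obtain ⟨hq, hr⟩ := not_or.1 hqr
  have hq' : intVal p (a ^ 2 + 2 * a * b - 4 * b ^ 2) = 0 :=
    intVal_eq_zero_of_ne (by push_cast; exact hq)
  have hr' : intVal p (a ^ 2 - 3 * a * b + b ^ 2) = 0 :=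
    intVal_eq_zero_of_ne (by push_cast; exact hr)
  refine tableCorrect_of_intVal_Δ_eq_zero hE ?_ (fun ℓ hn ↦ ?_)
  · rw [C10_Δ, intVal_mul, intVal_mul, intVal_pow, hq', hr', hP']
    simp
  · cases ℓ <;> simp only [MultRedTable, hP', hq', hr'] <;> simp [hn.ne', h2]

end C10

/-! ### The family `C₁₂`. -/

section C12

variable {p : ℕ} [Fact p.Prime] {a b : ℤ} {n : ℕ}

lemma C12_Δ (a b : ℤ) : (originCurve (OddTorsionFamily.C12.coeffA₁ a b)
    (OddTorsionFamily.C12.coeffA₂ a b) (OddTorsionFamily.C12.coeffA₃ a b)).Δ =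
    (b ^ 12 * (a - b) ^ 12 * (a - 2 * b) ^ 6) * (a ^ 2 * (a ^ 2 - 6 * a * b + 6 * b ^ 2)) *
      ((a ^ 2 - 2 * a * b + 2 * b ^ 2) ^ 3 * (a ^ 2 - 3 * a * b + 3 * b ^ 2) ^ 4) := by
  simp only [originCurve_Δ, OddTorsionFamily.coeffA₁, OddTorsionFamily.coeffA₂,
    OddTorsionFamily.coeffA₃]
  ring

lemma C12_intVal_Δ (p : ℕ) [Fact p.Prime] (a b : ℤ) :
    intVal p (originCurve (OddTorsionFamily.C12.coeffA₁ a b)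
      (OddTorsionFamily.C12.coeffA₂ a b) (OddTorsionFamily.C12.coeffA₃ a b)).Δ =
    intVal p (b ^ 12 * (a - b) ^ 12 * (a - 2 * b) ^ 6) +
      (2 * intVal p a + intVal p (a ^ 2 - 6 * a * b + 6 * b ^ 2)) +
      (3 * intVal p (a ^ 2 - 2 * a * b + 2 * b ^ 2) +
        4 * intVal p (a ^ 2 - 3 * a * b + 3 * b ^ 2)) := by
  rw [C12_Δ, intVal_mul, intVal_mul, intVal_mul (a ^ 2), intVal_mul (_ ^ 3), intVal_pow,
    intVal_pow, intVal_pow]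
  rfl

/-- Modulo 2, and likewise modulo 3, one of `a`, `b`, `a - b`, `a - 2b` always vanishes; once these
are dealt with, only `p ≥ 5` remains. -/
lemma C12_mul_eq_zero_mod_two : ∀ x y : ZMod 2, x * (y * (x - y) * (x - 2 * y)) = 0 := by
  decide

lemma C12_mul_eq_zero_mod_three : ∀ x y : ZMod 3, x * (y * (x - y) * (x - 2 * y)) = 0 := by
  decide

lemma tableCorrect_C12_of_dvd_mul (hab : IsCoprime a b)
    (hE : (OddTorsionFamily.C12.curve a b).IsElliptic)
    (h2 : p = 2 → (a : ZMod p) ≠ 0) (h3 : p = 3 → (a : ZMod p) ≠ 0)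
    (h : (b : ZMod p) * (a - b) * (a - 2 * b) = 0) :
    TableCorrect .C12 p a b n := by
  have hco := cast_ne_zero_of_isCoprime (p := p) hab
  have hP : (OddTorsionFamily.C12.coeffA₁ a b : ZMod p) ≠ 0 ∧ (a : ZMod p) ≠ 0 ∧
      (a : ZMod p) ^ 2 - 6 * a * b + 6 * b ^ 2 ≠ 0 ∧
      (a : ZMod p) ^ 2 - 2 * a * b + 2 * b ^ 2 ≠ 0 ∧
      (a : ZMod p) ^ 2 - 3 * a * b + 3 * b ^ 2 ≠ 0 := by
    push_cast [OddTorsionFamily.coeffA₁]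
    rcases mul_eq_zero.1 h with h | h
    · rcases mul_eq_zero.1 h with h | h
      · have ha : (a : ZMod p) ≠ 0 := fun ha ↦ hco ⟨ha, h⟩
        rw [h]
        simp [ha]
      · have hA := sub_eq_zero.1 h
        have hb : (b : ZMod p) ≠ 0 := fun hb ↦ hco ⟨hA.trans hb, hb⟩
        rw [hA]
        refine ⟨?_, hb, ?_, ?_, ?_⟩
        · convert pow_ne_zero 4 hb using 1
          ring
        all_goals
          convert pow_ne_zero 2 hb using 1
          ring
    · have hA := sub_eq_zero.1 h
      have hb : (b : ZMod p) ≠ 0 := fun hb ↦ hco ⟨by rw [hA, hb, mul_zero], hb⟩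
      have h2' : (2 : ZMod p) ≠ 0 := two_cast_ne_zero (by
        rintro rfl
        refine h2 rfl ?_
        rw [hA]
        reduce_mod_char)
      rw [hA]
      refine ⟨?_, mul_ne_zero h2' hb, ?_, ?_, ?_⟩
      · convert neg_ne_zero.2 (mul_ne_zero h2' (pow_ne_zero 4 hb)) using 1
        ring
      · convert neg_ne_zero.2 (mul_ne_zero h2' (pow_ne_zero 2 hb)) using 1
        ring
      · convert mul_ne_zero h2' (pow_ne_zero 2 hb) using 1
        ring
      · convert pow_ne_zero 2 hb using 1
        ring
  obtain ⟨h1, ha, hq6, hq2, hq3⟩ := hP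
  have ha' : intVal p a = 0 := intVal_eq_zero_of_ne ha
  have hq6' : intVal p (a ^ 2 - 6 * a * b + 6 * b ^ 2) = 0 :=
    intVal_eq_zero_of_ne (by push_cast; exact hq6)
  have hq2' : intVal p (a ^ 2 - 2 * a * b + 2 * b ^ 2) = 0 :=
    intVal_eq_zero_of_ne (by push_cast; exact hq2)
  have hq3' : intVal p (a ^ 2 - 3 * a * b + 3 * b ^ 2) = 0 :=
    intVal_eq_zero_of_ne (by push_cast; exact hq3)
  have h2a : p = 2 → intVal 2 a = 0 := by
    rintro rfl
    exact ha'
  have h3a : p = 3 → intVal 3 a = 0 := by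
    rintro rfl
    exact ha'
  have ha₂ : (OddTorsionFamily.C12.coeffA₂ a b : ZMod p) = 0 := by
    push_cast [OddTorsionFamily.coeffA₂]
    linear_combination ((a - b) * (a ^ 2 - 3 * a * b + 3 * b ^ 2) *
      (a ^ 2 - 2 * a * b + 2 * b ^ 2) : ZMod p) * h
  refine tableCorrect_of_split 1 (OddTorsionFamily.C12.coeffA₁ a b)
    (OddTorsionFamily.C12.coeffA₂ a b) (OddTorsionFamily.C12.coeffA₃ a b) one_ne_zero
    (one_mul _).symm (by rw [one_pow, one_mul]) (by rw [one_pow, one_mul]) hE h1 ha₂ ?_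
    (fun hn ↦ ?_) (fun hn ↦ ?_)
  · rw [OddTorsionFamily.coeffA₃, Int.cast_mul, ha₂, mul_zero]
  · rw [C12_intVal_Δ, ha', hq6', hq2', hq3']
    simp only [mul_zero, add_zero]
    constructor
    · rintro (⟨-, h, -⟩ | ⟨-, h, -, h'⟩ | ⟨h, -⟩ | ⟨-, -, h, -⟩ | ⟨h, -⟩ | ⟨-, -, h⟩)
      · exact h
      · simp [h2a h] at h'
      · simp at h
      · simp [ha', hq6', hn.ne'] at h
      · simp at h
      · simp [hq2', hq3', hn.ne'] at h
    · exact fun h ↦ .inl ⟨rfl, h, h2a, h3a⟩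
  · rintro (⟨h, -⟩ | ⟨h, -⟩ | ⟨-, h, -, h'⟩ | ⟨h, -⟩ | ⟨-, -, h, -⟩ | ⟨h, -⟩)
    · simp at h
    · simp at h
    · simp [h2a h] at h'
    · simp at h
    · simp [ha', hq6', hn.ne'] at h
    · simp at h

/-- Writing `a₁ = 3α`, `a₂ = 3β`, `a₃ = 9γ` gives `c₄ = 9 ((3α² + 4β)² - 72αγ)` with `β ≡ -b⁸` a
unit, so `v₃(c₄) = 2`. -/
lemma tableCorrect_C12_three [Fact (Nat.Prime 3)] (hE : (OddTorsionFamily.C12.curve a b).IsElliptic)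
    (ha : a % 3 = 0) (hb : (b : ZMod 3) ≠ 0) : TableCorrect .C12 3 a b n := by
  obtain ⟨A, rfl⟩ := Int.dvd_of_emod_eq_zero ha
  obtain ⟨α, hα⟩ : ∃ α, OddTorsionFamily.C12.coeffA₁ (3 * A) b = 3 * α :=
    ⟨-27 * A ^ 4 + 18 * A ^ 3 * b + 6 * A ^ 2 * b ^ 2 - 8 * A * b ^ 3 + 2 * b ^ 4, by
      simp only [OddTorsionFamily.coeffA₁]
      ring⟩
  obtain ⟨β, hβ, hβ'⟩ : ∃ β, OddTorsionFamily.C12.coeffA₂ (3 * A) b = 3 * β ∧ (β : ZMod 3) ≠ 0 := by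
    refine ⟨b * (3 * A - 2 * b) * (3 * A - b) ^ 2 * (3 * A ^ 2 - 3 * A * b + b ^ 2) *
      (9 * A ^ 2 - 6 * A * b + 2 * b ^ 2), ?_, ?_⟩
    · simp only [OddTorsionFamily.coeffA₂]
      ring
    · push_cast
      convert neg_ne_zero.2 (pow_ne_zero 8 hb) using 1
      ring_nf
      reduce_mod_char
  obtain ⟨γ, hγ⟩ : ∃ γ, OddTorsionFamily.C12.coeffA₃ (3 * A) b = 9 * γ := by
    refine ⟨A * (b - 3 * A) ^ 3 * β, ?_⟩
    simp only [OddTorsionFamily.coeffA₃, hβ]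
    ring
  refine tableCorrect_of_intVal_c₄_mod hE (j := 2) (by norm_num) ?_ fun ℓ hn ↦ ?_
  · rw [originCurve_c₄, hα, hβ, hγ]
    have h := intVal_pow_mul (p := 3) (m := 2) (x := (3 * α ^ 2 + 4 * β) ^ 2 - 72 * α * γ) ?_
    · rw [← h]
      congr 1
      push_cast
      ring
    · rw [← ZMod.intCast_zmod_eq_zero_iff_dvd]
      push_cast
      refine fun h ↦ pow_ne_zero 2 hβ' (Eq.trans ?_ h)
      ring_nf
      reduce_mod_char
  · have h : intVal 3 (3 * A) ≠ 0 := by simp [three_mul_intVal]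
    cases ℓ <;> simp [MultRedTable, h]

/-- For `a = 2A`, scaling by 2 makes `a₁` odd and leaves `A` as a factor of `a₃`. If `A` is even
then `a₂` is odd: non-split with `n = 2 v(A)`. If `A` is odd then `A - b` is even and divides `a₂`:
split with `n = 6 v(A - b)`. -/
lemma tableCorrect_C12_two [Fact (Nat.Prime 2)] (hE : (OddTorsionFamily.C12.curve a b).IsElliptic)
    (ha : a % 2 = 0) (hb : b % 2 = 1) : TableCorrect .C12 2 a b n := by
  obtain ⟨A, rfl⟩ := Int.dvd_of_emod_eq_zero ha
  have hb' := intVal_two_eq_zero (x := b) (by omega)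
  have hb1 : (b : ZMod 2) = 1 := ZMod.eq_one_of_ne_zero_two _ (by
    rw [Ne, cast_zmod_eq_zero_iff]
    push_cast
    omega)
  have hodd (c : ℤ) : intVal 2 (b ^ 2 + 2 * c) = 0 := by
    refine intVal_two_eq_zero ?_
    simp [pow_two, Int.add_emod, Int.mul_emod, hb]
  have h1' := intVal_two_eq_zero (x := 2 * A - b) (by omega)
  have hΔ0 := OddTorsionFamily.Δ_ne_zero hE
  rw [C12_Δ] at hΔ0
  have hA0 : A ≠ 0 := by
    rintro rfl
    simp at hΔ0
  have hAb0 : A - b ≠ 0 := by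
    intro h
    rw [← mul_sub, h] at hΔ0
    simp at hΔ0
  obtain ⟨k, hk⟩ := intVal_eq_coe (p := 2) hA0
  obtain ⟨l, hl⟩ := intVal_eq_coe (p := 2) hAb0
  have h2A : intVal 2 (2 * A) = 1 + k := by rw [two_mul_intVal, hk]
  have h2Ab : intVal 2 (2 * A - 2 * b) = 1 + l := by rw [← mul_sub, two_mul_intVal, hl]
  set a₁ := -8 * A ^ 4 + 8 * A ^ 3 * b + 4 * A ^ 2 * b ^ 2 - 8 * A * b ^ 3 + 3 * b ^ 4 with ha₁
  set a₂ := b * (A - b) * (2 * A - b) ^ 2 * (4 * A ^ 2 - 6 * A * b + 3 * b ^ 2) *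
    (2 * A ^ 2 - 2 * A * b + b ^ 2) with ha₂
  set a₃ := A * (b - 2 * A) ^ 3 * a₂ with ha₃
  have hv : intVal 2 (originCurve a₁ a₂ a₃).Δ = 6 * l + 2 * k := by
    rw [show (originCurve a₁ a₂ a₃).Δ =
      (A - b) ^ 6 * A ^ 2 * b ^ 12 * (2 * A - b) ^ 12 * (b ^ 2 + 2 * (A ^ 2 - 3 * A * b + b ^ 2)) *
        (b ^ 2 + 2 * (A ^ 2 - A * b)) ^ 3 * (b ^ 2 + 2 * (2 * A ^ 2 - 3 * A * b + b ^ 2)) ^ 4 by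
        rw [originCurve_Δ]; ring,
      intVal_mul, intVal_mul, intVal_mul, intVal_mul, intVal_mul, intVal_mul, intVal_pow,
      intVal_pow, intVal_pow, intVal_pow, intVal_pow, intVal_pow, hk, hl, hb', h1', hodd, hodd,
      hodd]
    simp
  have e1 : OddTorsionFamily.C12.coeffA₁ (2 * A) b = 2 * a₁ := by
    simp only [OddTorsionFamily.coeffA₁, ha₁]
    ring
  have e2 : OddTorsionFamily.C12.coeffA₂ (2 * A) b = 2 ^ 2 * a₂ := by
    simp only [OddTorsionFamily.coeffA₂, ha₂]
    ring
  have e3 : OddTorsionFamily.C12.coeffA₃ (2 * A) b = 2 ^ 3 * a₃ := by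
    simp only [OddTorsionFamily.coeffA₃, e2, ha₃]
    ring
  have h1 : (a₁ : ZMod 2) = 1 := by
    rw [ha₁]
    push_cast
    rw [hb1]
    ring_nf
    reduce_mod_char
  rcases Int.emod_two_eq_zero_or_one A with hA | hA
  · have hl0 : l = 0 := by
      rw [intVal_two_eq_zero (by omega)] at hl
      exact_mod_cast hl.symm
    have hk0 : k ≠ 0 := by
      rintro rfl
      exact intVal_eq_zero_iff.1 hk (Int.dvd_of_emod_eq_zero hA)
    have hA2 : (A : ZMod 2) = 0 := cast_zmod_eq_zero_iff.2 hA
    have h2 : (a₂ : ZMod 2) = 1 := by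
      rw [ha₂]
      push_cast
      rw [hb1, hA2]
      ring_nf
      reduce_mod_char
    refine tableCorrect_of_origin 2 a₁ a₂ a₃ two_ne_zero e1 e2 e3 hE ?_ ?_
      (fun hn ↦ ?_) (fun hn ↦ ?_)
    · rw [h1, h2]
      ring_nf
      reduce_mod_char
      exact one_ne_zero
    · rw [ha₃]
      push_cast
      rw [hA2, zero_mul, zero_mul]
    · rw [h1, h2]
      simp only [not_exists_sq_add_self_sub_one, and_false, iff_false]
      simp only [MultRedTable, h2A, h2Ab]
      norm_cast
      simp
      omega
    · rw [h1, h2, hv]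
      simp only [not_exists_sq_add_self_sub_one, not_false_iff, and_true, hl0]
      simp only [MultRedTable, h2A, h2Ab]
      norm_cast
      simp
      omega
  · have hk0 : k = 0 := by
      rw [intVal_two_eq_zero (by omega)] at hk
      exact_mod_cast hk.symm
    have hAb2 : (A - b : ZMod 2) = 0 := by
      have : ((A - b : ℤ) : ZMod 2) = 0 := cast_zmod_eq_zero_iff.2 (by push_cast; omega)
      exact_mod_cast this
    have h2 : (a₂ : ZMod 2) = 0 := by
      rw [ha₂]
      push_cast
      rw [hAb2]
      ring
    refine tableCorrect_of_split 2 a₁ a₂ a₃ two_ne_zero e1 e2 e3 hE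
      (by rw [h1]; exact one_ne_zero) h2 (by rw [ha₃, Int.cast_mul, h2, mul_zero])
      (fun hn ↦ ?_) (fun hn ↦ ?_)
    · rw [hv, hk0]
      simp only [MultRedTable, h2A, h2Ab, hk0]
      norm_cast
      simp
      omega
    · simp only [MultRedTable, h2A, hk0]
      norm_cast
      simp

lemma tableCorrect_C12_of_dvd_left (hE : (OddTorsionFamily.C12.curve a b).IsElliptic) (h5 : 5 ≤ p)
    (hP' : intVal p (b ^ 12 * (a - b) ^ 12 * (a - 2 * b) ^ 6) = 0)
    (hb : (b : ZMod p) ≠ 0) (ha : (a : ZMod p) = 0) : TableCorrect .C12 p a b n := by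
  have h2 := two_cast_ne_zero (p := p) (by omega)
  have h3 := three_cast_ne_zero (p := p) (by omega)
  have hq2' : intVal p (a ^ 2 - 2 * a * b + 2 * b ^ 2) = 0 :=
    intVal_eq_zero_of_ne (by push_cast; rw [ha]; simp [h2, hb])
  have hq3' : intVal p (a ^ 2 - 3 * a * b + 3 * b ^ 2) = 0 :=
    intVal_eq_zero_of_ne (by push_cast; rw [ha]; simp [h3, hb])
  have hv := C12_intVal_Δ p a b
  rw [hP', hq2', hq3', mul_zero, mul_zero, add_zero, add_zero, zero_add] at hv
  have hp2 : p ≠ 2 := by omega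
  -- `a₃` vanishes with `a`, so the node is the origin and `β = 36 b⁸ - 48 b⁸ = -3 (2b⁴)²`.
  refine tableCorrect_of_double_root (X := 0) (r := 1) (s := 1) (y := 2 * b ^ 4)
    (A₁ := 6 * b ^ 4) (A₂ := -12 * b ^ 8) (A₃ := 0)
    (-3) hp2 hE ?_ ?_ ?_ one_ne_zero one_ne_zero (by ring) (by ring) ?_ (by ring)
    (fun hn _ ↦ ?_) (fun hn _ ↦ ?_)
  · push_cast [OddTorsionFamily.coeffA₁]
    rw [ha]
    ring
  · push_cast [OddTorsionFamily.coeffA₂]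
    rw [ha]
    ring
  · rw [OddTorsionFamily.coeffA₃, Int.cast_mul, Int.cast_mul, ha, zero_mul, zero_mul]
  · convert neg_ne_zero.2 (mul_ne_zero (mul_ne_zero (pow_ne_zero 2 h2) h3) (pow_ne_zero 8 hb))
      using 1
    ring
  · rw [hv, isSquare_neg_three_iff h5]
    simp only [MultRedTable, hP', hq2', hq3']
    simp [hn.ne', h5, hp2]
  · rw [hv, isSquare_neg_three_iff h5, ← modEq_five_iff h5]
    simp only [MultRedTable]
    simp [h5, hp2]

lemma tableCorrect_C12_of_dvd_fst (hE : (OddTorsionFamily.C12.curve a b).IsElliptic) (h5 : 5 ≤ p)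
    (hP' : intVal p (b ^ 12 * (a - b) ^ 12 * (a - 2 * b) ^ 6) = 0)
    (hb : (b : ZMod p) ≠ 0) (hd : (a - b : ZMod p) ≠ 0)
    (hq : (a : ZMod p) ^ 2 - 6 * a * b + 6 * b ^ 2 = 0) : TableCorrect .C12 p a b n := by
  have h2 := two_cast_ne_zero (p := p) (by omega)
  have h3 := three_cast_ne_zero (p := p) (by omega)
  -- The other two quadratics differ from this one by `4b(a - b)` and `3b(a - b)`, which are units.
  have hq2' : intVal p (a ^ 2 - 2 * a * b + 2 * b ^ 2) = 0 := intVal_eq_zero_of_ne (by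
    push_cast
    convert mul_ne_zero (pow_ne_zero 2 h2) (mul_ne_zero hb hd) using 1
    linear_combination hq)
  have hq3' : intVal p (a ^ 2 - 3 * a * b + 3 * b ^ 2) = 0 := intVal_eq_zero_of_ne (by
    push_cast
    convert mul_ne_zero h3 (mul_ne_zero hb hd) using 1
    linear_combination hq)
  have hv := C12_intVal_Δ p a b
  rw [hP', hq2', hq3', mul_zero, mul_zero, add_zero, add_zero, zero_add] at hv
  have hp2 : p ≠ 2 := by omega
  refine tableCorrect_of_double_root (X := -2508 * a * b ^ 7 + 3180 * b ^ 8) (r := 1) (s := 1)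
    (y := 8 * a * b ^ 3 - 10 * b ^ 4) (-3) hp2 hE
    (by push_cast [OddTorsionFamily.coeffA₁]; rfl) (by push_cast [OddTorsionFamily.coeffA₂]; rfl)
    (by push_cast [OddTorsionFamily.coeffA₂, OddTorsionFamily.coeffA₃]; rfl)
    one_ne_zero one_ne_zero ?_ ?_ ?_ ?_ (fun hn _ ↦ ?_) (fun hn _ ↦ ?_)
  · linear_combination (a ^ 13 * b - 8 * a ^ 12 * b ^ 2 + 34 * a ^ 11 * b ^ 3 -
      67 * a ^ 10 * b ^ 4 + 83 * a ^ 9 * b ^ 5 + 220 * a ^ 8 * b ^ 6 - 2496 * a ^ 7 * b ^ 7 -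
      8661 * a ^ 6 * b ^ 8 + 44306 * a ^ 5 * b ^ 9 - 206514 * a ^ 4 * b ^ 10 -
      47880 * a ^ 3 * b ^ 11 - 1398646 * a ^ 2 * b ^ 12 - 5776236 * a * b ^ 13 +
      10106040 * b ^ 14 : ZMod p) * hq
  · linear_combination (a ^ 20 * b ^ 2 - 18 * a ^ 19 * b ^ 3 + 162 * a ^ 18 * b ^ 4 -
      942 * a ^ 17 * b ^ 5 + 3958 * a ^ 16 * b ^ 6 - 12644 * a ^ 15 * b ^ 7 +
      26929 * a ^ 14 * b ^ 8 - 17854 * a ^ 13 * b ^ 9 - 113841 * a ^ 12 * b ^ 10 +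
      414518 * a ^ 11 * b ^ 11 - 657636 * a ^ 10 * b ^ 12 - 592746 * a ^ 9 * b ^ 13 +
      8326848 * a ^ 8 * b ^ 14 + 8529200 * a ^ 7 * b ^ 15 -
      140664823 * a ^ 6 * b ^ 16 + 620349446 * a ^ 5 * b ^ 17 -
      693156854 * a ^ 4 * b ^ 18 + 2599163904 * a ^ 3 * b ^ 19 +
      6466310328 * a ^ 2 * b ^ 20 - 29071661760 * a * b ^ 21 + 21418063200 * b ^ 22 : ZMod p) * hq
  · have : (2 : ZMod p) ^ 2 * 3 * b ^ 9 ≠ 0 :=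
      mul_ne_zero (mul_ne_zero (pow_ne_zero _ h2) h3) (pow_ne_zero _ hb)
    contrapose! this
    linear_combination (56 * a - 265 * b : ZMod p) * this -
      (56 * a ^ 7 + 71 * a ^ 6 * b - 1926 * a ^ 5 * b ^ 2 + 6966 * a ^ 4 * b ^ 3 -
      12000 * a ^ 3 * b ^ 4 + 10992 * a ^ 2 * b ^ 5 - 4884 * a * b ^ 6 -
      1684872 * b ^ 7) * hq
  · linear_combination (a ^ 6 + 6 * a ^ 5 * b - 6 * a ^ 4 * b ^ 2 + 96 * a ^ 3 * b ^ 3 +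
      240 * a ^ 2 * b ^ 4 + 1332 * a * b ^ 5 + 6408 * b ^ 6 : ZMod p) * hq
  · rw [hv, isSquare_neg_three_iff h5]
    simp only [MultRedTable, hP', hq2', hq3']
    simp [hn.ne', h5, hp2]
  · rw [hv, isSquare_neg_three_iff h5, ← modEq_five_iff h5]
    simp only [MultRedTable]
    simp [h5, hp2]

/-- Both quadratics divide `a₂`, hence also `a₃`: the node is the origin and is split, with no
condition on `p` modulo 6. -/
lemma tableCorrect_C12_of_dvd_snd (hE : (OddTorsionFamily.C12.curve a b).IsElliptic) (h5 : 5 ≤ p)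
    (hP' : intVal p (b ^ 12 * (a - b) ^ 12 * (a - 2 * b) ^ 6) = 0)
    (ha : (a : ZMod p) ≠ 0) (hb : (b : ZMod p) ≠ 0)
    (hq : (a : ZMod p) ^ 2 - 6 * a * b + 6 * b ^ 2 ≠ 0)
    (h : ((a : ZMod p) ^ 2 - 2 * a * b + 2 * b ^ 2) * (a ^ 2 - 3 * a * b + 3 * b ^ 2) = 0) :
    TableCorrect .C12 p a b n := by
  have h2 := two_cast_ne_zero (p := p) (by omega)
  have ha' := intVal_eq_zero_of_ne ha
  have hq' : intVal p (a ^ 2 - 6 * a * b + 6 * b ^ 2) = 0 :=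
    intVal_eq_zero_of_ne (by push_cast; exact hq)
  have hv := C12_intVal_Δ p a b
  rw [hP', ha', hq', mul_zero, add_zero, zero_add, zero_add] at hv
  have hp2 : p ≠ 2 := by omega
  have ha₂ : (OddTorsionFamily.C12.coeffA₂ a b : ZMod p) = 0 := by
    push_cast [OddTorsionFamily.coeffA₂]
    linear_combination (b * (a - 2 * b) * (a - b) ^ 2 : ZMod p) * h
  refine tableCorrect_of_split 1 (OddTorsionFamily.C12.coeffA₁ a b)
    (OddTorsionFamily.C12.coeffA₂ a b) (OddTorsionFamily.C12.coeffA₃ a b) one_ne_zero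
    (one_mul _).symm (by rw [one_pow, one_mul]) (by rw [one_pow, one_mul]) hE ?_ ha₂
    (by rw [OddTorsionFamily.coeffA₃, Int.cast_mul, ha₂, mul_zero]) (fun hn ↦ ?_) (fun hn ↦ ?_)
  · push_cast [OddTorsionFamily.coeffA₁]
    rcases mul_eq_zero.1 h with h | h
    · convert neg_ne_zero.2 (mul_ne_zero h2 (pow_ne_zero 4 hb)) using 1
      linear_combination (4 * b ^ 2 - a ^ 2 : ZMod p) * h
    · convert mul_ne_zero ha (pow_ne_zero 3 hb) using 1
      linear_combination (2 * b ^ 2 - a * b - a ^ 2 : ZMod p) * h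
  · rw [hv]
    simp only [MultRedTable, hP', ha', hq']
    simp [hn.ne', h5, hp2]
  · simp only [MultRedTable, hP', ha', hq']
    simp [hn.ne', hp2]

theorem tableCorrect_C12 (hab : IsCoprime a b) (hE : (OddTorsionFamily.C12.curve a b).IsElliptic) :
    TableCorrect .C12 p a b n := by
  have hco := cast_ne_zero_of_isCoprime (p := p) hab
  by_cases h2 : p = 2 ∧ (a : ZMod p) = 0
  · obtain ⟨rfl, ha⟩ := h2
    have hb : (b : ZMod 2) ≠ 0 := fun hb ↦ hco ⟨ha, hb⟩
    rw [cast_zmod_eq_zero_iff] at ha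
    rw [Ne, cast_zmod_eq_zero_iff] at hb
    push_cast at ha hb
    exact tableCorrect_C12_two hE ha (by omega)
  by_cases h3 : p = 3 ∧ (a : ZMod p) = 0
  · obtain ⟨rfl, ha⟩ := h3
    exact tableCorrect_C12_three hE (cast_zmod_eq_zero_iff.1 ha) fun hb ↦ hco ⟨ha, hb⟩
  rw [not_and] at h2 h3
  by_cases hP : (b : ZMod p) * (a - b) * (a - 2 * b) = 0
  · exact tableCorrect_C12_of_dvd_mul hab hE h2 h3 hP
  have h5 : 5 ≤ p := by
    rcases eq_two_or_eq_three_or_five_le p with rfl | rfl | h5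
    · exact (mul_ne_zero (h2 rfl) hP (C12_mul_eq_zero_mod_two _ _)).elim
    · exact (mul_ne_zero (h3 rfl) hP (C12_mul_eq_zero_mod_three _ _)).elim
    · exact h5
  obtain ⟨⟨hb, hd⟩, hd2⟩ := by simpa only [mul_ne_zero_iff] using hP
  have hP' : intVal p (b ^ 12 * (a - b) ^ 12 * (a - 2 * b) ^ 6) = 0 :=
    intVal_eq_zero_of_ne (by
      push_cast
      exact mul_ne_zero (mul_ne_zero (pow_ne_zero _ hb) (pow_ne_zero _ hd)) (pow_ne_zero _ hd2))
  by_cases ha : (a : ZMod p) = 0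
  · exact tableCorrect_C12_of_dvd_left hE h5 hP' hb ha
  by_cases hq : (a : ZMod p) ^ 2 - 6 * a * b + 6 * b ^ 2 = 0
  · exact tableCorrect_C12_of_dvd_fst hE h5 hP' hb hd hq
  by_cases h : ((a : ZMod p) ^ 2 - 2 * a * b + 2 * b ^ 2) * (a ^ 2 - 3 * a * b + 3 * b ^ 2) = 0
  · exact tableCorrect_C12_of_dvd_snd hE h5 hP' ha hb hq h
  obtain ⟨hq2, hq3⟩ := mul_ne_zero_iff.1 h
  have ha' := intVal_eq_zero_of_ne ha
  have hq' : intVal p (a ^ 2 - 6 * a * b + 6 * b ^ 2) = 0 :=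
    intVal_eq_zero_of_ne (by push_cast; exact hq)
  have hq2' : intVal p (a ^ 2 - 2 * a * b + 2 * b ^ 2) = 0 :=
    intVal_eq_zero_of_ne (by push_cast; exact hq2)
  have hq3' : intVal p (a ^ 2 - 3 * a * b + 3 * b ^ 2) = 0 :=
    intVal_eq_zero_of_ne (by push_cast; exact hq3)
  have hp2 : p ≠ 2 := by omega
  refine tableCorrect_of_intVal_Δ_eq_zero hE ?_ (fun ℓ hn ↦ ?_)
  · rw [C12_intVal_Δ, hP', ha', hq', hq2', hq3']
    simp
  · cases ℓ <;> simp only [MultRedTable, hP', ha', hq', hq2', hq3'] <;> simp [hn.ne', hp2]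

end C12

/-! ### The family `C₂ × C₆`. -/

section C2xC6

variable {p : ℕ} [Fact p.Prime] {a b : ℤ} {n : ℕ}

lemma C2xC6_Δ (a b : ℤ) : (originCurve (OddTorsionFamily.C2xC6.coeffA₁ a b)
    (OddTorsionFamily.C2xC6.coeffA₂ a b) (OddTorsionFamily.C2xC6.coeffA₃ a b)).Δ =
    (2 * a * (b - 5 * a) * (b - a)) ^ 6 * ((b ^ 2 - 9 * a ^ 2) * (b - 9 * a)) ^ 2 := by
  simp only [originCurve_Δ, OddTorsionFamily.coeffA₁, OddTorsionFamily.coeffA₂,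
    OddTorsionFamily.coeffA₃]
  ring

lemma C2xC6_intVal_Δ (p : ℕ) [Fact p.Prime] (a b : ℤ) :
    intVal p (originCurve (OddTorsionFamily.C2xC6.coeffA₁ a b)
      (OddTorsionFamily.C2xC6.coeffA₂ a b) (OddTorsionFamily.C2xC6.coeffA₃ a b)).Δ =
    6 * intVal p (2 * a * (b - 5 * a) * (b - a)) +
      2 * intVal p ((b ^ 2 - 9 * a ^ 2) * (b - 9 * a)) := by
  rw [C2xC6_Δ, intVal_mul, intVal_pow, intVal_pow]
  rfl

lemma C2xC6_coeffA₂ (a b : ℤ) :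
    OddTorsionFamily.C2xC6.coeffA₂ a b = 2 * a * (b - 5 * a) * (b - a) * (b - a) := by
  simp only [OddTorsionFamily.coeffA₂]
  ring

/-- Zeros of `b² - 9a²` therefore put the node at the origin; on `b = 9a` it lies elsewhere. -/
lemma C2xC6_coeffA₃ (a b : ℤ) : OddTorsionFamily.C2xC6.coeffA₃ a b =
    OddTorsionFamily.C2xC6.coeffA₂ a b * (b ^ 2 - 9 * a ^ 2) := by
  simp only [OddTorsionFamily.coeffA₂, OddTorsionFamily.coeffA₃]
  ring

lemma C2xC6_ne_zero_mod_two : ∀ x y : ZMod 2, x + y ≠ 0 →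
    -19 * x ^ 2 + 2 * x * y + y ^ 2 ≠ 0 ∧ (y ^ 2 - 9 * x ^ 2) * (y - 9 * x) ≠ 0 := by
  decide

lemma C2xC6_mul_eq_zero_mod_three : ∀ x y : ZMod 3, y ≠ 0 →
    2 * x * (y - 5 * x) * (y - x) = 0 := by
  decide

lemma C2xC6_ne_zero (hab : IsCoprime a b) (h2 : p = 2 → (a + b : ZMod p) ≠ 0)
    (h : (2 * a * (b - 5 * a) * (b - a) : ZMod p) = 0) :
    (OddTorsionFamily.C2xC6.coeffA₁ a b : ZMod p) ≠ 0 ∧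
      ((b : ZMod p) ^ 2 - 9 * a ^ 2) * (b - 9 * a) ≠ 0 := by
  have hco := cast_ne_zero_of_isCoprime (p := p) hab
  push_cast [OddTorsionFamily.coeffA₁]
  rcases eq_or_ne p 2 with rfl | hp2
  · exact C2xC6_ne_zero_mod_two _ _ (h2 rfl)
  have h2' := two_cast_ne_zero hp2
  rcases mul_eq_zero.1 h with h | h
  · rcases mul_eq_zero.1 h with h | h
    · have ha : (a : ZMod p) = 0 := (mul_eq_zero.1 h).resolve_left h2'
      have hb : (b : ZMod p) ≠ 0 := fun hb ↦ hco ⟨ha, hb⟩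
      rw [ha]
      simp [hb]
    · have hB := sub_eq_zero.1 h
      have ha : (a : ZMod p) ≠ 0 := fun ha ↦ hco ⟨ha, by rw [hB, ha, mul_zero]⟩
      rw [hB]
      constructor
      · convert mul_ne_zero (pow_ne_zero 4 h2') (pow_ne_zero 2 ha) using 1
        ring
      · convert neg_ne_zero.2 (mul_ne_zero (pow_ne_zero 6 h2') (pow_ne_zero 3 ha)) using 1
        ring
  · have hB := sub_eq_zero.1 h
    have ha : (a : ZMod p) ≠ 0 := fun ha ↦ hco ⟨ha, hB.trans ha⟩
    rw [hB]
    constructor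
    · convert neg_ne_zero.2 (mul_ne_zero (pow_ne_zero 4 h2') (pow_ne_zero 2 ha)) using 1
      ring
    · convert mul_ne_zero (pow_ne_zero 6 h2') (pow_ne_zero 3 ha) using 1
      ring

lemma tableCorrect_C2xC6_of_dvd_mul (hab : IsCoprime a b)
    (hE : (OddTorsionFamily.C2xC6.curve a b).IsElliptic)
    (h2 : p = 2 → (a + b : ZMod p) ≠ 0) (h3 : p = 3 → (b : ZMod p) ≠ 0)
    (h : (2 * a * (b - 5 * a) * (b - a) : ZMod p) = 0) :
    TableCorrect .C2xC6 p a b n := by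
  obtain ⟨h1, hR⟩ := C2xC6_ne_zero hab h2 h
  have hR' : intVal p ((b ^ 2 - 9 * a ^ 2) * (b - 9 * a)) = 0 :=
    intVal_eq_zero_of_ne (by push_cast; exact hR)
  have h2a : p = 2 → intVal 2 (a + b) = 0 := by
    rintro rfl
    exact intVal_eq_zero_of_ne (by push_cast; exact h2 rfl)
  have h2s : p = 2 → intVal 2 (a - b) = 0 := by
    rintro rfl
    have := h2 rfl
    rw [← Int.cast_add, Ne, cast_zmod_eq_zero_iff] at this
    push_cast at this
    exact intVal_two_eq_zero (by omega)
  have h3b : p = 3 → intVal 3 b = 0 := by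
    rintro rfl
    exact intVal_eq_zero_of_ne (h3 rfl)
  have ha₂ : (OddTorsionFamily.C2xC6.coeffA₂ a b : ZMod p) = 0 := by
    rw [C2xC6_coeffA₂]
    push_cast
    rw [h, zero_mul]
  refine tableCorrect_of_split 1 (OddTorsionFamily.C2xC6.coeffA₁ a b)
    (OddTorsionFamily.C2xC6.coeffA₂ a b) (OddTorsionFamily.C2xC6.coeffA₃ a b) one_ne_zero
    (one_mul _).symm (by rw [one_pow, one_mul]) (by rw [one_pow, one_mul]) hE h1 ha₂
    (by rw [C2xC6_coeffA₃, Int.cast_mul, ha₂, zero_mul]) (fun hn ↦ ?_) (fun hn ↦ ?_)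
  · rw [C2xC6_intVal_Δ, hR', mul_zero, add_zero]
    constructor
    · rintro (⟨-, h, -⟩ | ⟨-, -, h, -⟩ | ⟨h, -⟩ | ⟨h, -⟩ | ⟨-, h, -, h', -⟩ | ⟨-, h, -, h'⟩ |
        ⟨h, -⟩ | ⟨h, -⟩)
      · exact h
      · simp [hR', hn.ne'] at h
      · simp at h
      · simp at h
      · simp [h2s h] at h'
      · simp [h2s h] at h'
      · simp at h
      · simp at h
    · exact fun h ↦ .inl ⟨rfl, h, h3b, h2a⟩
  · rintro (⟨h, -⟩ | ⟨h, -⟩ | ⟨-, -, h, -⟩ | ⟨-, h, -, h', -⟩ | ⟨h, -⟩ | ⟨h, -⟩ |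
      ⟨-, h, -, h'⟩ | ⟨-, h, -, h'⟩)
    · simp at h
    · simp at h
    · simp [hR', hn.ne'] at h
    · simp [h2s h] at h'
    · simp at h
    · simp at h
    · simp [h2s h] at h'
    · simp [h2s h] at h'

lemma tableCorrect_C2xC6_three [Fact (Nat.Prime 3)]
    (hE : (OddTorsionFamily.C2xC6.curve a b).IsElliptic) (ha : (a : ZMod 3) ≠ 0)
    (hb : b % 3 = 0) : TableCorrect .C2xC6 3 a b n := by
  obtain ⟨B, rfl⟩ := Int.dvd_of_emod_eq_zero hb
  refine tableCorrect_of_intVal_c₄_mod hE (j := 2) (by norm_num) ?_ fun ℓ hn ↦ ?_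
  -- For `b = 3B`, `c₄` is 9 times this form, which is `a⁸` modulo 3.
  · have h := intVal_pow_mul (p := 3) (m := 2) (x := (107 * a ^ 4 + 12 * a ^ 3 * B -
      270 * a ^ 2 * B ^ 2 + 108 * a * B ^ 3 + 27 * B ^ 4) ^ 2 -
      24 * (-19 * a ^ 2 + 6 * a * B + 9 * B ^ 2) * (2 * a * (3 * B - 5 * a) * (3 * B - a) ^ 2) *
        (B ^ 2 - a ^ 2)) ?_
    · rw [← h, originCurve_c₄]
      congr 1
      simp only [OddTorsionFamily.coeffA₁, OddTorsionFamily.coeffA₂, OddTorsionFamily.coeffA₃]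
      push_cast
      ring
    · rw [← ZMod.intCast_zmod_eq_zero_iff_dvd]
      push_cast
      refine fun h ↦ pow_ne_zero 8 ha (Eq.trans ?_ h)
      ring_nf
      reduce_mod_char
  · have h : intVal 3 (3 * B) ≠ 0 := by simp [three_mul_intVal]
    cases ℓ <;> simp [MultRedTable, h]

/-- Common frame for the lines `b = 3a`, `b = -3a` and `b = 9a`, on each of which `β` is `-3` times
a square. -/
lemma tableCorrect_C2xC6_of_double_root (hE : (OddTorsionFamily.C2xC6.curve a b).IsElliptic)
    (h5 : 5 ≤ p) (hP' : intVal p (2 * a * (b - 5 * a) * (b - a)) = 0)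
    {A₁ A₂ A₃ X y : ZMod p} (h1 : (OddTorsionFamily.C2xC6.coeffA₁ a b : ZMod p) = A₁)
    (h2 : (OddTorsionFamily.C2xC6.coeffA₂ a b : ZMod p) = A₂)
    (h3 : (OddTorsionFamily.C2xC6.coeffA₃ a b : ZMod p) = A₃) (hy : y ≠ 0)
    (hd : 6 * X ^ 2 + (A₁ ^ 2 + 4 * A₂) * X + A₁ * A₃ = 0)
    (hc : 4 * X ^ 3 + (A₁ ^ 2 + 4 * A₂) * X ^ 2 + 2 * (A₁ * A₃) * X + A₃ ^ 2 = 0)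
    (hβ : A₁ ^ 2 + 4 * A₂ + 12 * X = -3 * y ^ 2) : TableCorrect .C2xC6 p a b n := by
  have hp2 : p ≠ 2 := by omega
  have hv := C2xC6_intVal_Δ p a b
  rw [hP', mul_zero, zero_add] at hv
  refine tableCorrect_of_double_root (X := X) (r := 1) (s := 1) (y := y) (-3) hp2 hE h1 h2 h3
    one_ne_zero one_ne_zero (by linear_combination hd) (by linear_combination hc) ?_
    (by linear_combination hβ) (fun hn _ ↦ ?_) (fun hn _ ↦ ?_)
  · rw [mul_one, hβ]
    exact mul_ne_zero (neg_ne_zero.2 (three_cast_ne_zero (by omega))) (pow_ne_zero 2 hy)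
  · rw [hv, isSquare_neg_three_iff h5]
    simp only [MultRedTable, hP']
    simp [hn.ne', h5, hp2]
  · rw [hv, isSquare_neg_three_iff h5, ← modEq_five_iff h5]
    simp only [MultRedTable]
    simp [h5, hp2]

lemma tableCorrect_C2xC6_of_dvd (hE : (OddTorsionFamily.C2xC6.curve a b).IsElliptic) (h5 : 5 ≤ p)
    (hP' : intVal p (2 * a * (b - 5 * a) * (b - a)) = 0) (ha : (a : ZMod p) ≠ 0)
    (hR : ((b : ZMod p) ^ 2 - 9 * a ^ 2) * (b - 9 * a) = 0) : TableCorrect .C2xC6 p a b n := by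
  have h2 := two_cast_ne_zero (p := p) (by omega)
  have hR : ((b : ZMod p) - 3 * a) * (b + 3 * a) * (b - 9 * a) = 0 := by
    linear_combination hR
  rcases mul_eq_zero.1 hR with h | h
  · rcases mul_eq_zero.1 h with h | h
    · have hB : (b : ZMod p) = 3 * a := by linear_combination h
      refine tableCorrect_C2xC6_of_double_root hE h5 hP' (X := 0) (y := 2 ^ 2 * a ^ 2)
        (A₁ := -4 * a ^ 2) (A₂ := -16 * a ^ 4) (A₃ := 0) ?_ ?_ ?_
        (mul_ne_zero (pow_ne_zero _ h2) (pow_ne_zero _ ha)) (by ring) (by ring) (by ring) <;>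
      · push_cast [OddTorsionFamily.coeffA₁, OddTorsionFamily.coeffA₂, OddTorsionFamily.coeffA₃]
        rw [hB]
        ring
    · have hB : (b : ZMod p) = -3 * a := by linear_combination h
      refine tableCorrect_C2xC6_of_double_root hE h5 hP' (X := 0) (y := 2 ^ 4 * a ^ 2)
        (A₁ := -16 * a ^ 2) (A₂ := -256 * a ^ 4) (A₃ := 0) ?_ ?_ ?_
        (mul_ne_zero (pow_ne_zero _ h2) (pow_ne_zero _ ha)) (by ring) (by ring) (by ring) <;>
      · push_cast [OddTorsionFamily.coeffA₁, OddTorsionFamily.coeffA₂, OddTorsionFamily.coeffA₃]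
        rw [hB]
        ring
  · have hB : (b : ZMod p) = 9 * a := by linear_combination h
    refine tableCorrect_C2xC6_of_double_root hE h5 hP' (X := -768 * a ^ 4) (y := 2 ^ 4 * a ^ 2)
      (A₁ := 80 * a ^ 2) (A₂ := 512 * a ^ 4) (A₃ := 36864 * a ^ 6) ?_ ?_ ?_
      (mul_ne_zero (pow_ne_zero _ h2) (pow_ne_zero _ ha)) (by ring) (by ring) (by ring) <;>
    · push_cast [OddTorsionFamily.coeffA₁, OddTorsionFamily.coeffA₂, OddTorsionFamily.coeffA₃]
      rw [hB]
      ring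

lemma ZMod.intCast_eq_one_of_odd {x : ℤ} (hx : x % 2 = 1) : (x : ZMod 2) = 1 :=
  ZMod.eq_one_of_ne_zero_two _ (by
    rw [Ne, cast_zmod_eq_zero_iff]
    push_cast
    omega)

/-- Scaling by 4 makes `a₁` and `a₂` odd, while `a₃` keeps the even factor `u - a`. The node is the
non-split one at the origin, with `n = 2 v(u - a)`. -/
lemma tableCorrect_C2xC6_of_emod_four [Fact (Nat.Prime 2)]
    (hE : (OddTorsionFamily.C2xC6.curve a b).IsElliptic) {u : ℤ} (hu : b = a + 2 * u)
    (ha2 : a % 2 = 1) (hu2 : u % 2 = 1) : TableCorrect .C2xC6 2 a b n := by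
  have ha1 := ZMod.intCast_eq_one_of_odd ha2
  have hu1 := ZMod.intCast_eq_one_of_odd hu2
  have ha0 := intVal_two_eq_zero (x := a) (by omega)
  have hu0 := intVal_two_eq_zero (x := u) (by omega)
  have hΔ0 := OddTorsionFamily.Δ_ne_zero hE
  rw [C2xC6_Δ] at hΔ0
  obtain ⟨k, hk⟩ : ∃ k : ℕ, intVal 2 (u - a) = k := by
    refine intVal_eq_coe fun h ↦ hΔ0 ?_
    rw [hu, show u = a by linarith]
    ring
  have hs : intVal 2 (a + b) ≠ 0 := by
    rw [hu, show a + (a + 2 * u) = 2 * (a + u) by ring, two_mul_intVal]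
    simp
  have hd : intVal 2 (a - b) = 1 := by
    rw [hu, show a - (a + 2 * u) = 2 * -u by ring, two_mul_intVal, intVal_neg, hu0, add_zero]
  have h3 : intVal 2 (b - 3 * a) = 1 + k := by
    rw [hu, show a + 2 * u - 3 * a = 2 * (u - a) by ring, two_mul_intVal, hk]
  set a₁ := u ^ 2 + 2 * a * u - 4 * a ^ 2 with ha₁
  set a₂ := a * u ^ 2 * (u - 2 * a) with ha₂
  set a₃ := a₂ * ((u - a) * (u + 2 * a)) with ha₃
  have hv : intVal 2 (originCurve a₁ a₂ a₃).Δ = 2 * k := by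
    rw [show (originCurve a₁ a₂ a₃).Δ =
      (a * (u - 2 * a) * u) ^ 6 * ((u - a) * ((u + 2 * a) * (u - 4 * a))) ^ 2 by
        rw [originCurve_Δ]; ring,
      intVal_mul, intVal_pow, intVal_pow, intVal_mul, intVal_mul, intVal_mul, intVal_mul, hk, ha0,
      hu0, intVal_two_eq_zero (x := u - 2 * a) (by omega),
      intVal_two_eq_zero (x := u + 2 * a) (by omega),
      intVal_two_eq_zero (x := u - 4 * a) (by omega)]
    simp
  have h1 : (a₁ : ZMod 2) = 1 := by
    rw [ha₁]
    push_cast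
    rw [ha1, hu1]
    ring_nf
    reduce_mod_char
  have h2 : (a₂ : ZMod 2) = 1 := by
    rw [ha₂]
    push_cast
    rw [ha1, hu1]
    ring_nf
    reduce_mod_char
  refine tableCorrect_of_origin 4 a₁ a₂ a₃ four_ne_zero ?_ ?_ ?_ hE ?_ ?_
    (fun hn ↦ ?_) (fun hn ↦ ?_)
  · simp only [OddTorsionFamily.coeffA₁, hu, ha₁]
    ring
  · simp only [OddTorsionFamily.coeffA₂, hu, ha₂]
    ring
  · simp only [OddTorsionFamily.coeffA₃, hu, ha₃, ha₂]
    ring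
  · rw [h1, h2]
    ring_nf
    reduce_mod_char
    exact one_ne_zero
  · rw [ha₃]
    push_cast
    rw [ha1, hu1, sub_self, zero_mul, mul_zero]
  · rw [h1, h2]
    simp only [not_exists_sq_add_self_sub_one, and_false, iff_false]
    simp [MultRedTable, hs, hd]
  · rw [h1, h2, hv]
    simp only [not_exists_sq_add_self_sub_one, not_false_iff, and_true]
    simp only [MultRedTable, hd, h3]
    norm_cast
    simp
    omega

/-- Scaling by 16 makes `a₁` odd and `a₂ ≡ w`; `a₃` is even because it contains `w (a + w)`. The
parity of `w` decides splitness and is read off from `ab - b² = -4 (5a + 8w)(a + 2w) ≡ 12 - 8w`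
modulo 16. -/
lemma tableCorrect_C2xC6_of_emod_eight [Fact (Nat.Prime 2)]
    (hE : (OddTorsionFamily.C2xC6.curve a b).IsElliptic) {w : ℤ} (hw : b = 5 * a + 8 * w)
    (ha2 : a % 2 = 1) : TableCorrect .C2xC6 2 a b n := by
  have ha1 := ZMod.intCast_eq_one_of_odd ha2
  have ha0 := intVal_two_eq_zero (x := a) (by omega)
  have hΔ0 := OddTorsionFamily.Δ_ne_zero hE
  rw [C2xC6_Δ] at hΔ0
  obtain ⟨k, hk⟩ : ∃ k : ℕ, intVal 2 w = k := by
    refine intVal_eq_coe fun h ↦ hΔ0 ?_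
    rw [hw, h]
    ring
  obtain ⟨l, hl⟩ : ∃ l : ℕ, intVal 2 (a + w) = l := by
    refine intVal_eq_coe fun h ↦ hΔ0 ?_
    rw [hw, show w = -a by linarith]
    ring
  have hs : intVal 2 (a + b) ≠ 0 := by
    rw [hw, show a + (5 * a + 8 * w) = 2 * (3 * a + 4 * w) by ring, two_mul_intVal]
    simp
  have hd : intVal 2 (a - b) = 2 := by
    rw [hw, show a - (5 * a + 8 * w) = 2 * (2 * (-a - 2 * w)) by ring, two_mul_intVal,
      two_mul_intVal, intVal_two_eq_zero (by omega)]
    norm_num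
  have h5 : intVal 2 (b - 5 * a) = 3 + k := by
    rw [hw, show 5 * a + 8 * w - 5 * a = 2 * (2 * (2 * w)) by ring, two_mul_intVal,
      two_mul_intVal, two_mul_intVal, hk]
    norm_cast
    omega
  have h3 : intVal 2 (b + 3 * a) = 3 + l := by
    rw [hw, show 5 * a + 8 * w + 3 * a = 2 * (2 * (2 * (a + w))) by ring, two_mul_intVal,
      two_mul_intVal, two_mul_intVal, hl]
    norm_cast
    omega
  set a₁ := a ^ 2 + 6 * a * w + 4 * w ^ 2 with ha₁
  set a₂ := a * (a + 2 * w) ^ 2 * w with ha₂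
  set a₃ := a₂ * ((a + 4 * w) * (a + w)) with ha₃
  have hv : intVal 2 (originCurve a₁ a₂ a₃).Δ = 6 * k + 2 * l := by
    rw [show (originCurve a₁ a₂ a₃).Δ =
      (w * (a * (a + 2 * w))) ^ 6 * ((a + w) * ((a + 4 * w) * (2 * w - a))) ^ 2 by
        rw [originCurve_Δ]; ring,
      intVal_mul, intVal_pow, intVal_pow, intVal_mul, intVal_mul, intVal_mul, intVal_mul, hk, ha0,
      hl, intVal_two_eq_zero (x := a + 2 * w) (by omega),
      intVal_two_eq_zero (x := a + 4 * w) (by omega),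
      intVal_two_eq_zero (x := 2 * w - a) (by omega)]
    simp
  have h1 : (a₁ : ZMod 2) = 1 := by
    rw [ha₁]
    push_cast
    rw [ha1]
    ring_nf
    reduce_mod_char
  have h2 : (a₂ : ZMod 2) = w := by
    rw [ha₂]
    push_cast
    rw [ha1]
    ring_nf
    reduce_mod_char
  have e1 : OddTorsionFamily.C2xC6.coeffA₁ a b = 16 * a₁ := by
    simp only [OddTorsionFamily.coeffA₁, hw, ha₁]
    ring
  have e2 : OddTorsionFamily.C2xC6.coeffA₂ a b = 16 ^ 2 * a₂ := by
    simp only [OddTorsionFamily.coeffA₂, hw, ha₂]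
    ring
  have e3 : OddTorsionFamily.C2xC6.coeffA₃ a b = 16 ^ 3 * a₃ := by
    simp only [OddTorsionFamily.coeffA₃, hw, ha₃, ha₂]
    ring
  obtain ⟨c, rfl⟩ : ∃ c, a = 2 * c + 1 := ⟨a / 2, by omega⟩
  rcases Int.even_or_odd' w with ⟨v, hv' | hv'⟩
  · have hw2 : (w : ZMod 2) = 0 := cast_zmod_eq_zero_iff.2 (by push_cast; omega)
    have hmod : (2 * c + 1) * b - b ^ 2 ≡ 12 [ZMOD 16] := by
      refine (Int.modEq_iff_dvd.2 ⟨?_, ?_⟩)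
      · exact -(-5 * c ^ 2 - 5 * c - 2 - 9 * (2 * c + 1) * v - 16 * v ^ 2)
      · rw [hw, hv']
        ring
    have hmod' : ¬ (2 * c + 1) * b - b ^ 2 ≡ 4 [ZMOD 16] := by
      intro h
      have := h.symm.trans hmod
      revert this
      decide
    rw [hw2] at h2
    refine tableCorrect_of_split 16 a₁ a₂ a₃ (by norm_num) e1 e2 e3 hE
      (by rw [h1]; exact one_ne_zero) h2 (by rw [ha₃, Int.cast_mul, h2, zero_mul])
      (fun hn ↦ ?_) (fun hn ↦ ?_)
    · rw [hv]
      simp only [MultRedTable, hd, h5, h3, hmod]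
      norm_cast
      simp [hs]
      omega
    · simp only [MultRedTable, hd, hmod']
      norm_cast
      simp
  · have hw2 := ZMod.intCast_eq_one_of_odd (x := w) (by omega)
    have hmod : (2 * c + 1) * b - b ^ 2 ≡ 4 [ZMOD 16] := by
      refine (Int.modEq_iff_dvd.2 ⟨?_, ?_⟩)
      · exact -(-5 * c ^ 2 - 5 * c - 6 - 9 * (2 * c + 1) * v - 9 * c - 4 * w ^ 2)
      · rw [hw, hv']
        ring
    have hmod' : ¬ (2 * c + 1) * b - b ^ 2 ≡ 12 [ZMOD 16] := by
      intro h
      have := h.symm.trans hmod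
      revert this
      decide
    rw [hw2] at h2
    refine tableCorrect_of_origin 16 a₁ a₂ a₃ (by norm_num) e1 e2 e3 hE ?_ ?_
      (fun hn ↦ ?_) (fun hn ↦ ?_)
    · rw [h1, h2]
      ring_nf
      reduce_mod_char
      exact one_ne_zero
    · rw [ha₃]
      push_cast
      rw [hw2, h2]
      push_cast at ha1
      rw [ha1]
      ring_nf
      reduce_mod_char
    · rw [h1, h2]
      simp only [not_exists_sq_add_self_sub_one, and_false, iff_false]
      simp only [MultRedTable, hd, hmod']
      norm_cast
      simp [hs]
    · rw [h1, h2, hv]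
      simp only [not_exists_sq_add_self_sub_one, not_false_iff, and_true]
      simp only [MultRedTable, hd, h5, h3, hmod]
      norm_cast
      simp
      omega

/-- Scaling by 16 leaves `a₁` odd, `a₂` even and `a₃ ≡ w`: a split node at the origin for even `w`,
and `y² + xy + y = x³` for odd `w`. In `v(Δ) = 6 v(w) + 2 v(w - a)` only one summand can be nonzero,
as `a` is odd. -/
lemma tableCorrect_C2xC6_of_eight_dvd [Fact (Nat.Prime 2)]
    (hE : (OddTorsionFamily.C2xC6.curve a b).IsElliptic) {w : ℤ} (hw : b = a + 8 * w)
    (ha2 : a % 2 = 1) : TableCorrect .C2xC6 2 a b n := by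
  have ha1 := ZMod.intCast_eq_one_of_odd ha2
  have ha0 := intVal_two_eq_zero (x := a) (by omega)
  have hΔ0 := OddTorsionFamily.Δ_ne_zero hE
  rw [C2xC6_Δ] at hΔ0
  obtain ⟨k, hk⟩ : ∃ k : ℕ, intVal 2 w = k := by
    refine intVal_eq_coe fun h ↦ hΔ0 ?_
    rw [hw, h]
    ring
  obtain ⟨l, hl⟩ : ∃ l : ℕ, intVal 2 (w - a) = l := by
    refine intVal_eq_coe fun h ↦ hΔ0 ?_
    rw [hw, show w = a by linarith]
    ring
  have hs : intVal 2 (a + b) ≠ 0 := by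
    rw [hw, show a + (a + 8 * w) = 2 * (a + 4 * w) by ring, two_mul_intVal]
    simp
  have hd' : intVal 2 (b - a) = 3 + k := by
    rw [hw, show a + 8 * w - a = 2 * (2 * (2 * w)) by ring, two_mul_intVal,
      two_mul_intVal, two_mul_intVal, hk]
    norm_cast
    omega
  have hd : intVal 2 (a - b) = 3 + k := by
    rw [← neg_sub, intVal_neg, hd']
  have h9 : intVal 2 (b - 9 * a) = 3 + l := by
    rw [hw, show a + 8 * w - 9 * a = 2 * (2 * (2 * (w - a))) by ring, two_mul_intVal,
      two_mul_intVal, two_mul_intVal, hl]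
    norm_cast
    omega
  set a₁ := 4 * w ^ 2 + 2 * a * w - a ^ 2 with ha₁
  set a₂ := 2 * (a * w ^ 2 * (2 * w - a)) with ha₂
  set a₃ := a * w ^ 2 * (2 * w - a) * (4 * w - a) * (2 * w + a) with ha₃
  have hv : intVal 2 (originCurve a₁ a₂ a₃).Δ = 6 * k + 2 * l := by
    rw [show (originCurve a₁ a₂ a₃).Δ =
      (w * (a * (2 * w - a))) ^ 6 * ((w - a) * ((4 * w - a) * (2 * w + a))) ^ 2 by
        rw [originCurve_Δ]; ring,
      intVal_mul, intVal_pow, intVal_pow, intVal_mul, intVal_mul, intVal_mul, intVal_mul, hk, ha0,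
      hl, intVal_two_eq_zero (x := 2 * w + a) (by omega),
      intVal_two_eq_zero (x := 4 * w - a) (by omega),
      intVal_two_eq_zero (x := 2 * w - a) (by omega)]
    simp
  have h1 : (a₁ : ZMod 2) = 1 := by
    rw [ha₁]
    push_cast
    rw [ha1]
    ring_nf
    reduce_mod_char
  have h2 : (a₂ : ZMod 2) = 0 := by
    rw [ha₂, cast_zmod_eq_zero_iff]
    push_cast
    omega
  have e1 : OddTorsionFamily.C2xC6.coeffA₁ a b = 16 * a₁ := by
    simp only [OddTorsionFamily.coeffA₁, hw, ha₁]
    ring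
  have e2 : OddTorsionFamily.C2xC6.coeffA₂ a b = 16 ^ 2 * a₂ := by
    simp only [OddTorsionFamily.coeffA₂, hw, ha₂]
    ring
  have e3 : OddTorsionFamily.C2xC6.coeffA₃ a b = 16 ^ 3 * a₃ := by
    simp only [OddTorsionFamily.coeffA₃, hw, ha₃]
    ring
  rcases Int.emod_two_eq_zero_or_one w with hw2 | hw2
  · have hl0 : l = 0 := by
      rw [intVal_two_eq_zero (by omega)] at hl
      exact_mod_cast hl.symm
    have hk0 : k ≠ 0 := by
      rintro rfl
      exact intVal_eq_zero_iff.1 hk (Int.dvd_of_emod_eq_zero hw2)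
    have hw0 : (w : ZMod 2) = 0 := cast_zmod_eq_zero_iff.2 hw2
    refine tableCorrect_of_split 16 a₁ a₂ a₃ (by norm_num) e1 e2 e3 hE
      (by rw [h1]; exact one_ne_zero) h2 ?_ (fun hn ↦ ?_) (fun hn ↦ ?_)
    · rw [ha₃]
      push_cast
      rw [hw0]
      ring
    · rw [hv]
      simp only [MultRedTable, hd, hd', hl0]
      norm_cast
      simp [hs]
      omega
    · simp only [MultRedTable, hd]
      norm_cast
      simp
      omega
  · have hk0 : k = 0 := by
      rw [intVal_two_eq_zero (by omega)] at hk
      exact_mod_cast hk.symm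
    have hw1 := ZMod.intCast_eq_one_of_odd hw2
    have h3 : (a₃ : ZMod 2) = 1 := by
      rw [ha₃]
      push_cast
      rw [ha1, hw1]
      ring_nf
      reduce_mod_char
    obtain ⟨h4, hns⟩ := c₄_ne_zero_and_not_nodeSplits
    refine tableCorrect_of_scaled 16 a₁ a₂ a₃ (by norm_num) e1 e2 e3 hE
      (by rwa [h1, h2, h3]) (fun hn ↦ ?_) (fun hn ↦ ?_)
    · rw [h1, h2, h3]
      simp only [hns, and_false, iff_false]
      simp only [MultRedTable, hd, hk0]
      norm_cast
      simp [hs]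
    · rw [h1, h2, h3, hv]
      simp only [hns, not_false_iff, and_true]
      simp only [MultRedTable, hd, h9, hk0]
      norm_cast
      simp
      omega

lemma tableCorrect_C2xC6_two [Fact (Nat.Prime 2)]
    (hE : (OddTorsionFamily.C2xC6.curve a b).IsElliptic) (ha : a % 2 = 1) (hb : b % 2 = 1) :
    TableCorrect .C2xC6 2 a b n := by
  -- For odd `a`, `b ≡ 5a` modulo 8 is the same as `b - a ≡ 4` modulo 8.
  rcases (show (b - a) % 4 = 2 ∨ (b - 5 * a) % 8 = 0 ∨ (b - a) % 8 = 0 by omega) with h | h | h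
  · exact tableCorrect_C2xC6_of_emod_four hE (u := (b - a) / 2) (by omega) ha (by omega)
  · exact tableCorrect_C2xC6_of_emod_eight hE (w := (b - 5 * a) / 8) (by omega) ha
  · exact tableCorrect_C2xC6_of_eight_dvd hE (w := (b - a) / 8) (by omega) ha

theorem tableCorrect_C2xC6 (hab : IsCoprime a b)
    (hE : (OddTorsionFamily.C2xC6.curve a b).IsElliptic) : TableCorrect .C2xC6 p a b n := by
  have hco := cast_ne_zero_of_isCoprime (p := p) hab
  by_cases h2 : p = 2 ∧ (a + b : ZMod p) = 0
  · obtain ⟨rfl, h⟩ := h2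
    rw [← Int.cast_add, cast_zmod_eq_zero_iff] at h
    rw [cast_zmod_eq_zero_iff, cast_zmod_eq_zero_iff] at hco
    push_cast at h hco
    exact tableCorrect_C2xC6_two hE (by omega) (by omega)
  by_cases h3 : p = 3 ∧ (b : ZMod p) = 0
  · obtain ⟨rfl, hb⟩ := h3
    exact tableCorrect_C2xC6_three hE (fun ha ↦ hco ⟨ha, hb⟩) (cast_zmod_eq_zero_iff.1 hb)
  rw [not_and] at h2 h3
  by_cases hP : (2 * a * (b - 5 * a) * (b - a) : ZMod p) = 0
  · exact tableCorrect_C2xC6_of_dvd_mul hab hE h2 h3 hP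
  have h5 : 5 ≤ p := by
    rcases eq_two_or_eq_three_or_five_le p with rfl | rfl | h5
    -- The explicit factor 2 kills the product at `p = 2`.
    · refine (hP ?_).elim
      reduce_mod_char
    · exact (hP (C2xC6_mul_eq_zero_mod_three _ _ (h3 rfl))).elim
    · exact h5
  have hP' : intVal p (2 * a * (b - 5 * a) * (b - a)) = 0 :=
    intVal_eq_zero_of_ne (by push_cast; exact hP)
  have ha : (a : ZMod p) ≠ 0 := by
    rintro ha
    simp [ha] at hP
  by_cases hR : ((b : ZMod p) ^ 2 - 9 * a ^ 2) * (b - 9 * a) = 0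
  · exact tableCorrect_C2xC6_of_dvd hE h5 hP' ha hR
  have hR' : intVal p ((b ^ 2 - 9 * a ^ 2) * (b - 9 * a)) = 0 :=
    intVal_eq_zero_of_ne (by push_cast; exact hR)
  have hp2 : p ≠ 2 := by omega
  refine tableCorrect_of_intVal_Δ_eq_zero hE ?_ (fun ℓ hn ↦ ?_)
  · rw [C2xC6_intVal_Δ, hP', hR']
    simp
  · cases ℓ <;> simp only [MultRedTable, hP', hR'] <;> simp [hn.ne', hp2]

end C2xC6

/-! ### The table for all families. -/

theorem mainTheorem1 (T : OddTorsionFamily) (a b : ℤ) (hab : IsCoprime a b)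
    (hE : (T.curve a b).IsElliptic) (p : ℕ) [Fact p.Prime] (n : ℕ) :
    (HasMultiplicativeReductionOfType (T.curve a b) p n ↔
      0 < n ∧ ∃ ℓ : ReductionLabel, MultRedTable T p a b n ℓ) ∧
    (HasSplitMultiplicativeReductionOfType (T.curve a b) p n ↔
      0 < n ∧ MultRedTable T p a b n .S) ∧
    (HasNonsplitMultiplicativeReductionOfType (T.curve a b) p n ↔
      0 < n ∧ MultRedTable T p a b n .NS) := by
  cases T
  · exact tableCorrect_C3 hab hE
  · exact tableCorrect_C5 hab hE
  · exact tableCorrect_C6 hab hE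
  · exact tableCorrect_C7 hab hE
  · exact tableCorrect_C9 hab hE
  · exact tableCorrect_C10 hab hE
  · exact tableCorrect_C12 hab hE
  · exact tableCorrect_C2xC6 hab hE
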